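/- Let $k$ be an algebraically closed field of characteristic $p>0$ with ring of Witt vectors $W(k)$, and let $\sigma$ denote the Frobenius. Let $(N,F)$ be an isocrystal over $k$ (a finite-dimensional $\mathrm{Quot}(W(k))$-vector space with a $\sigma$-linear bijection $F$; put $V=pF^{-1}$) together with a decomposition $N=\bigoplus_{j=1}^{j_0}\bigoplus_{i=1}^{l_j}N_{j,i}$ into simple isocrystals, where $j_0\ge 1$, $l_j\ge 1$, and $N_{j,i}$ has slope $\lambda_j=m_j/h_j$ with $h_j=m_j+n_j$, $m_j,n_j\ge 1$ coprime integers and $\lambda_1<\dots<\lambda_{j_0}$. Choose $0\ne e_{ji0}\in N_{j,i}$ with $F^{h_j}e_{ji0}=p^{m_j}e_{ji0}$, choose $\alpha_j,\beta_j\in\mathbb Z$ with $\alpha_jh_j+\beta_jm_j=1$, and put $\pi_j=p^{\alpha_j}F^{\beta_j}$ and $e_{jil}=\pi_j^l e_{ji0}$ for $l\in\mathbb Z$. Let $J$ be the group of $\mathrm{Quot}(W(k))$-linear automorphisms of $N$ commuting with $F$. Let $K\supseteq k$ be a perfect field and let $N_K=N\otimes_{\mathrm{Quot}(W(k))}\mathrm{Quot}(W(K))$,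 with $F$ and $V$ extended semilinearly. Write $[x]\in W(K)$ for the Teichmüller representative of $x\in K$. Let $M_0\subset N_K$ be the $W(K)$-lattice generated by the $e_{jil}$ with $l\ge 0$. For a lattice $M\subset N_K$ put $\mathrm{vol}(M)=\mathrm{lg}(M_0/(M_0\cap M))-\mathrm{lg}(M/(M_0\cap M))$ (lengths over $W(K)$). A $\mathcal D(K)$-submodule of $N_K$ is a $W(K)$-submodule stable under $F$ and $V$. A family $(a_{jil})_{j,i,\,l\ge 0}$ in $K$ is said to satisfy $(*)$ if for each $j$ the elements $a_{ji0}$, $1\le i\le l_j$, are linearly independent over $\mathbb F_{p^{h_j}}\subset K$. The pairs $(j,i)$ and the triples $(j,i,l)$ are ordered lexicographically. **Theorem.** Let $g\in J$, let $(a_{jil})$ satisfy $(*)$, let $$v=\sum_{j=1}^{j_0}\sum_{i=1}^{l_j}\sum_{l\ge 0}[a_{jil}]\,g(e_{jil})\in N_K$$ ($p$-adically convergent sum), and let $M$ be the smallest $\mathcal D(K)$-submodule of $N_K$ containing $v$. Then: (i) $M$ is a lattice in $N_K$. (ii) $\mathrm{vol}(M)=v_p(\det g)+c$, where $$c=\sum_{j}l_j\frac{(m_j-1)(n_j-1)}2+\sum_{(j,i)<(j',i')}m_jn_{j'}.$$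 (iii) Let $I$ be the set of triples $(j,i,l)$, $l\ge 0$, that are not of the form $l=am_j+bn_j+\sum_{(j',i')<(j,i)}m_{j'}n_j$ with integers $a,b\ge 0$. Then $I$ is finite with $|I|=c$, $(1,1,0)\notin I$, and $(j,i,0)\in I$ for $(j,i)\ne(1,1)$. There is an element $w=\sum_{j,i}\sum_{l\ge0}[b_{jil}]\,g(e_{jil})\in M$ such that $(b_{jil})$ satisfies $(*)$, $b_{110}=1$, and $b_{jil}=0$ whenever $(1,1,0)\ne(j,i,l)\notin I$. Every such $w$ generates $M$ as a $\mathcal D(K)$-module (it is called a normalised generator of $M$), and $w$ is uniquely determined by $M$ and $g$. (iv) Every $x\in M$ can be written as $x=\sum_{j,i}\sum_{l\ge0}[b_{jil}]\,g(e_{jil})$ with $b_{jil}\in K$, and for every nonzero $x\in M$ the index of the first nonzero summand of such an expression is not in $I$. (v) For every $(j,i,l)\notin I$ (with $l\ge 0$) there is an $x\in M$ with an expression as in (iv) whose first nonzero coefficient is $[b_{jil}]$. -/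

import Mathlib

open scoped Isocrystal TensorProduct

noncomputable section

namespace Dieudonne

section Frobenius

variable (p : ℕ) [Fact p.Prime]
variable (k : Type*) [Field k] [CharP k p] [PerfectRing k p]
variable (N : Type*) [AddCommGroup N] [WittVector.Isocrystal p k N]

/-- The Frobenius `F` of an isocrystal `N` over `k`. -/
abbrev frob : N ≃ᶠˡ[p, k] N := WittVector.Isocrystal.frobenius p k

/-- `F` as a permutation of `N`, so that its integral powers make sense. -/
def F : Equiv.Perm N := (frob p k N).toEquiv

end Frobenius

section BaseChange

variable (p : ℕ) [Fact p.Prime]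
variable (k : Type*) [Field k] [CharP k p] [PerfectRing k p]
variable (K : Type*) [Field K] [CharP K p] [PerfectRing K p] [Algebra k K]

/-- The map `Quot(W(k)) → Quot(W(K))` induced by `k → K`. -/
def fracMap : K(p, k) →+* K(p, K) :=
  IsFractionRing.lift (A := WittVector p k)
    (g := (algebraMap (WittVector p K) K(p, K)).comp (WittVector.map (algebraMap k K)))
    ((IsFractionRing.injective (WittVector p K) K(p, K)).comp
      (WittVector.map_injective _ (algebraMap k K).injective))

theorem fracMap_algebraMap (x : WittVector p k) :
    fracMap p k K (algebraMap (WittVector p k) K(p, k) x) =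
      algebraMap (WittVector p K) K(p, K) (WittVector.map (algebraMap k K) x) :=
  IsFractionRing.lift_algebraMap _ x

theorem frobenius_algebraMap (x : WittVector p k) :
    φ(p, k) (algebraMap (WittVector p k) K(p, k) x) =
      algebraMap (WittVector p k) K(p, k) (WittVector.frobenius x) :=
  IsFractionRing.ringEquivOfRingEquiv_algebraMap (WittVector.frobeniusEquiv p k) x

theorem frobenius_fracMap (c : K(p, k)) :
    φ(p, K) (fracMap p k K c) = fracMap p k K (φ(p, k) c) := by
  have h : (φ(p, K)).comp (fracMap p k K) = (fracMap p k K).comp φ(p, k) := by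
    apply IsLocalization.ringHom_ext (nonZeroDivisors (WittVector p k))
    ext x : 1
    simp only [RingHom.comp_apply, frobenius_algebraMap, fracMap_algebraMap,
      WittVector.frobenius_eq_map_frobenius]
    congr 1
    ext n
    simp only [WittVector.map_coeff, frobenius_def, map_pow]
  exact DFunLike.congr_fun h c

theorem frobenius_symm_fracMap (c : K(p, k)) :
    (WittVector.FractionRing.frobenius p K).symm (fracMap p k K c) =
      fracMap p k K ((WittVector.FractionRing.frobenius p k).symm c) := by
  rw [RingEquiv.symm_apply_eq]
  have h := frobenius_fracMap p k K ((WittVector.FractionRing.frobenius p k).symm c)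
  have h' : φ(p, k) ((WittVector.FractionRing.frobenius p k).symm c) = c :=
    (WittVector.FractionRing.frobenius p k).apply_symm_apply c
  rw [h'] at h
  exact h.symm

/-- `Quot(W(K))` as an algebra over `Quot(W(k))`; only used to form base changes. -/
@[reducible] def fracAlgebra : Algebra K(p, k) K(p, K) := (fracMap p k K).toAlgebra

attribute [local instance] fracAlgebra

variable (N : Type*) [AddCommGroup N] [WittVector.Isocrystal p k N]

/-- The base change `N_K = Quot(W(K)) ⊗ N` over `Quot(W(k))`. -/
def BaseChange : Type _ := K(p, K) ⊗[K(p, k)] N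

instance : AddCommGroup (BaseChange p k K N) :=
  inferInstanceAs (AddCommGroup (K(p, K) ⊗[K(p, k)] N))

instance : Module K(p, K) (BaseChange p k K N) :=
  inferInstanceAs (Module K(p, K) (K(p, K) ⊗[K(p, k)] N))

variable {p k K N}

/-- The base change `τ ⊗ f` of a `τ₀`-semilinear map `f`, where `τ` extends `τ₀`. -/
def semiBaseChange {τ : K(p, K) →+* K(p, K)} {τ₀ : K(p, k) →+* K(p, k)}
    (hτ : ∀ c, τ (fracMap p k K c) = fracMap p k K (τ₀ c)) (f : N →ₛₗ[τ₀] N) :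
    (K(p, K) ⊗[K(p, k)] N) →+ (K(p, K) ⊗[K(p, k)] N) :=
  TensorProduct.liftAddHom
    (AddMonoidHom.mk' (fun x : K(p, K) => AddMonoidHom.mk'
        (fun y : N => τ x ⊗ₜ[K(p, k)] f.toFun y)
        (fun y z => by rw [f.map_add', TensorProduct.tmul_add]))
      (fun x y => by
        ext z
        simp only [AddMonoidHom.mk'_apply, AddMonoidHom.add_apply, map_add,
          TensorProduct.add_tmul]))
    (fun c x y => by
      have h : τ (c • x) = τ₀ c • τ x := by
        rw [Algebra.smul_def, Algebra.smul_def, map_mul]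
        exact congrArg (· * τ x) (hτ c)
      have h' : f.toFun (c • y) = τ₀ c • f.toFun y := f.map_smul' c y
      simp only [AddMonoidHom.mk'_apply, h, h', TensorProduct.smul_tmul])

theorem semiBaseChange_tmul {τ : K(p, K) →+* K(p, K)} {τ₀ : K(p, k) →+* K(p, k)}
    (hτ : ∀ c, τ (fracMap p k K c) = fracMap p k K (τ₀ c)) (f : N →ₛₗ[τ₀] N)
    (x : K(p, K)) (y : N) :
    semiBaseChange hτ f (x ⊗ₜ[K(p, k)] y) = τ x ⊗ₜ[K(p, k)] f.toFun y :=
  TensorProduct.liftAddHom_tmul _ _ _ _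

theorem semiBaseChange_smul {τ : K(p, K) →+* K(p, K)} {τ₀ : K(p, k) →+* K(p, k)}
    (hτ : ∀ c, τ (fracMap p k K c) = fracMap p k K (τ₀ c)) (f : N →ₛₗ[τ₀] N)
    (c : K(p, K)) (x : K(p, K) ⊗[K(p, k)] N) :
    semiBaseChange hτ f (c • x) = τ c • semiBaseChange hτ f x := by
  induction x using TensorProduct.induction_on with
  | zero => rw [smul_zero, map_zero, smul_zero]
  | tmul x y =>
    rw [TensorProduct.smul_tmul', semiBaseChange_tmul, semiBaseChange_tmul,
      TensorProduct.smul_tmul', smul_eq_mul, smul_eq_mul, map_mul]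
  | add x y hx hy => rw [smul_add, map_add, map_add, smul_add, hx, hy]

theorem semiBaseChange_comp {τ τ' : K(p, K) →+* K(p, K)} {τ₀ τ₀' : K(p, k) →+* K(p, k)}
    (hτ : ∀ c, τ (fracMap p k K c) = fracMap p k K (τ₀ c)) (f : N →ₛₗ[τ₀] N)
    (hτ' : ∀ c, τ' (fracMap p k K c) = fracMap p k K (τ₀' c)) (f' : N →ₛₗ[τ₀'] N)
    (h : ∀ c, τ' (τ c) = c) (hf : ∀ y, f'.toFun (f.toFun y) = y)
    (x : K(p, K) ⊗[K(p, k)] N) :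
    semiBaseChange hτ' f' (semiBaseChange hτ f x) = x := by
  induction x using TensorProduct.induction_on with
  | zero => rw [map_zero, map_zero]
  | tmul x y => rw [semiBaseChange_tmul, semiBaseChange_tmul, h, hf]
  | add x y hx hy => rw [map_add, map_add, hx, hy]

variable (p k K N)

/-- The Frobenius `σ ⊗ F` on `Quot(W(K)) ⊗ N`. -/
def frobBaseChange : (K(p, K) ⊗[K(p, k)] N) ≃ᶠˡ[p, K] (K(p, K) ⊗[K(p, k)] N) :=
  have h₁ : ∀ y : N, (frob p k N).symm.toLinearMap.toFun
      ((frob p k N).toLinearMap.toFun y) = y := fun y => (frob p k N).left_inv y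
  have h₂ : ∀ y : N, (frob p k N).toLinearMap.toFun
      ((frob p k N).symm.toLinearMap.toFun y) = y := fun y => (frob p k N).right_inv y
  LinearEquiv.mk
    { toFun := fun x => semiBaseChange (frobenius_fracMap p k K) (frob p k N).toLinearMap x
      map_add' := fun x y => map_add (semiBaseChange _ _) x y
      map_smul' := fun c x => semiBaseChange_smul (frobenius_fracMap p k K) _ c x }
    (fun x => semiBaseChange (τ := (WittVector.FractionRing.frobenius p K).symm.toRingHom)
      (τ₀ := ((WittVector.FractionRing.frobenius p k).symm : K(p, k) →+* K(p, k)))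
      (frobenius_symm_fracMap p k K) (frob p k N).symm.toLinearMap x)
    (fun x => semiBaseChange_comp _ _ _ _
        (WittVector.FractionRing.frobenius p K).symm_apply_apply h₁ x)
    (fun x => semiBaseChange_comp _ _ _ _
        (WittVector.FractionRing.frobenius p K).apply_symm_apply h₂ x)

/-- `N_K` with the Frobenius `σ ⊗ F`. -/
instance : WittVector.Isocrystal p K (BaseChange p k K N) where
  frob := frobBaseChange p k K N

instance : Module (WittVector p K) (BaseChange p k K N) :=
  Module.compHom _ (algebraMap (WittVector p K) K(p, K))

instance : IsScalarTower (WittVector p K) K(p, K) (BaseChange p k K N) where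
  smul_assoc a b x := by
    rw [Algebra.smul_def, mul_smul]
    rfl

variable {N}

/-- The canonical map `N → N_K`, `x ↦ 1 ⊗ x`. -/
def toBaseChange (x : N) : BaseChange p k K N :=
  (1 ⊗ₜ[K(p, k)] x : K(p, K) ⊗[K(p, k)] N)

theorem F_toBaseChange (x : N) :
    F p K _ (toBaseChange p k K x) = toBaseChange p k K (F p k N x) := by
  refine (semiBaseChange_tmul (frobenius_fracMap p k K) _ 1 x).trans ?_
  rw [map_one]
  rfl

end BaseChange

section Modules

variable (p : ℕ) [Fact p.Prime]
variable (K : Type*) [Field K] [CharP K p] [PerfectRing K p]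

/-- The `p`-adic valuation on `Quot(W(K))`, with `v_p(p) = 1` (and junk value `0` at `0`). -/
def vp (x : K(p, K)) : ℤ :=
  -WithZero.log ((IsDiscreteValuationRing.maximalIdeal (WittVector p K)).valuation K(p, K) x)

variable {K} {X : Type*} [AddCommGroup X] [WittVector.Isocrystal p K X]

/-- The Verschiebung `V = p F⁻¹`. -/
def versch (x : X) : X := (p : K(p, K)) • (F p K X)⁻¹ x

/-- A nonzero `F`-stable subspace without proper nonzero `F`-stable subspaces. -/
def IsSimpleSubisocrystal (S : Submodule K(p, K) X) : Prop :=
  S ≠ ⊥ ∧ (∀ x ∈ S, F p K X x ∈ S) ∧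
    ∀ T : Submodule K(p, K) X, T ≤ S → (∀ x ∈ T, F p K X x ∈ T) → T = ⊥ ∨ T = S

variable [Module (WittVector p K) X]

/-- `𝒟(K)`-submodules: `W(K)`-submodules stable under `F` and `V`. -/
def IsDieudonneSubmodule (M : Submodule (WittVector p K) X) : Prop :=
  (∀ x ∈ M, F p K X x ∈ M) ∧ ∀ x ∈ M, versch p (K := K) x ∈ M

/-- The smallest `𝒟(K)`-submodule containing `v`. -/
def dieudonneSpan (v : X) : Submodule (WittVector p K) X :=
  sInf {M | v ∈ M ∧ IsDieudonneSubmodule p M}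

variable {p}

/-- The volume of `M` relative to `M₀`: `lg(M₀/(M₀ ∩ M)) - lg(M/(M₀ ∩ M))`. -/
def relVol (M₀ M : Submodule (WittVector p K) X) : ℤ :=
  ((Module.length (WittVector p K) (M₀ ⧸ (M₀ ⊓ M).submoduleOf M₀)).toNat : ℤ) -
    ((Module.length (WittVector p K) (M ⧸ (M₀ ⊓ M).submoduleOf M)).toNat : ℤ)

end Modules

/-- The numerical data of a nonzero bi-infinitesimal isocrystal: there are `r > 0` slopes
`m j / (m j + n j)` in `(0, 1)`, in lowest terms and strictly increasing in `j`, with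
multiplicities `l j > 0`. -/
structure SlopeData where
  r : ℕ
  r_pos : 0 < r
  l : Fin r → ℕ
  m : Fin r → ℕ
  n : Fin r → ℕ
  l_pos : ∀ j, 0 < l j
  m_pos : ∀ j, 0 < m j
  n_pos : ∀ j, 0 < n j
  coprime : ∀ j, Nat.Coprime (m j) (n j)
  slope_lt : ∀ j j', j < j' → (m j : ℚ) / (m j + n j) < (m j' : ℚ) / (m j' + n j')

namespace SlopeData

variable (D : SlopeData)

/-- The denominator `h_j = m_j + n_j` of the slope. -/
def h (j : Fin D.r) : ℕ := D.m j + D.n j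

/-- The pairs `(j, i)` (counted from `0`). -/
abbrev Slot : Type := Σ j : Fin D.r, Fin (D.l j)

/-- The triples `(j, i, l)` with `l ≥ 0`. -/
abbrev Index : Type := D.Slot × ℕ

/-- The first pair, called `(1, 1)` when counting from `1`. -/
def first : D.Slot := ⟨⟨0, D.r_pos⟩, ⟨0, D.l_pos _⟩⟩

/-- Lexicographic order on the pairs `(j, i)`. -/
def SlotLt (s t : D.Slot) : Prop :=
  s.1 < t.1 ∨ (s.1 = t.1 ∧ (s.2 : ℕ) < (t.2 : ℕ))

/-- Lexicographic order on the triples `(j, i, l)`. -/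
def IndexLt (x y : D.Index) : Prop :=
  D.SlotLt x.1 y.1 ∨ (x.1 = y.1 ∧ x.2 < y.2)

open Classical in
/-- The constant `c`. -/
def c : ℚ :=
  ∑ j, (D.l j : ℚ) * (((D.m j : ℚ) - 1) * ((D.n j : ℚ) - 1) / 2) +
    ∑ x : D.Slot × D.Slot with D.SlotLt x.1 x.2, (D.m x.1.1 : ℚ) * (D.n x.2.1 : ℚ)

open Classical in
/-- The index set `I`, given through its complement. -/
def I : Set D.Index :=
  {x | ∃ a b : ℕ, x.2 = a * D.m x.1.1 + b * D.n x.1.1 +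
    ∑ s : D.Slot with D.SlotLt s x.1, D.m s.1 * D.n x.1.1}ᶜ

/-- `t` is the first index at which the coefficient of `b` is nonzero. -/
def IsLeading {D : SlopeData} {K : Type*} [Field K] (b : D.Slot → ℕ → K) (t : D.Index) : Prop :=
  b t.1 t.2 ≠ 0 ∧ ∀ u : D.Index, D.IndexLt u t → b u.1 u.2 = 0

/-- For each `j` the `a_{ji0}` are linearly independent over the subfield `𝔽_{p^{h_j}}` of `K`,
that is, over the subfield of all `x` with `x ^ (p ^ h_j) = x`. -/
def LeadingIndependent {D : SlopeData} (p : ℕ) [Fact p.Prime] {K : Type*} [Field K] [CharP K p]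
    (a : D.Slot → ℕ → K) : Prop :=
  ∀ j : Fin D.r, LinearIndependent
    ((iterateFrobenius K p (D.h j)).eqLocusField (RingHom.id K))
    (fun i : Fin (D.l j) => a ⟨j, i⟩ 0)

end SlopeData

section Main

variable (p : ℕ) [Fact p.Prime]
variable (k : Type*) [Field k] [CharP k p] [PerfectRing k p]
variable (N : Type*) [AddCommGroup N] [WittVector.Isocrystal p k N]

/-- A decomposition of `N` into simple isocrystals `N_{j,i}` together with nonzero elements
`e_{ji0} ∈ N_{j,i}` such that `F^{h_j} e_{ji0} = p^{m_j} e_{ji0}` (so `N_{j,i}` has slope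
`m_j / h_j`). -/
structure Decomposition (D : SlopeData) where
  comp : D.Slot → Submodule K(p, k) N
  isInternal : DirectSum.IsInternal comp
  isSimple : ∀ s, IsSimpleSubisocrystal p (comp s)
  e₀ : D.Slot → N
  e₀_mem : ∀ s, e₀ s ∈ comp s
  e₀_ne_zero : ∀ s, e₀ s ≠ 0
  frob_e₀ : ∀ s, (F p k N ^ D.h s.1) (e₀ s) = (p : K(p, k)) ^ D.m s.1 • e₀ s

variable {p k N} {D : SlopeData} (E : Decomposition p k N D) (α β : Fin D.r → ℤ)

/-- The map `p^{α_j} F^{β_j}` as a permutation of `N`; on `N_{λ_j}` it is the map `π_j`. -/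
def piPerm (p : ℕ) [Fact p.Prime] (k : Type*) [Field k] [CharP k p] [PerfectRing k p]
    (N : Type*) [AddCommGroup N] [WittVector.Isocrystal p k N] (α β : ℤ) : Equiv.Perm N :=
  (LinearEquiv.smulOfNeZero K(p, k) N ((p : K(p, k)) ^ α)
    (zpow_ne_zero α (WittVector.FractionRing.p_nonzero p k))).toEquiv * F p k N ^ β

/-- `e_{jil} = π_j^l e_{ji0}` for `l ∈ ℤ`. -/
def Decomposition.e (s : D.Slot) (l : ℤ) : N :=
  (piPerm p k N (α s.1) (β s.1) ^ l) (E.e₀ s)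

variable (K : Type*) [Field K] [CharP K p] [PerfectRing K p] [Algebra k K]

/-- The lattice `M₀` in `N_K`, generated over `W(K)` by the `e_{jil}` with `l ≥ 0`. -/
def Decomposition.M₀ : Submodule (WittVector p K) (BaseChange p k K N) :=
  Submodule.span (WittVector p K) {x | ∃ (s : D.Slot) (l : ℕ), x = toBaseChange p k K (E.e α β s l)}

variable {K}

/-- `x = ∑_{j,i} ∑_{l ≥ 0} [a_{jil}] g(e_{jil})` in `N_K`, the sum being `p`-adically convergent:
for every `N`, all sufficiently long partial sums differ from `x` by an element of `p^N M₀`. -/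
def Decomposition.HasExpansion (g : N ≃ₗ[K(p, k)] N) (a : D.Slot → ℕ → K)
    (x : BaseChange p k K N) : Prop :=
  ∀ n : ℕ, ∃ L₀ : ℕ, ∀ L ≥ L₀, ∃ y ∈ E.M₀ α β K,
    x - ∑ s : D.Slot, ∑ l ∈ Finset.range L,
      WittVector.teichmuller p (a s l) • toBaseChange p k K (g (E.e α β s l)) = (p : WittVector p K) ^ n • y

/-- A normalised element `w` of `M` with respect to `g`: it has an expansion with coefficients
`b` satisfying the independence condition, `b_{110} = 1`, and `b_{jil} = 0` for all
`(j,i,l) ∉ I` other than `(1,1,0)`. -/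
def Decomposition.IsNormalised (g : N ≃ₗ[K(p, k)] N) (M : Submodule (WittVector p K) (BaseChange p k K N))
    (w : BaseChange p k K N) : Prop :=
  w ∈ M ∧ ∃ b : D.Slot → ℕ → K, E.HasExpansion α β g b w ∧ SlopeData.LeadingIndependent p b ∧
    b D.first 0 = 1 ∧ ∀ t : D.Index, t ≠ (D.first, 0) → t ∉ D.I → b t.1 t.2 = 0

end Main

end Dieudonne

end

open scoped Isocrystal TensorProduct
noncomputable section
namespace Dieudonne

/-! ### Teichmüller digits modulo p. -/

section Witt

variable {p : ℕ} [Fact p.Prime] {K : Type*} [Field K] [CharP K p] [PerfectRing K p]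

/-! Since g commutes with F, the vectors g(e_{jil}) obey the same relations as the e_{jil}: on them
F, V and p shift the last index by m_j, n_j and h_j. Such data form a `Frame`. Elements of its
lattice have unique Teichmüller expansions, and F^a V^b turns a term [c] e_{t,l} into [σ^{a-b}(c)]
e_{t,l+am_t+bn_t}. Up to the comparison with M₀ in (ii), the theorem is about leading terms in this
frame.

The heart is an elimination along increasing slopes (`Frame.exists_elim`). Let s be the first
component not yet removed from v. Then F^{n_s} v and V^{m_s} v have the same order at s, and
Teichmüller multiples of them cancel there; what is left at s has higher order and is cleared by
further monomials, because all large integers are of the form a m_s + b n_s. The result v' has no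
component at s. At a later t its order has grown by m_s n_t, since the minimality of the slope of s
lets V^{m_s} v dominate; for equal slopes both terms contribute, and (*) is what keeps the new
leading coefficient nonzero. That (*) is inherited is `Indep.elim`.

The relation defining v' also makes all monomials of equal order proportional, modulo higher order
and the module generated by v'. Hence elements led by s have index a m_s + b n_s plus the
accumulated shift, and elements without component at s are generated by v'. Iterating, the leading
indices of M are exactly the complement of I (`Frame.leads_dieudonneSpan_iff`), which is (iv) and
(v).

The rest is linear algebra over W(K). A submodule of the lattice whose leading indices miss only a
finite set J has colength |J|, with representatives supported on J (`Frame.finite_colength`); this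
gives (i) and, by reducing a multiple of v, a normalised generator. Two normalised elements coincide
because their difference would lead at an index outside I, where both are prescribed. A normalised w
satisfies (*), so its module has the same leading indices as M and equals M. Sylvester's count gives
|I| = c, and passing from g M₀ to M₀ costs v_p(det g). -/

theorem p_dvd_iff_coeff_zero (w : WittVector p K) : (p : WittVector p K) ∣ w ↔ w.coeff 0 = 0 := by
  have h := WittVector.mem_span_p_pow_iff_le_coeff_eq_zero w 1
  rw [pow_one, Ideal.mem_span_singleton] at h
  rw [h]
  exact ⟨fun H => H 0 one_pos, fun H i hi => by rwa [Nat.lt_one_iff.mp hi]⟩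

theorem exists_eq_teichmuller_add (w : WittVector p K) :
    ∃ w', w = WittVector.teichmuller p (w.coeff 0) + (p : WittVector p K) * w' := by
  have h : (p : WittVector p K) ∣ w - WittVector.teichmuller p (w.coeff 0) := by
    rw [p_dvd_iff_coeff_zero]
    have := map_sub (WittVector.constantCoeff (p := p) (R := K)) w
      (WittVector.teichmuller p (w.coeff 0))
    simpa using this
  obtain ⟨w', hw'⟩ := h
  exact ⟨w', by rw [← hw']; ring⟩

theorem isUnit_teichmuller {a : K} (ha : a ≠ 0) : IsUnit (WittVector.teichmuller p a) :=
  (IsUnit.mk0 a ha).map _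

theorem exists_p_pow_smul_eq (c : K(p, K)) :
    ∃ (n : ℕ) (w : WittVector p K), (p : K(p, K)) ^ n * c = algebraMap (WittVector p K) K(p, K) w := by
  obtain ⟨a, b, hb, rfl⟩ := IsFractionRing.div_surjective (A := WittVector p K) c
  have hb0 : b ≠ 0 := nonZeroDivisors.ne_zero hb
  obtain ⟨n, u, rfl⟩ := WittVector.exists_eq_pow_p_mul' b hb0
  refine ⟨n, a * (u⁻¹ : (WittVector p K)ˣ), ?_⟩
  have h1 : algebraMap (WittVector p K) K(p, K) (u : WittVector p K) *
      algebraMap (WittVector p K) K(p, K) ((u⁻¹ : (WittVector p K)ˣ) : WittVector p K) = 1 := by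
    rw [← map_mul, Units.mul_inv, map_one]
  have h2 : (p : K(p, K)) ^ n ≠ 0 := pow_ne_zero _ (WittVector.FractionRing.p_nonzero p K)
  have h3 : algebraMap (WittVector p K) K(p, K) (u : WittVector p K) ≠ 0 :=
    left_ne_zero_of_mul_eq_one h1
  rw [map_mul, map_mul, map_pow, map_natCast]
  field_simp
  linear_combination -(algebraMap (WittVector p K) K(p, K) a) * h1

end Witt

/-! ### Semilinear calculus of F, V and the monomials F^a V^b. -/

section Operators

variable (p : ℕ) [Fact p.Prime] (K : Type*) [Field K] [CharP K p] [PerfectRing K p]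
variable (X : Type*) [AddCommGroup X] [WittVector.Isocrystal p K X]

/-- The Frobenius as an additive endomorphism. -/
def frobHom : AddMonoid.End X :=
  AddMonoidHom.mk' (F p K X) (frob p K X).map_add'

variable {X} in
theorem F_inv_smul (c : K(p, K)) (x : X) :
    (F p K X)⁻¹ (φ(p, K) c • x) = c • (F p K X)⁻¹ x := by
  rw [Equiv.Perm.inv_eq_iff_eq]
  refine Eq.trans ?_ ((frob p K X).map_smul' c ((F p K X)⁻¹ x)).symm
  congr 1
  exact ((F p K X).apply_symm_apply x).symm

/-- The Verschiebung as an additive endomorphism. -/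
def verHom : AddMonoid.End X :=
  AddMonoidHom.mk' (versch p (K := K)) fun x y => by
    have : (F p K X)⁻¹ (x + y) = (F p K X)⁻¹ x + (F p K X)⁻¹ y := (frob p K X).symm.map_add' x y
    simp only [versch, this, smul_add]

variable {p K X}

theorem frobHom_apply (x : X) : frobHom p K X x = F p K X x := rfl

theorem verHom_apply (x : X) : verHom p K X x = versch p (K := K) x := rfl

theorem frobHom_smul (c : K(p, K)) (x : X) : frobHom p K X (c • x) = φ(p, K) c • frobHom p K X x :=
  (frob p K X).map_smul' c x

theorem verHom_frob_smul (c : K(p, K)) (x : X) :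
    verHom p K X (φ(p, K) c • x) = c • verHom p K X x := by
  rw [verHom_apply, verHom_apply, versch, versch, F_inv_smul, smul_comm]

theorem frobHom_verHom (x : X) : frobHom p K X (verHom p K X x) = (p : K(p, K)) • x := by
  rw [verHom_apply, versch, frobHom_smul, map_natCast]
  congr 1
  exact (F p K X).apply_symm_apply x

theorem verHom_frobHom (x : X) : verHom p K X (frobHom p K X x) = (p : K(p, K)) • x := by
  rw [verHom_apply, versch]
  congr 1
  exact (F p K X).symm_apply_apply x

theorem frobHom_verHom_commute : Commute (frobHom p K X) (verHom p K X) :=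
  AddMonoidHom.ext fun x => (frobHom_verHom x).trans (verHom_frobHom x).symm

variable (p K X) in
/-- The operator `F ^ a V ^ b`. -/
def mono (a b : ℕ) : AddMonoid.End X := frobHom p K X ^ a * verHom p K X ^ b

theorem mono_zero_zero (x : X) : mono p K X 0 0 x = x := rfl

theorem mono_mono (a b a' b' : ℕ) (x : X) :
    mono p K X a b (mono p K X a' b' x) = mono p K X (a + a') (b + b') x := by
  have : mono p K X a b * mono p K X a' b' = mono p K X (a + a') (b + b') := by
    rw [mono, mono, mono, pow_add, pow_add, mul_assoc, mul_assoc,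
      ← mul_assoc (verHom p K X ^ b), ← mul_assoc (frobHom p K X ^ a'),
      ((frobHom_verHom_commute (p := p) (K := K) (X := X)).pow_pow a' b).eq]
  exact DFunLike.congr_fun this x

theorem frobHom_mono (a b : ℕ) (x : X) :
    frobHom p K X (mono p K X a b x) = mono p K X (a + 1) b x := by
  have := mono_mono (p := p) (K := K) 1 0 a b x
  rwa [zero_add, add_comm 1 a, mono, pow_one, pow_zero, mul_one] at this

theorem verHom_mono (a b : ℕ) (x : X) :
    verHom p K X (mono p K X a b x) = mono p K X a (b + 1) x := by
  have := mono_mono (p := p) (K := K) 0 1 a b x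
  rwa [zero_add, add_comm 1 b, mono, pow_one, pow_zero, one_mul] at this

section Shift

variable {m n : ℕ} {e : ℕ → X}

theorem p_pow_smul_shift (hp : ∀ l, (p : K(p, K)) • e l = e (l + (m + n))) (q l : ℕ) :
    (p : K(p, K)) ^ q • e l = e (l + q * (m + n)) := by
  induction q with
  | zero => simp
  | succ q ih => rw [pow_succ', mul_smul, ih, hp]; congr 1; ring

theorem ver_shift (hF : ∀ l, frobHom p K X (e l) = e (l + m))
    (hp : ∀ l, (p : K(p, K)) • e l = e (l + (m + n))) (l : ℕ) :
    verHom p K X (e l) = e (l + n) := by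
  have h : frobHom p K X (verHom p K X (e l)) = frobHom p K X (e (l + n)) := by
    rw [frobHom_verHom, hp, hF]; congr 1; ring
  exact (F p K X).injective h

theorem mono_shift (hF : ∀ l, frobHom p K X (e l) = e (l + m))
    (hp : ∀ l, (p : K(p, K)) • e l = e (l + (m + n))) (a b l : ℕ) :
    mono p K X a b (e l) = e (l + (a * m + b * n)) := by
  induction a with
  | zero =>
    induction b with
    | zero => simp [mono_zero_zero]
    | succ b ih => rw [← verHom_mono, ih, ver_shift hF hp]; congr 1; ring
  | succ a ih => rw [← frobHom_mono, ih, hF]; congr 1; ring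

end Shift

variable [Module (WittVector p K) X] [IsScalarTower (WittVector p K) K(p, K) X]

theorem witt_smul_eq (w : WittVector p K) (x : X) :
    w • x = algebraMap (WittVector p K) K(p, K) w • x := by
  rw [algebraMap_smul]

theorem p_smul_eq (x : X) : (p : WittVector p K) • x = (p : K(p, K)) • x := by
  rw [witt_smul_eq, map_natCast]

theorem frobHom_witt_smul (w : WittVector p K) (x : X) :
    frobHom p K X (w • x) = WittVector.frobenius w • frobHom p K X x := by
  rw [witt_smul_eq, frobHom_smul, frobenius_algebraMap, ← witt_smul_eq]

theorem verHom_witt_smul (w : WittVector p K) (x : X) :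
    verHom p K X (WittVector.frobenius w • x) = w • verHom p K X x := by
  rw [witt_smul_eq, ← frobenius_algebraMap, verHom_frob_smul, ← witt_smul_eq]

theorem exists_frobenius_eq (w : WittVector p K) :
    ∃ w' : WittVector p K, WittVector.frobenius w' = w :=
  (WittVector.frobenius_bijective p K).2 w

variable (p K) in
/-- The automorphism `σ ^ z` of the residue field. -/
def tw (z : ℤ) : K ≃+* K := (show RingAut K from frobeniusEquiv K p) ^ z

theorem tw_add (z z' : ℤ) (x : K) : tw p K (z + z') x = tw p K z (tw p K z' x) := by
  rw [tw, zpow_add]; rfl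

theorem tw_zero (x : K) : tw p K 0 x = x := rfl

theorem tw_one (x : K) : tw p K 1 x = x ^ p := rfl

theorem tw_natCast (l : ℕ) (x : K) : tw p K l x = x ^ p ^ l := by
  induction l with
  | zero => simp [tw_zero]
  | succ l ih => rw [Nat.cast_succ, add_comm, tw_add, ih, tw_one, pow_succ, pow_mul]

theorem frobHom_teichmuller_smul (c : K) (x : X) :
    frobHom p K X (WittVector.teichmuller p c • x) =
      WittVector.teichmuller p (tw p K 1 c) • frobHom p K X x := by
  rw [frobHom_witt_smul, WittVector.frobenius_eq_map_frobenius, WittVector.map_teichmuller]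
  rfl

theorem verHom_teichmuller_smul (c : K) (x : X) :
    verHom p K X (WittVector.teichmuller p c • x) =
      WittVector.teichmuller p (tw p K (-1) c) • verHom p K X x := by
  rw [← verHom_witt_smul, WittVector.frobenius_eq_map_frobenius, WittVector.map_teichmuller]
  congr 3
  have : tw p K 1 (tw p K (-1) c) = c := by rw [← tw_add, add_neg_cancel, tw_zero]
  exact this.symm

/-- F twists Teichmüller scalars by σ and V by σ⁻¹, so only a - b matters. -/
theorem mono_teichmuller_smul (a b : ℕ) (c : K) (x : X) :
    mono p K X a b (WittVector.teichmuller p c • x) =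
      WittVector.teichmuller p (tw p K (a - b) c) • mono p K X a b x := by
  have hV : mono p K X 0 b (WittVector.teichmuller p c • x) =
      WittVector.teichmuller p (tw p K (-b) c) • mono p K X 0 b x := by
    induction b with
    | zero => simp [mono_zero_zero, tw_zero]
    | succ b ih =>
      rw [← verHom_mono, ih, verHom_teichmuller_smul, ← tw_add, verHom_mono]
      congr 4; push_cast; ring
  induction a with
  | zero => simpa using hV
  | succ a ih =>
    rw [← frobHom_mono, ih, frobHom_teichmuller_smul, ← tw_add, frobHom_mono]
    congr 4; push_cast; ring

end Operators

/-! ### Frames and the filtration by order in each component. -/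

/-- A direct sum of standard isocrystals of slopes `m t / (m t + n t)`, with elements `e t l`
on which `F`, `V` and `p` act as shifts by `m t`, `n t` and `m t + n t`. -/
structure Frame (p : ℕ) [Fact p.Prime] (K : Type*) [Field K] [CharP K p] [PerfectRing K p]
    (X : Type*) [AddCommGroup X] [WittVector.Isocrystal p K X] {ι : Type*} (m n : ι → ℕ) where
  m_pos : ∀ t, 0 < m t
  n_pos : ∀ t, 0 < n t
  e : ι → ℕ → X
  frob_e : ∀ t l, frobHom p K X (e t l) = e t (l + m t)
  p_smul_e' : ∀ t l, (p : K(p, K)) • e t l = e t (l + (m t + n t))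
  basis : Module.Basis (Σ t, Fin (m t + n t)) K(p, K) X
  basis_apply : ∀ t i, basis ⟨t, i⟩ = e t i

namespace Frame

variable {p : ℕ} [Fact p.Prime] {K : Type*} [Field K] [CharP K p] [PerfectRing K p]
variable {X : Type*} [AddCommGroup X] [WittVector.Isocrystal p K X]
variable [Module (WittVector p K) X] [IsScalarTower (WittVector p K) K(p, K) X]
variable {ι : Type*} {m n : ι → ℕ} (B : Frame p K X m n)

include B in
theorem h_pos (t : ι) : 0 < m t + n t := Nat.add_pos_left (B.m_pos t) _

theorem p_smul_e (t : ι) (l : ℕ) : (p : WittVector p K) • B.e t l = B.e t (l + (m t + n t)) := by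
  rw [p_smul_eq, B.p_smul_e']

theorem p_pow_smul_e (N : ℕ) (t : ι) (l : ℕ) :
    (p : WittVector p K) ^ N • B.e t l = B.e t (l + N * (m t + n t)) := by
  rw [witt_smul_eq, map_pow, map_natCast, p_pow_smul_shift (B.p_smul_e' t)]

theorem ver_e (t : ι) (l : ℕ) : verHom p K X (B.e t l) = B.e t (l + n t) :=
  ver_shift (B.frob_e t) (B.p_smul_e' t) l

theorem mono_e (a b : ℕ) (t : ι) (l : ℕ) :
    mono p K X a b (B.e t l) = B.e t (l + (a * m t + b * n t)) :=
  mono_shift (B.frob_e t) (B.p_smul_e' t) a b l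

/-- The submodule spanned by all components except the one at `t`. -/
def U (t : ι) : Submodule (WittVector p K) X :=
  (Submodule.span K(p, K) {x | ∃ t' l, t' ≠ t ∧ x = B.e t' l}).restrictScalars _

/-- The elements whose component at `t` is spanned by the `e t l'` with `l' ≥ l`. -/
def G (t : ι) (l : ℕ) : Submodule (WittVector p K) X :=
  Submodule.span _ {x | ∃ l', l ≤ l' ∧ x = B.e t l'} ⊔ B.U t

/-- The lattice spanned by all `e t l`. -/
def lattice : Submodule (WittVector p K) X :=
  Submodule.span _ {x | ∃ t l, x = B.e t l}

theorem e_mem_lattice (t : ι) (l : ℕ) : B.e t l ∈ B.lattice := Submodule.subset_span ⟨t, l, rfl⟩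

theorem e_mem_U {t t' : ι} (h : t' ≠ t) (l : ℕ) : B.e t' l ∈ B.U t :=
  Submodule.subset_span ⟨t', l, h, rfl⟩

theorem U_le_G (t : ι) (l : ℕ) : B.U t ≤ B.G t l := le_sup_right

theorem e_mem_G {t : ι} {l l' : ℕ} (h : l ≤ l') : B.e t l' ∈ B.G t l :=
  Submodule.mem_sup_left (Submodule.subset_span ⟨l', h, rfl⟩)

theorem e_mem_G_of_ne {t t' : ι} (h : t' ≠ t) (l l' : ℕ) : B.e t' l' ∈ B.G t l :=
  B.U_le_G t l (B.e_mem_U h l')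

theorem G_anti (t : ι) {l l' : ℕ} (h : l ≤ l') : B.G t l' ≤ B.G t l :=
  sup_le_sup_right (Submodule.span_mono (by rintro _ ⟨l'', h', rfl⟩; exact ⟨l'', h.trans h', rfl⟩)) _

theorem lattice_le_G (t : ι) : B.lattice ≤ B.G t 0 := by
  refine Submodule.span_le.2 ?_
  rintro _ ⟨t', l, rfl⟩
  by_cases h : t' = t
  · subst h; exact B.e_mem_G (Nat.zero_le _)
  · exact B.e_mem_G_of_ne h _ _

/-- Induction over the elements of `U t`. -/
theorem U_induction {t : ι} {P : X → Prop} (h0 : P 0) (ha : ∀ x y, P x → P y → P (x + y))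
    (he : ∀ (c : K(p, K)) t' l, t' ≠ t → P (c • B.e t' l)) {x : X} (hx : x ∈ B.U t) : P x := by
  change x ∈ Submodule.span K(p, K) _ at hx
  rw [Submodule.mem_span_iff_exists_finset_subset] at hx
  obtain ⟨f, s, hs, -, rfl⟩ := hx
  refine Finset.sum_induction _ _ ha h0 fun y hy => ?_
  obtain ⟨t', l, ht, rfl⟩ := hs hy
  exact he _ _ _ ht

/-- Induction over the elements of `G t l`. -/
theorem G_induction {t : ι} {l : ℕ} {P : X → Prop} (ha : ∀ x y, P x → P y → P (x + y))
    (hu : ∀ x ∈ B.U t, P x) (he : ∀ (c : WittVector p K) l', l ≤ l' → P (c • B.e t l'))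
    {x : X} (hx : x ∈ B.G t l) : P x := by
  obtain ⟨y, hy, z, hz, rfl⟩ := Submodule.mem_sup.1 hx
  refine ha _ _ ?_ (hu z hz)
  rw [Submodule.mem_span_iff_exists_finset_subset] at hy
  obtain ⟨f, s, hs, -, rfl⟩ := hy
  refine Finset.sum_induction _ _ ha (hu 0 (zero_mem _)) fun y hy => ?_
  obtain ⟨l', hl, rfl⟩ := hs hy
  exact he _ _ hl

theorem smul_mem_U {t : ι} (c : K(p, K)) {x : X} (hx : x ∈ B.U t) : c • x ∈ B.U t :=
  Submodule.smul_mem (Submodule.span K(p, K) _) c hx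

theorem frob_mem_U {t : ι} {x : X} (hx : x ∈ B.U t) : frobHom p K X x ∈ B.U t := by
  refine B.U_induction (P := fun x => frobHom p K X x ∈ B.U t) (by simp) ?_ ?_ hx
  · intro x y hx hy; rw [map_add]; exact add_mem hx hy
  · intro c t' l h; rw [frobHom_smul, frob_e]; exact B.smul_mem_U _ (B.e_mem_U h _)

theorem ver_mem_U {t : ι} {x : X} (hx : x ∈ B.U t) : verHom p K X x ∈ B.U t := by
  refine B.U_induction (P := fun x => verHom p K X x ∈ B.U t) (by simp) ?_ ?_ hx
  · intro x y hx hy; rw [map_add]; exact add_mem hx hy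
  · intro c t' l h
    obtain ⟨c, rfl⟩ := (WittVector.FractionRing.frobenius p K).surjective c
    have := verHom_frob_smul (p := p) c (B.e t' l)
    rw [ver_e] at this
    exact this ▸ B.smul_mem_U _ (B.e_mem_U h _)

theorem mono_mem_U (a b : ℕ) {t : ι} {x : X} (hx : x ∈ B.U t) : mono p K X a b x ∈ B.U t := by
  induction a with
  | zero =>
    induction b with
    | zero => exact hx
    | succ b ih => rw [← verHom_mono]; exact B.ver_mem_U ih
  | succ a ih => rw [← frobHom_mono]; exact B.frob_mem_U ih

theorem frob_mem_G {t : ι} {l : ℕ} {x : X} (hx : x ∈ B.G t l) :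
    frobHom p K X x ∈ B.G t (l + m t) := by
  refine B.G_induction (P := fun x => frobHom p K X x ∈ B.G t (l + m t)) ?_ ?_ ?_ hx
  · intro x y hx hy; rw [map_add]; exact add_mem hx hy
  · intro x hx; exact B.U_le_G _ _ (B.frob_mem_U hx)
  · intro c l' h
    rw [frobHom_witt_smul, frob_e]
    exact Submodule.smul_mem _ _ (B.e_mem_G (by omega))

theorem ver_mem_G {t : ι} {l : ℕ} {x : X} (hx : x ∈ B.G t l) :
    verHom p K X x ∈ B.G t (l + n t) := by
  refine B.G_induction (P := fun x => verHom p K X x ∈ B.G t (l + n t)) ?_ ?_ ?_ hx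
  · intro x y hx hy; rw [map_add]; exact add_mem hx hy
  · intro x hx; exact B.U_le_G _ _ (B.ver_mem_U hx)
  · intro c l' h
    obtain ⟨c, rfl⟩ := exists_frobenius_eq c
    rw [verHom_witt_smul, ver_e]
    exact Submodule.smul_mem _ _ (B.e_mem_G (by omega))

theorem mono_mem_G (a b : ℕ) {t : ι} {l : ℕ} {x : X} (hx : x ∈ B.G t l) :
    mono p K X a b x ∈ B.G t (l + (a * m t + b * n t)) := by
  induction a with
  | zero =>
    induction b with
    | zero => simpa [mono_zero_zero] using hx
    | succ b ih =>
      rw [← verHom_mono]; convert B.ver_mem_G ih using 2; ring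
  | succ a ih => rw [← frobHom_mono]; convert B.frob_mem_G ih using 2; ring

theorem p_smul_mem_G {t : ι} {l : ℕ} {x : X} (hx : x ∈ B.G t l) :
    (p : WittVector p K) • x ∈ B.G t (l + (m t + n t)) := by
  rw [p_smul_eq, ← frobHom_verHom]
  convert B.frob_mem_G (B.ver_mem_G hx) using 2; ring

theorem p_smul_mem_G_succ {t : ι} {l : ℕ} {x : X} (hx : x ∈ B.G t l) :
    (p : WittVector p K) • x ∈ B.G t (l + 1) :=
  B.G_anti t (by have := B.h_pos t; omega) (B.p_smul_mem_G hx)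

theorem frob_mem_lattice {x : X} (hx : x ∈ B.lattice) : frobHom p K X x ∈ B.lattice := by
  refine Submodule.span_induction ?_ ?_ ?_ ?_ hx
  · rintro _ ⟨t, l, rfl⟩; rw [frob_e]; exact B.e_mem_lattice _ _
  · simp
  · intro x y _ _ hx hy; rw [map_add]; exact add_mem hx hy
  · intro c x _ hx; rw [frobHom_witt_smul]; exact Submodule.smul_mem _ _ hx

theorem ver_mem_lattice {x : X} (hx : x ∈ B.lattice) : verHom p K X x ∈ B.lattice := by
  refine Submodule.span_induction ?_ ?_ ?_ ?_ hx
  · rintro _ ⟨t, l, rfl⟩; rw [ver_e]; exact B.e_mem_lattice _ _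
  · simp
  · intro x y _ _ hx hy; rw [map_add]; exact add_mem hx hy
  · intro c x _ hx
    obtain ⟨c, rfl⟩ := exists_frobenius_eq c
    rw [verHom_witt_smul]; exact Submodule.smul_mem _ _ hx

theorem mono_mem_lattice (a b : ℕ) {x : X} (hx : x ∈ B.lattice) :
    mono p K X a b x ∈ B.lattice := by
  induction a with
  | zero =>
    induction b with
    | zero => exact hx
    | succ b ih => rw [← verHom_mono]; exact B.ver_mem_lattice ih
  | succ a ih => rw [← frobHom_mono]; exact B.frob_mem_lattice ih

/-! ### Coordinates -/

theorem e_eq_smul_basis (t : ι) (l : ℕ) :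
    B.e t l = (p : K(p, K)) ^ (l / (m t + n t)) •
      B.basis ⟨t, ⟨l % (m t + n t), Nat.mod_lt _ (B.h_pos t)⟩⟩ := by
  rw [basis_apply]
  have := B.p_pow_smul_e (l / (m t + n t)) t (l % (m t + n t))
  rw [witt_smul_eq, map_pow, map_natCast] at this
  rw [this, Nat.mod_add_div']

theorem coord_e (t : ι) (l : ℕ) (s : ι) (i : Fin (m s + n s)) [Decidable (t = s ∧ l % (m t + n t) = i)] :
    B.basis.repr (B.e t l) ⟨s, i⟩ =
      if t = s ∧ l % (m t + n t) = i then (p : K(p, K)) ^ (l / (m t + n t)) else 0 := by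
  classical
  rw [e_eq_smul_basis, map_smul, Finsupp.smul_apply, Module.Basis.repr_self,
    Finsupp.single_apply, smul_eq_mul, mul_ite, mul_one, mul_zero]
  refine if_congr ?_ rfl rfl
  constructor
  · rintro h
    obtain ⟨rfl, h⟩ := Sigma.mk.inj_iff.1 h
    exact ⟨rfl, congrArg Fin.val (eq_of_heq h)⟩
  · rintro ⟨rfl, h⟩
    congr 1
    exact Fin.ext h

theorem coord_U {t : ι} {x : X} (hx : x ∈ B.U t) (i : Fin (m t + n t)) :
    B.basis.repr x ⟨t, i⟩ = 0 := by
  classical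
  refine B.U_induction (P := fun x => B.basis.repr x ⟨t, i⟩ = 0) (by simp) ?_ ?_ hx
  · intro x y hx hy; rw [map_add, Finsupp.add_apply, hx, hy, add_zero]
  · intro c t' l h
    rw [map_smul, Finsupp.smul_apply, coord_e, if_neg (fun H => h H.1), smul_zero]

/-- Only the `e t l'` with l' congruent to i modulo h_t contribute to coordinate i, each with the
factor p^(l'/h_t); `hk` bounds these exponents from below. -/
theorem coord_G {t : ι} {l k : ℕ} (i : Fin (m t + n t))
    (hk : ∀ l', l ≤ l' → l' % (m t + n t) = i → k ≤ l' / (m t + n t)) {x : X} (hx : x ∈ B.G t l) :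
    ∃ w : WittVector p K, B.basis.repr x ⟨t, i⟩ = (p : K(p, K)) ^ k * algebraMap _ _ w := by
  classical
  refine B.G_induction (P := fun x => ∃ w : WittVector p K, B.basis.repr x ⟨t, i⟩ =
    (p : K(p, K)) ^ k * algebraMap _ _ w) ?_ ?_ ?_ hx
  · rintro x y ⟨w, hx⟩ ⟨w', hy⟩
    exact ⟨w + w', by rw [map_add, Finsupp.add_apply, hx, hy, map_add, mul_add]⟩
  · intro x hx; exact ⟨0, by rw [B.coord_U hx, map_zero, mul_zero]⟩
  · intro c l' hl
    rw [witt_smul_eq, map_smul, Finsupp.smul_apply, coord_e]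
    split_ifs with h
    · obtain ⟨d, hd⟩ := Nat.exists_eq_add_of_le (hk l' hl h.2)
      refine ⟨(p : WittVector p K) ^ d * c, ?_⟩
      rw [hd, map_mul, map_pow, map_natCast, smul_eq_mul, pow_add]; ring
    · exact ⟨0, by simp⟩

/-- The leading coefficient of an element of `G t l` is well defined. -/
theorem p_dvd_of_smul_e_mem_G {t : ι} {l : ℕ} {c : WittVector p K}
    (h : c • B.e t l ∈ B.G t (l + 1)) : (p : WittVector p K) ∣ c := by
  classical
  have hh := B.h_pos t
  -- Among the indices congruent to l modulo h_t, those beyond l start at l + h_t, so the coordinate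
  -- has one more factor p than that of `e t l`.
  obtain ⟨w, hw⟩ := B.coord_G (k := l / (m t + n t) + 1)
    ⟨l % (m t + n t), Nat.mod_lt _ hh⟩ (fun l' hl h => by
      simp only at h
      by_contra hc
      have h1 := Nat.div_add_mod l (m t + n t)
      have h2 := Nat.div_add_mod l' (m t + n t)
      have h3 : (m t + n t) * (l' / (m t + n t)) ≤ (m t + n t) * (l / (m t + n t)) :=
        Nat.mul_le_mul_left _ (by omega)
      omega) h
  rw [witt_smul_eq, map_smul, Finsupp.smul_apply, coord_e, if_pos ⟨rfl, rfl⟩, pow_succ,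
    smul_eq_mul, mul_comm, mul_assoc] at hw
  have h1 := mul_left_cancel₀ (pow_ne_zero _ (WittVector.FractionRing.p_nonzero p K)) hw
  rw [← map_natCast (algebraMap (WittVector p K) K(p, K)), ← map_mul] at h1
  exact ⟨w, IsFractionRing.injective _ _ h1⟩

variable [Fintype ι]

theorem eq_zero_of_mem_U {x : X} (h : ∀ t, x ∈ B.U t) : x = 0 := by
  apply B.basis.repr.injective
  ext ⟨t, i⟩
  rw [B.coord_U (h t), map_zero, Finsupp.zero_apply]

/-- As p shifts by h_t, order N h_t at t means divisibility by p^N there. This links the order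
filtrations to the p-adic topology. -/
theorem exists_p_pow_smul_of_mem_G (N : ℕ) {x : X} (h : ∀ t, x ∈ B.G t (N * (m t + n t))) :
    ∃ y ∈ B.lattice, x = (p : WittVector p K) ^ N • y := by
  have hc : ∀ a : Σ t, Fin (m t + n t), ∃ w : WittVector p K,
      B.basis.repr x a = (p : K(p, K)) ^ N * algebraMap _ _ w := fun a =>
    B.coord_G a.2 (fun l' hl _ => (Nat.le_div_iff_mul_le (B.h_pos _)).2 hl) (h a.1)
  choose w hw using hc
  refine ⟨∑ a, w a • B.e a.1 a.2, Submodule.sum_mem _ fun a _ =>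
    Submodule.smul_mem _ _ (B.e_mem_lattice _ _), ?_⟩
  rw [← B.basis.sum_repr x, Finset.smul_sum]
  refine Finset.sum_congr rfl fun a _ => ?_
  rw [hw, smul_smul, ← B.basis_apply, witt_smul_eq, map_mul, map_pow, map_natCast]

theorem mem_lattice_iff {x : X} : x ∈ B.lattice ↔ ∀ t, x ∈ B.G t 0 := by
  refine ⟨fun h t => B.lattice_le_G t h, fun h => ?_⟩
  obtain ⟨y, hy, rfl⟩ := B.exists_p_pow_smul_of_mem_G 0 (x := x) (by simpa using h)
  simpa using hy

theorem lattice_eq_span_basis : B.lattice = Submodule.span (WittVector p K) (Set.range B.basis) := by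
  refine le_antisymm (Submodule.span_le.2 ?_) (Submodule.span_le.2 ?_)
  · rintro _ ⟨t, l, rfl⟩
    rw [e_eq_smul_basis, ← map_natCast (algebraMap (WittVector p K) K(p, K)), ← map_pow,
      ← witt_smul_eq]
    exact Submodule.smul_mem _ _ (Submodule.subset_span ⟨_, rfl⟩)
  · rintro _ ⟨⟨t, i⟩, rfl⟩
    rw [basis_apply]
    exact B.e_mem_lattice _ _

theorem lattice_fg : B.lattice.FG := by
  rw [lattice_eq_span_basis]
  exact Submodule.fg_span (Set.finite_range _)

theorem fg_of_le_lattice {R : Submodule (WittVector p K) X} (h : R ≤ B.lattice) : R.FG := by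
  have := isNoetherian_of_fg_of_noetherian _ B.lattice_fg
  exact Submodule.FG.of_le B.lattice_fg h

/-- Submodules of the lattice are `p`-adically closed. -/
theorem mem_of_forall_p_pow {R : Submodule (WittVector p K) X} (hR : R ≤ B.lattice) {x : X}
    (h : ∀ N : ℕ, ∃ r ∈ R, ∃ y ∈ B.lattice, x = r + (p : WittVector p K) ^ N • y) : x ∈ R := by
  have hx : x ∈ B.lattice := by
    obtain ⟨r, hr, y, hy, rfl⟩ := h 0
    exact add_mem (hR hr) (Submodule.smul_mem _ _ hy)
  have hfin : Module.Finite (WittVector p K) B.lattice := Module.Finite.iff_fg.2 B.lattice_fg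
  let Q := B.lattice ⧸ R.submoduleOf B.lattice
  have hI : (Ideal.span {(p : WittVector p K)}) ≠ ⊤ := by
    rw [Ne, Ideal.span_singleton_eq_top]
    exact (WittVector.irreducible p).not_isUnit
  -- Krull's intersection theorem in the finitely generated quotient of the lattice by R.
  have hb := Ideal.iInf_pow_smul_eq_bot_of_isLocalRing (M := Q) _ hI
  have hq : (Submodule.Quotient.mk ⟨x, hx⟩ : Q) ∈
      (⨅ i : ℕ, Ideal.span {(p : WittVector p K)} ^ i • (⊤ : Submodule (WittVector p K) Q)) := by
    rw [Submodule.mem_iInf]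
    intro N
    obtain ⟨r, hr, y, hy, hxy⟩ := h N
    have : (Submodule.Quotient.mk ⟨x, hx⟩ : Q) =
        (p : WittVector p K) ^ N • (Submodule.Quotient.mk ⟨y, hy⟩ : Q) := by
      rw [← Submodule.Quotient.mk_smul, Submodule.Quotient.eq]
      change x - (p : WittVector p K) ^ N • y ∈ R
      rwa [hxy, add_sub_cancel_right]
    rw [this]
    exact Submodule.smul_mem_smul (Ideal.pow_mem_pow (Ideal.mem_span_singleton_self _) N) trivial
  rw [hb, Submodule.mem_bot, Submodule.Quotient.mk_eq_zero] at hq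
  exact hq

-- The component of x at t is itself p^N y with y in the lattice. Removing it does not disturb the
-- other components, for which `U t` would even allow denominators.
omit [Fintype ι] in
theorem exists_split (N : ℕ) {t : ι} {x : X} (hx : x ∈ B.G t (N * (m t + n t))) :
    ∃ y ∈ B.lattice, x - (p : WittVector p K) ^ N • y ∈ B.U t ∧ ∀ t', t' ≠ t → y ∈ B.U t' := by
  refine B.G_induction (P := fun x => ∃ y ∈ B.lattice,
    x - (p : WittVector p K) ^ N • y ∈ B.U t ∧ ∀ t', t' ≠ t → y ∈ B.U t') ?_ ?_ ?_ hx
  · rintro x y ⟨z, hz, hxz, hz'⟩ ⟨w, hw, hyw, hw'⟩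
    refine ⟨z + w, add_mem hz hw, ?_, fun t' ht' => add_mem (hz' t' ht') (hw' t' ht')⟩
    convert add_mem hxz hyw using 1
    rw [smul_add]; abel
  · intro x hx; exact ⟨0, zero_mem _, by simpa using hx, fun _ _ => zero_mem _⟩
  · intro c l hl
    obtain ⟨d, rfl⟩ := Nat.exists_eq_add_of_le hl
    refine ⟨c • B.e t d, Submodule.smul_mem _ _ (B.e_mem_lattice _ _), ?_,
      fun t' ht' => Submodule.smul_mem _ _ (B.e_mem_U ht'.symm _)⟩
    rw [smul_comm, B.p_pow_smul_e, add_comm d, sub_self]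
    exact zero_mem _

end Frame

/-! ### Leading coefficients and Teichmüller expansions. -/

namespace Frame

variable {p : ℕ} [Fact p.Prime] {K : Type*} [Field K] [CharP K p] [PerfectRing K p]
variable {X : Type*} [AddCommGroup X] [WittVector.Isocrystal p K X]
variable [Module (WittVector p K) X] [IsScalarTower (WittVector p K) K(p, K) X]
variable {ι : Type*} {m n : ι → ℕ} (B : Frame p K X m n)

/-- The component of `x` at `t` is `[a] e t l` up to terms of higher order. -/
def Lead (t : ι) (l : ℕ) (a : K) (x : X) : Prop :=
  x - WittVector.teichmuller p a • B.e t l ∈ B.G t (l + 1)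

variable {B}

theorem Lead.mem_G {t : ι} {l : ℕ} {a : K} {x : X} (h : B.Lead t l a x) : x ∈ B.G t l := by
  have := add_mem (B.G_anti t (Nat.le_succ l) h)
    (Submodule.smul_mem _ (WittVector.teichmuller p a) (B.e_mem_G (le_refl l)))
  rwa [sub_add_cancel] at this

theorem lead_zero_iff {t : ι} {l : ℕ} {x : X} : B.Lead t l 0 x ↔ x ∈ B.G t (l + 1) := by
  rw [Lead, WittVector.teichmuller_zero, zero_smul, sub_zero]

/-- A multiple of p raises the order, so only c modulo p is visible at l. This is why leading
coefficients add in K although Teichmüller representatives are not additive. -/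
theorem Lead.of_smul {t : ι} {l : ℕ} (c : WittVector p K) {x : X}
    (h : x - c • B.e t l ∈ B.G t (l + 1)) : B.Lead t l (c.coeff 0) x := by
  obtain ⟨d, hd⟩ := exists_eq_teichmuller_add c
  have h2 : (p : WittVector p K) • d • B.e t l ∈ B.G t (l + 1) :=
    B.p_smul_mem_G_succ (Submodule.smul_mem _ _ (B.e_mem_G le_rfl))
  have := add_mem h h2
  rw [Lead]
  convert this using 1
  conv_rhs => rw [hd, add_smul, mul_smul]
  abel

theorem exists_lead {t : ι} {l : ℕ} {x : X} (hx : x ∈ B.G t l) : ∃ a, B.Lead t l a x := by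
  suffices h : ∃ c : WittVector p K, x - c • B.e t l ∈ B.G t (l + 1) by
    obtain ⟨c, hc⟩ := h
    exact ⟨_, Lead.of_smul c hc⟩
  refine B.G_induction (P := fun x => ∃ c : WittVector p K, x - c • B.e t l ∈ B.G t (l + 1))
    ?_ ?_ ?_ hx
  · rintro x y ⟨c, hc⟩ ⟨d, hd⟩
    refine ⟨c + d, ?_⟩
    convert add_mem hc hd using 1
    rw [add_smul]; abel
  · intro x hx; exact ⟨0, by simpa using B.U_le_G _ _ hx⟩
  · intro c l' hl
    obtain rfl | hl := hl.eq_or_lt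
    · exact ⟨c, by simp⟩
    · exact ⟨0, by simpa using Submodule.smul_mem _ c (B.e_mem_G hl)⟩

theorem Lead.unique {t : ι} {l : ℕ} {a b : K} {x : X} (ha : B.Lead t l a x) (hb : B.Lead t l b x) :
    a = b := by
  have := sub_mem hb ha
  rw [sub_sub_sub_cancel_left, ← sub_smul] at this
  have h := (p_dvd_iff_coeff_zero _).1 (B.p_dvd_of_smul_e_mem_G this)
  have := map_sub (WittVector.constantCoeff (p := p) (R := K)) (WittVector.teichmuller p a)
      (WittVector.teichmuller p b)
  simp only [WittVector.constantCoeff_apply, WittVector.teichmuller_coeff_zero] at this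
  exact sub_eq_zero.1 (this.symm.trans h)

theorem Lead.add {t : ι} {l : ℕ} {a b : K} {x y : X} (ha : B.Lead t l a x) (hb : B.Lead t l b y) :
    B.Lead t l (a + b) (x + y) := by
  have h := Lead.of_smul (B := B) (t := t) (l := l)
    (WittVector.teichmuller p a + WittVector.teichmuller p b) (x := x + y) (by
      convert add_mem ha hb using 1
      rw [add_smul]; abel)
  have := map_add (WittVector.constantCoeff (p := p) (R := K)) (WittVector.teichmuller p a)
      (WittVector.teichmuller p b)
  simp only [WittVector.constantCoeff_apply, WittVector.teichmuller_coeff_zero] at this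
  rwa [this] at h

theorem Lead.witt_smul {t : ι} {l : ℕ} {a : K} {x : X} (h : B.Lead t l a x) (c : WittVector p K) :
    B.Lead t l (c.coeff 0 * a) (c • x) := by
  have h := Lead.of_smul (B := B) (t := t) (l := l) (c * WittVector.teichmuller p a) (x := c • x) (by
      convert Submodule.smul_mem _ c h using 1
      rw [smul_sub, mul_smul])
  have := map_mul (WittVector.constantCoeff (p := p) (R := K)) c (WittVector.teichmuller p a)
  simp only [WittVector.constantCoeff_apply, WittVector.teichmuller_coeff_zero] at this
  rwa [this] at h

theorem Lead.smul {t : ι} {l : ℕ} {a : K} {x : X} (h : B.Lead t l a x) (c : K) :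
    B.Lead t l (c * a) (WittVector.teichmuller p c • x) := by
  simpa using h.witt_smul (WittVector.teichmuller p c)

theorem Lead.neg {t : ι} {l : ℕ} {a : K} {x : X} (h : B.Lead t l a x) : B.Lead t l (-a) (-x) := by
  have h := h.witt_smul (-1)
  have := map_neg (WittVector.constantCoeff (p := p) (R := K)) 1
  simp only [map_one, WittVector.constantCoeff_apply] at this
  rwa [this, neg_one_smul, neg_one_mul] at h

theorem Lead.sub {t : ι} {l : ℕ} {a b : K} {x y : X} (ha : B.Lead t l a x) (hb : B.Lead t l b y) :
    B.Lead t l (a - b) (x - y) := by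
  rw [sub_eq_add_neg, sub_eq_add_neg]; exact ha.add hb.neg

theorem Lead.add_mem {t : ι} {l : ℕ} {a : K} {x y : X} (h : B.Lead t l a x)
    (hy : y ∈ B.G t (l + 1)) : B.Lead t l a (x + y) := by
  simpa using h.add (lead_zero_iff.2 hy)

theorem Lead.sub_mem {t : ι} {l : ℕ} {a : K} {x y : X} (h : B.Lead t l a x)
    (hy : y ∈ B.G t (l + 1)) : B.Lead t l a (x - y) := by
  simpa using h.sub (lead_zero_iff.2 hy)

theorem Lead.mono {t : ι} {l : ℕ} {c : K} {x : X} (h : B.Lead t l c x) (a b : ℕ) :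
    B.Lead t (l + (a * m t + b * n t)) (tw p K (a - b) c) (Dieudonne.mono p K X a b x) := by
  have := B.mono_mem_G a b h
  rw [map_sub, mono_teichmuller_smul, B.mono_e] at this
  rw [Lead]
  convert this using 2
  ring

theorem lead_e (t : ι) (l : ℕ) : B.Lead t l 1 (B.e t l) := by
  rw [Lead, map_one, one_smul, sub_self]; exact zero_mem _

variable (B)

/-- `x` is the sum of the `[b t l] e t l`. -/
def Expands (b : ι → ℕ → K) (x : X) : Prop :=
  ∀ t L, x - ∑ l ∈ Finset.range L, WittVector.teichmuller p (b t l) • B.e t l ∈ B.G t L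

variable {B}

/-- The digits arise by repeatedly subtracting the current leading term. Each component can be
treated on its own, the others being absorbed by `U t`. -/
theorem exists_expands_of_forall {x : X} (hx : ∀ t, x ∈ B.G t 0) : ∃ b, B.Expands b x := by
  have H : ∀ t, ∃ b : ℕ → K, ∀ L,
      x - ∑ l ∈ Finset.range L, WittVector.teichmuller p (b l) • B.e t l ∈ B.G t L := by
    intro t
    have step : ∀ L (y : B.G t L), ∃ a, B.Lead t L a (y : X) := fun L y => exists_lead y.2
    choose f hf using step
    let r : (L : ℕ) → B.G t L := fun L => Nat.rec (⟨x, hx t⟩ : B.G t 0)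
      (fun L y => ⟨y - WittVector.teichmuller p (f L y) • B.e t L, hf L y⟩) L
    refine ⟨fun L => f L (r L), fun L => ?_⟩
    have : x - ∑ l ∈ Finset.range L, WittVector.teichmuller p (f l (r l)) • B.e t l = (r L).1 := by
      induction L with
      | zero => simp [r]
      | succ L ih => rw [Finset.sum_range_succ, ← sub_sub, ih]
    rw [this]
    exact (r L).2
  choose b hb using H
  exact ⟨b, hb⟩

theorem Expands.mem_G {b : ι → ℕ → K} {x : X} (h : B.Expands b x) {t : ι} {L : ℕ}
    (hb : ∀ l < L, b t l = 0) : x ∈ B.G t L := by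
  have := h t L
  rwa [Finset.sum_eq_zero, sub_zero] at this
  intro l hl
  rw [hb l (Finset.mem_range.1 hl), WittVector.teichmuller_zero, zero_smul]

theorem Expands.lead {b : ι → ℕ → K} {x : X} (h : B.Expands b x) {t : ι} {L : ℕ}
    (hb : ∀ l < L, b t l = 0) : B.Lead t L (b t L) x := by
  have := h t (L + 1)
  rw [Finset.sum_range_succ, Finset.sum_eq_zero, zero_add] at this
  · exact this
  intro l hl
  rw [hb l (Finset.mem_range.1 hl), WittVector.teichmuller_zero, zero_smul]

theorem Expands.eq_zero_of_mem_G {b : ι → ℕ → K} {x : X} (h : B.Expands b x) {t : ι} {L : ℕ}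
    (hx : x ∈ B.G t L) : ∀ l < L, b t l = 0 := by
  intro l
  induction l using Nat.strong_induction_on with
  | _ l ih =>
    intro hl
    exact (h.lead fun l' hl' => ih l' hl' (hl'.trans hl)).unique
      (lead_zero_iff.2 (B.G_anti t hl hx))

/-- The first coefficients in which two expansions differ give the leading term of the
difference. -/
theorem Expands.lead_sub {b b' : ι → ℕ → K} {x x' : X} (h : B.Expands b x) (h' : B.Expands b' x')
    {t : ι} {L : ℕ} (hb : ∀ l < L, b t l = b' t l) : B.Lead t L (b t L - b' t L) (x - x') := by
  have h1 : B.Lead t L (b t L)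
      (x - ∑ l ∈ Finset.range L, WittVector.teichmuller p (b t l) • B.e t l) := by
    have := h t (L + 1)
    rwa [Finset.sum_range_succ, ← sub_sub] at this
  have h2 : B.Lead t L (b' t L)
      (x' - ∑ l ∈ Finset.range L, WittVector.teichmuller p (b' t l) • B.e t l) := by
    have := h' t (L + 1)
    rwa [Finset.sum_range_succ, ← sub_sub] at this
  have := h1.sub h2
  rw [Finset.sum_congr rfl fun l hl => by rw [hb l (Finset.mem_range.1 hl)],
    sub_sub_sub_cancel_right] at this
  exact this

variable [Fintype ι]

theorem exists_expands {x : X} (hx : x ∈ B.lattice) : ∃ b, B.Expands b x :=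
  exists_expands_of_forall (B.mem_lattice_iff.1 hx)

theorem Expands.mem_lattice {b : ι → ℕ → K} {x : X} (h : B.Expands b x) : x ∈ B.lattice :=
  B.mem_lattice_iff.2 fun t => by simpa using h t 0

/-- Arbitrarily high order at t approximates x p-adically by elements of `U t`, and submodules of
the lattice are closed. -/
theorem mem_U_of_forall_mem_G {t : ι} {x : X} (hx : x ∈ B.lattice) (h : ∀ L, x ∈ B.G t L) :
    x ∈ B.U t := by
  refine (B.mem_of_forall_p_pow (R := B.U t ⊓ B.lattice) inf_le_right (x := x) fun N => ?_).1
  obtain ⟨y, hy, hxy, -⟩ := B.exists_split N (h (N * (m t + n t)))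
  exact ⟨_, ⟨hxy, sub_mem hx (Submodule.smul_mem _ _ hy)⟩, y, hy, by abel⟩

theorem Expands.mem_U_iff {b : ι → ℕ → K} {x : X} (h : B.Expands b x) {t : ι} :
    x ∈ B.U t ↔ ∀ l, b t l = 0 :=
  ⟨fun hx l => h.eq_zero_of_mem_G (B.U_le_G t (l + 1) hx) l (Nat.lt_succ_self l),
    fun hb => mem_U_of_forall_mem_G h.mem_lattice fun _ => h.mem_G fun l _ => hb l⟩

variable [LinearOrder ι]

variable (B) in
/-- The elements whose components before `s` vanish. -/
def Z (s : ι) : Submodule (WittVector p K) X := ⨅ t, ⨅ _ : t < s, B.U t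

omit [Fintype ι] in
theorem mem_Z {s : ι} {x : X} : x ∈ B.Z s ↔ ∀ t < s, x ∈ B.U t := by
  simp [Z, Submodule.mem_iInf]

variable (B) in
/-- `M` has an element whose first nonzero term has index `u`. -/
def Leads (M : Submodule (WittVector p K) X) (u : ι × ℕ) : Prop :=
  ∃ x ∈ M, x ∈ B.Z u.1 ∧ ∃ a ≠ 0, B.Lead u.1 u.2 a x

/-- A nonzero element of the lattice has a leading term. -/
theorem exists_leading {x : X} (hx : x ∈ B.lattice) (h0 : x ≠ 0) :
    ∃ s l, x ∈ B.Z s ∧ ∃ a ≠ 0, B.Lead s l a x := by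
  obtain ⟨b, hb⟩ := exists_expands hx
  have h1 : ∃ s, x ∉ B.U s := by
    by_contra! h; exact h0 (B.eq_zero_of_mem_U h)
  obtain ⟨s, hs, hmin⟩ := (Finite.to_wellFoundedLT (α := ι)).wf.has_min {s | x ∉ B.U s} h1
  have hs' : ∃ l, b s l ≠ 0 := by
    by_contra! h; exact hs (hb.mem_U_iff.2 h)
  classical
  refine ⟨s, Nat.find hs', mem_Z.2 fun t ht => ?_, _, Nat.find_spec hs', hb.lead fun l hl => ?_⟩
  · by_contra h; exact hmin t h ht
  · by_contra h; exact Nat.find_min hs' hl h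

end Frame

/-! ### Spans of monomials of bounded order. -/

section Span

variable {p : ℕ} [Fact p.Prime] {K : Type*} [Field K] [CharP K p] [PerfectRing K p]
variable {X : Type*} [AddCommGroup X] [WittVector.Isocrystal p K X]
variable [Module (WittVector p K) X]

variable (p K) in
/-- The span of the `F ^ a V ^ b v` with `a * m + b * n ≥ d`. -/
def monoSpan (m n d : ℕ) (v : X) : Submodule (WittVector p K) X :=
  Submodule.span _ {x | ∃ a b, d ≤ a * m + b * n ∧ x = mono p K X a b v}

theorem mono_mem_monoSpan {m n d a b : ℕ} (h : d ≤ a * m + b * n) (v : X) :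
    mono p K X a b v ∈ monoSpan p K m n d v := Submodule.subset_span ⟨a, b, h, rfl⟩

theorem monoSpan_anti (m n : ℕ) {d d' : ℕ} (h : d ≤ d') (v : X) :
    monoSpan p K m n d' v ≤ monoSpan p K m n d v :=
  Submodule.span_mono (by rintro _ ⟨a, b, h', rfl⟩; exact ⟨a, b, h.trans h', rfl⟩)

theorem self_mem_monoSpan (m n : ℕ) (v : X) : v ∈ monoSpan p K m n 0 v :=
  mono_mem_monoSpan (a := 0) (b := 0) (Nat.zero_le _) v

variable [IsScalarTower (WittVector p K) K(p, K) X]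

theorem mono_witt_smul (a b : ℕ) (c : WittVector p K) (x : X) :
    ∃ c' : WittVector p K, mono p K X a b (c • x) = c' • mono p K X a b x := by
  induction a with
  | zero =>
    induction b with
    | zero => exact ⟨c, rfl⟩
    | succ b ih =>
      obtain ⟨c', h⟩ := ih
      obtain ⟨c', rfl⟩ := exists_frobenius_eq c'
      exact ⟨c', by rw [← verHom_mono, h, verHom_witt_smul, verHom_mono]⟩
  | succ a ih =>
    obtain ⟨c', h⟩ := ih
    exact ⟨_, by rw [← frobHom_mono, h, frobHom_witt_smul, frobHom_mono]⟩

theorem mono_mem_monoSpan_add {m n d : ℕ} {v x : X} (hx : x ∈ monoSpan p K m n d v) (a b : ℕ) :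
    mono p K X a b x ∈ monoSpan p K m n (d + (a * m + b * n)) v := by
  refine Submodule.span_induction ?_ ?_ ?_ ?_ hx
  · rintro _ ⟨a', b', h, rfl⟩
    rw [mono_mono]
    exact mono_mem_monoSpan (by rw [add_mul, add_mul]; omega) v
  · rw [map_zero]; exact zero_mem _
  · intro x y _ _ hx hy; rw [map_add]; exact add_mem hx hy
  · intro c x _ hx
    obtain ⟨c', h⟩ := mono_witt_smul a b c x
    rw [h]; exact Submodule.smul_mem _ _ hx

theorem monoSpan_le_of_mem {m n d d' : ℕ} {v x : X} (hx : x ∈ monoSpan p K m n d v) :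
    monoSpan p K m n d' x ≤ monoSpan p K m n (d + d') v := by
  refine Submodule.span_le.2 ?_
  rintro _ ⟨a, b, h, rfl⟩
  exact monoSpan_anti _ _ (by omega) _ (mono_mem_monoSpan_add hx a b)

/-- The `𝒟(K)`-submodule generated by `v` is spanned by the `F ^ a V ^ b v`. -/
theorem dieudonneSpan_eq (m n : ℕ) (v : X) : dieudonneSpan p v = monoSpan p K m n 0 v := by
  refine le_antisymm (sInf_le ⟨self_mem_monoSpan _ _ v, fun x hx => ?_, fun x hx => ?_⟩)
    (le_sInf ?_)
  · have := mono_mem_monoSpan_add hx 1 0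
    rw [← frobHom_mono, mono_zero_zero] at this
    exact monoSpan_anti _ _ (Nat.zero_le _) _ this
  · have := mono_mem_monoSpan_add hx 0 1
    rw [← verHom_mono, mono_zero_zero] at this
    exact monoSpan_anti _ _ (Nat.zero_le _) _ this
  · rintro M ⟨hv, hF, hV⟩
    refine Submodule.span_le.2 ?_
    rintro _ ⟨a, b, -, rfl⟩
    induction a with
    | zero =>
      induction b with
      | zero => exact hv
      | succ b ih => rw [← verHom_mono]; exact hV _ ih
    | succ a ih => rw [← frobHom_mono]; exact hF _ ih

end Span

/-! ### The module generated by v, seen in one component. -/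

namespace Frame

variable {p : ℕ} [Fact p.Prime] {K : Type*} [Field K] [CharP K p] [PerfectRing K p]
variable {X : Type*} [AddCommGroup X] [WittVector.Isocrystal p K X]
variable [Module (WittVector p K) X] [IsScalarTower (WittVector p K) K(p, K) X]
variable {ι : Type*} {m n : ι → ℕ} {B : Frame p K X m n}

theorem monoSpan_le_lattice {v : X} (hv : v ∈ B.lattice) (m' n' d : ℕ) :
    monoSpan p K m' n' d v ≤ B.lattice := by
  refine Submodule.span_le.2 ?_
  rintro _ ⟨a, b, -, rfl⟩
  exact B.mono_mem_lattice a b hv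

theorem monoSpan_le_U {t : ι} {v : X} (hv : v ∈ B.U t) (m' n' d : ℕ) :
    monoSpan p K m' n' d v ≤ B.U t := by
  refine Submodule.span_le.2 ?_
  rintro _ ⟨a, b, -, rfl⟩
  exact B.mono_mem_U a b hv

theorem monoSpan_le_G {t : ι} {l k m' n' d : ℕ} {v : X} (hv : v ∈ B.G t l)
    (h : ∀ a b, d ≤ a * m' + b * n' → k ≤ a * m t + b * n t) :
    monoSpan p K m' n' d v ≤ B.G t (l + k) := by
  refine Submodule.span_le.2 ?_
  rintro _ ⟨a, b, hd, rfl⟩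
  exact B.G_anti t (by have := h a b hd; omega) (B.mono_mem_G a b hv)

theorem monoSpan_le_G_self {t : ι} {l d : ℕ} {v : X} (hv : v ∈ B.G t l) :
    monoSpan p K (m t) (n t) d v ≤ B.G t (l + d) := monoSpan_le_G hv fun _ _ h => h

section Fill

variable [Fintype ι]

/-- If all integers `≥ d` are of the form `a * m + b * n`, then the `F ^ a V ^ b v` span everything
of order `≥ l + d` in the component at `s`. -/
theorem exists_sub_mem_U {s : ι} {l d : ℕ} {c : K} {v z : X} (hv : v ∈ B.lattice)
    (hl : B.Lead s l c v) (hc : c ≠ 0) (hd : ∀ k ≥ d, ∃ a b, a * m s + b * n s = k)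
    (hz : z ∈ B.lattice) (hzG : z ∈ B.G s (l + d)) :
    ∃ r ∈ monoSpan p K (m s) (n s) d v, z - r ∈ B.U s := by
  have hR : monoSpan p K (m s) (n s) d v ≤ B.lattice := monoSpan_le_lattice hv _ _ _
  have step : ∀ k, ∃ r ∈ monoSpan p K (m s) (n s) d v, z - r ∈ B.G s (l + d + k) := by
    intro k
    induction k with
    | zero => exact ⟨0, zero_mem _, by simpa using hzG⟩
    | succ k ih =>
      obtain ⟨r, hr, hzr⟩ := ih
      obtain ⟨c₁, hc₁⟩ := exists_lead hzr
      -- A monomial of order exactly d + k hits the current leading index, and a Teichmüller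
      -- multiple of it cancels the leading term.
      obtain ⟨a, b, hab⟩ := hd (d + k) (by omega)
      have h1 := hl.mono a b
      have h0 : tw p K (a - b) c ≠ 0 := by simpa using hc
      rw [hab, ← add_assoc] at h1
      have h2 := hc₁.sub (h1.smul (c₁ / tw p K (a - b) c))
      rw [div_mul_cancel₀ _ h0, sub_self, lead_zero_iff, sub_sub] at h2
      exact ⟨_, add_mem hr (Submodule.smul_mem _ _ (mono_mem_monoSpan (by omega) v)), h2⟩
  -- No limit of the approximations r is needed: the sum of the monomial span and `B.U s ⊓
  -- B.lattice` is p-adically closed.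
  have hz' : z ∈ monoSpan p K (m s) (n s) d v ⊔ (B.U s ⊓ B.lattice) := by
    refine B.mem_of_forall_p_pow (sup_le hR inf_le_right) fun N => ?_
    obtain ⟨r, hr, hzr⟩ := step (N * (m s + n s))
    obtain ⟨y, hy, hy', -⟩ := B.exists_split N (B.G_anti s (Nat.le_add_left _ _) hzr)
    refine ⟨r + (z - r - (p : WittVector p K) ^ N • y), add_mem (Submodule.mem_sup_left hr)
      (Submodule.mem_sup_right ⟨hy', sub_mem (sub_mem hz (hR hr)) (Submodule.smul_mem _ _ hy)⟩),
      y, hy, by abel⟩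
  obtain ⟨r, hr, u, hu, rfl⟩ := Submodule.mem_sup.1 hz'
  exact ⟨r, hr, by simpa using hu.1⟩

end Fill

section Relation

variable {s : ι} {v r v' : X} {x y : K}

/-- A relation `[x] F ^ n v ≡ [y] V ^ m v` makes all monomials of the same order proportional. -/
theorem mono_mem_of_relation_step (hx : x ≠ 0) (hy : y ≠ 0)
    (hr : r ∈ monoSpan p K (m s) (n s) (m s * n s + 1) v)
    (hv' : v' = WittVector.teichmuller p x • mono p K X (n s) 0 v -
      WittVector.teichmuller p y • mono p K X 0 (m s) v - r)
    (a b d : ℕ) (hd : d = a * m s + b * n s + m s * n s) :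
    mono p K X (a + n s) b v ∈ Submodule.span (WittVector p K) {mono p K X a (b + m s) v} ⊔
        (monoSpan p K (m s) (n s) (d + 1) v ⊔ monoSpan p K (m s) (n s) 0 v') ∧
    mono p K X a (b + m s) v ∈ Submodule.span (WittVector p K) {mono p K X (a + n s) b v} ⊔
        (monoSpan p K (m s) (n s) (d + 1) v ⊔ monoSpan p K (m s) (n s) 0 v') := by
  set T := monoSpan p K (m s) (n s) (d + 1) v ⊔ monoSpan p K (m s) (n s) 0 v' with hT
  have h1 : mono p K X a b v' ∈ T :=
    Submodule.mem_sup_right (mono_mem_monoSpan (Nat.zero_le _) v')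
  have h2 : mono p K X a b r ∈ T := Submodule.mem_sup_left
    (monoSpan_anti _ _ (by omega) v (mono_mem_monoSpan_add hr a b))
  -- This is F^a V^b applied to the relation, with r absorbed into higher order. Either monomial can
  -- be solved for, its Teichmüller coefficient being a unit.
  have h3 := add_mem h1 h2
  rw [hv', map_sub, map_sub, mono_teichmuller_smul, mono_teichmuller_smul, mono_mono, mono_mono,
    add_zero, add_zero, sub_add_cancel] at h3
  have hx' : tw p K (a - b) x ≠ 0 := by simpa using hx
  have hy' : tw p K (a - b) y ≠ 0 := by simpa using hy
  obtain ⟨cx, hcx⟩ := (isUnit_teichmuller (p := p) hx').exists_left_inv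
  obtain ⟨cy, hcy⟩ := (isUnit_teichmuller (p := p) hy').exists_left_inv
  constructor
  · have h4 := T.smul_mem cx h3
    rw [smul_sub, smul_smul, smul_smul, hcx, one_smul] at h4
    rw [Submodule.mem_sup]
    exact ⟨_, Submodule.smul_mem _ _ (Submodule.mem_span_singleton_self _), _, h4,
      add_sub_cancel _ _⟩
  · have h4 := T.smul_mem cy h3
    rw [smul_sub, smul_smul, smul_smul, hcy, one_smul] at h4
    rw [Submodule.mem_sup]
    exact ⟨_, Submodule.smul_mem _ _ (Submodule.mem_span_singleton_self _), _, T.neg_mem h4, by abel⟩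

theorem span_sup_le {R A : Type*} [CommRing R] [AddCommGroup A] [Module R A] {x y z : A}
    {T : Submodule R A} (h : x ∈ Submodule.span R {y} ⊔ T) (h' : y ∈ Submodule.span R {z} ⊔ T) :
    x ∈ Submodule.span R {z} ⊔ T :=
  sup_le (Submodule.span_le.2 (Set.singleton_subset_iff.2 h')) le_sup_right h

/-- F^n is traded for V^m one step at a time. All intermediate monomials have the same order d, so
the errors stay in one submodule. -/
theorem mono_mem_of_relation (hx : x ≠ 0) (hy : y ≠ 0)
    (hr : r ∈ monoSpan p K (m s) (n s) (m s * n s + 1) v)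
    (hv' : v' = WittVector.teichmuller p x • mono p K X (n s) 0 v -
      WittVector.teichmuller p y • mono p K X 0 (m s) v - r)
    (d k : ℕ) : ∀ a b, d = (a + k * n s) * m s + b * n s →
    mono p K X (a + k * n s) b v ∈ Submodule.span (WittVector p K) {mono p K X a (b + k * m s) v} ⊔
        (monoSpan p K (m s) (n s) (d + 1) v ⊔ monoSpan p K (m s) (n s) 0 v') ∧
    mono p K X a (b + k * m s) v ∈ Submodule.span (WittVector p K) {mono p K X (a + k * n s) b v} ⊔
        (monoSpan p K (m s) (n s) (d + 1) v ⊔ monoSpan p K (m s) (n s) 0 v') := by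
  induction k with
  | zero =>
    intro a b _
    simp only [zero_mul, add_zero, and_self]
    exact Submodule.mem_sup_left (Submodule.mem_span_singleton_self _)
  | succ k ih =>
    intro a b hd
    have h1 := ih (a + n s) b (by rw [hd]; ring)
    have h2 := mono_mem_of_relation_step hx hy hr hv' a (b + k * m s) d (by rw [hd]; ring)
    rw [show a + n s + k * n s = a + (k + 1) * n s by ring] at h1
    rw [show b + k * m s + m s = b + (k + 1) * m s by ring] at h2
    exact ⟨span_sup_le h1.1 h2.1, span_sup_le h2.2 h1.2⟩

theorem exists_of_mul_add_mul_eq {m n a b a' b' : ℕ} (hmn : m.Coprime n) (hm : 0 < m) (hn : 0 < n)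
    (h : a * m + b * n = a' * m + b' * n) :
    ∃ k, (a = a' + k * n ∧ b' = b + k * m) ∨ (a' = a + k * n ∧ b = b' + k * m) := by
  wlog haa : a' ≤ a generalizing a b a' b'
  · obtain ⟨k, hk⟩ := this h.symm (by omega)
    exact ⟨k, hk.symm⟩
  obtain ⟨c, rfl⟩ := Nat.exists_eq_add_of_le haa
  have h1 : c * m + b * n = b' * n := by rw [add_mul] at h; omega
  have h2 : n ∣ c * m := (Nat.dvd_add_left (Dvd.intro_left b rfl)).1 (h1 ▸ Dvd.intro_left b' rfl)
  obtain ⟨k, rfl⟩ := hmn.symm.dvd_of_dvd_mul_right h2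
  refine ⟨k, Or.inl ⟨by ring, ?_⟩⟩
  exact (Nat.eq_of_mul_eq_mul_right hn (by rw [← h1]; ring)).symm

/-- By coprimality, any two monomials of the same order are linked by trades of F^n for V^m. So each
graded piece is cyclic modulo the span of the monomials in v'. -/
theorem monoSpan_le_of_relation (hmn : (m s).Coprime (n s)) (hm : 0 < m s) (hn : 0 < n s)
    (hx : x ≠ 0) (hy : y ≠ 0)
    (hr : r ∈ monoSpan p K (m s) (n s) (m s * n s + 1) v)
    (hv' : v' = WittVector.teichmuller p x • mono p K X (n s) 0 v -
      WittVector.teichmuller p y • mono p K X 0 (m s) v - r) (a b : ℕ) :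
    monoSpan p K (m s) (n s) (a * m s + b * n s) v ≤
      Submodule.span (WittVector p K) {mono p K X a b v} ⊔
        (monoSpan p K (m s) (n s) (a * m s + b * n s + 1) v ⊔
          monoSpan p K (m s) (n s) 0 v') := by
  refine Submodule.span_le.2 ?_
  rintro _ ⟨a', b', h, rfl⟩
  obtain h | h := h.eq_or_lt
  · obtain ⟨k, ⟨rfl, rfl⟩ | ⟨rfl, rfl⟩⟩ := exists_of_mul_add_mul_eq hmn hm hn h
    · exact (mono_mem_of_relation hx hy hr hv' _ k a' b rfl).2
    · exact (mono_mem_of_relation hx hy hr hv' _ k a b' h).1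
  · exact Submodule.mem_sup_right (Submodule.mem_sup_left (mono_mem_monoSpan h v))

/-- Elements of high order in `monoSpan` lie, modulo multiples of `v'`, in the span of monomials
of high order. -/
theorem exists_sub_mem_monoSpan {l : ℕ} {c : K} (hl : B.Lead s l c v) (hc : c ≠ 0)
    (hmn : (m s).Coprime (n s))
    (hx : x ≠ 0) (hy : y ≠ 0)
    (hr : r ∈ monoSpan p K (m s) (n s) (m s * n s + 1) v)
    (hv' : v' = WittVector.teichmuller p x • mono p K X (n s) 0 v -
      WittVector.teichmuller p y • mono p K X 0 (m s) v - r) (hU : v' ∈ B.U s)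
    {q : X} (hq : q ∈ monoSpan p K (m s) (n s) 0 v) (d : ℕ) (hqG : q ∈ B.G s (l + d)) :
    ∃ q' ∈ monoSpan p K (m s) (n s) 0 v', q - q' ∈ monoSpan p K (m s) (n s) d v := by
  induction d with
  | zero => exact ⟨0, zero_mem _, by simpa using hq⟩
  | succ d ih =>
    obtain ⟨q', hq', hqq⟩ := ih (B.G_anti s (by omega) hqG)
    by_cases hab : ∃ a b, a * m s + b * n s = d
    · obtain ⟨a, b, rfl⟩ := hab
      have h1 := monoSpan_le_of_relation hmn (B.m_pos s) (B.n_pos s) hx hy hr hv' a b hqq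
      obtain ⟨_, h2, z, hz, h3⟩ := Submodule.mem_sup.1 h1
      obtain ⟨w, rfl⟩ := Submodule.mem_span_singleton.1 h2
      obtain ⟨f, hf, q'', hq'', rfl⟩ := Submodule.mem_sup.1 hz
      have hUle := monoSpan_le_U hU (m s) (n s) 0
      -- The part of order d must cancel at s, since q has higher order there and v' has no
      -- component at s. Its leading coefficient is a nonzero multiple of the residue of w, so p
      -- divides w.
      have h4 : w • mono p K X a b v ∈ B.G s (l + (a * m s + b * n s) + 1) := by
        have : w • mono p K X a b v = q - q' - f - q'' := by
          rw [← h3, sub_sub, add_sub_cancel_right]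
        rw [this]
        refine sub_mem (sub_mem (sub_mem hqG (B.U_le_G _ _ (hUle hq'))) ?_)
          (B.U_le_G _ _ (hUle hq''))
        have := monoSpan_le_G_self hl.mem_G hf
        rwa [← add_assoc] at this
      have h5 : w.coeff 0 * tw p K (a - b) c = 0 :=
        ((hl.mono a b).witt_smul w).unique (lead_zero_iff.2 h4)
      have h0 : tw p K (a - b) c ≠ 0 := by simpa using hc
      have h6 : w.coeff 0 = 0 := by
        rcases mul_eq_zero.1 h5 with h | h
        · exact h
        · exact absurd h h0
      obtain ⟨w', rfl⟩ := (p_dvd_iff_coeff_zero w).2 h6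
      refine ⟨q' + q'', add_mem hq' hq'', ?_⟩
      -- As p = FV, the factor p adds one F and one V, which raises the order.
      have h7 : ((p : WittVector p K) * w') • mono p K X a b v = w' • mono p K X (a + 1) (b + 1) v := by
        rw [mul_comm, mul_smul, p_smul_eq, ← frobHom_verHom, verHom_mono, frobHom_mono]
      rw [h7] at h3
      have : q - (q' + q'') = w' • mono p K X (a + 1) (b + 1) v + f := by
        rw [← sub_sub, ← h3, ← add_assoc, add_sub_cancel_right]
      rw [this]
      refine add_mem (Submodule.smul_mem _ _ (mono_mem_monoSpan ?_ v)) hf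
      have := B.m_pos s
      rw [add_mul, add_mul]; omega
    · refine ⟨q', hq', Submodule.span_mono ?_ hqq⟩
      rintro _ ⟨a, b, h, rfl⟩
      refine ⟨a, b, ?_, rfl⟩
      by_contra h'
      exact hab ⟨a, b, by omega⟩

/-- If k - l is not of the form a m + b n, then modulo multiples of v' the element q involves only
monomials of order above k - l, and its coefficient at k vanishes. For k < l it vanishes because
everything has order at least l. -/
theorem exists_eq_of_lead {l : ℕ} {c : K} (hl : B.Lead s l c v) (hc : c ≠ 0)
    (hmn : (m s).Coprime (n s))
    (hx : x ≠ 0) (hy : y ≠ 0)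
    (hr : r ∈ monoSpan p K (m s) (n s) (m s * n s + 1) v)
    (hv' : v' = WittVector.teichmuller p x • mono p K X (n s) 0 v -
      WittVector.teichmuller p y • mono p K X 0 (m s) v - r) (hU : v' ∈ B.U s)
    {q : X} (hq : q ∈ monoSpan p K (m s) (n s) 0 v) {k : ℕ} {c' : K} (hk : B.Lead s k c' q)
    (hc' : c' ≠ 0) : ∃ a b, k = a * m s + b * n s + l := by
  by_contra hcon
  apply hc'
  refine hk.unique (lead_zero_iff.2 ?_)
  by_cases hlk : l ≤ k
  · obtain ⟨d, rfl⟩ := Nat.exists_eq_add_of_le hlk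
    obtain ⟨q', hq', h⟩ := exists_sub_mem_monoSpan hl hc hmn hx hy hr hv' hU hq d hk.mem_G
    have h' : q - q' ∈ monoSpan p K (m s) (n s) (d + 1) v := by
      refine Submodule.span_mono ?_ h
      rintro _ ⟨a, b, h, rfl⟩
      refine ⟨a, b, ?_, rfl⟩
      by_contra h'
      exact hcon ⟨a, b, by omega⟩
    have := add_mem (monoSpan_le_G_self hl.mem_G h')
      (B.U_le_G s _ (monoSpan_le_U hU _ _ _ hq'))
    rwa [sub_add_cancel] at this
  · exact B.G_anti s (by omega) (monoSpan_le_G_self hl.mem_G hq)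

theorem exists_monoSpan_le_p_pow [Fintype ι] (B : Frame p K X m n) (hv : v ∈ B.lattice) (s : ι)
    (N : ℕ) :
    ∃ d, ∀ x ∈ monoSpan p K (m s) (n s) d v,
      ∃ y ∈ B.lattice, x = (p : WittVector p K) ^ N • y := by
  -- Monomials are graded by the weights of s. Order at least (m_s + n_s) D forces a + b ≥ D, hence
  -- order at least D in every component; D = N ∑ h_t yields divisibility by p^N.
  refine ⟨(m s + n s) * (N * ∑ t, (m t + n t)), fun x hx => B.exists_p_pow_smul_of_mem_G N fun t => ?_⟩
  have := monoSpan_le_G (B := B) (B.lattice_le_G t hv) (k := N * (m t + n t)) (fun a b h => ?_) hx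
  · simpa using this
  have h1 : a * m s + b * n s ≤ (m s + n s) * (a + b) := by nlinarith [Nat.zero_le (a * n s)]
  have h2 := Nat.le_of_mul_le_mul_left (h.trans h1) (B.h_pos s)
  have h3 : m t + n t ≤ ∑ t, (m t + n t) :=
    Finset.single_le_sum (f := fun t => m t + n t) (fun _ _ => Nat.zero_le _) (Finset.mem_univ t)
  have h4 := Nat.mul_le_mul_left N h3
  nlinarith [B.m_pos t, B.n_pos t]

/-- The elements of `monoSpan` with vanishing component at `s` are generated by `v'`. -/
theorem mem_monoSpan_of_mem_U [Fintype ι] {l : ℕ} {c : K} (hv : v ∈ B.lattice)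
    (hl : B.Lead s l c v) (hc : c ≠ 0)
    (hmn : (m s).Coprime (n s))
    (hx : x ≠ 0) (hy : y ≠ 0)
    (hr : r ∈ monoSpan p K (m s) (n s) (m s * n s + 1) v)
    (hv' : v' = WittVector.teichmuller p x • mono p K X (n s) 0 v -
      WittVector.teichmuller p y • mono p K X 0 (m s) v - r) (hU : v' ∈ B.U s)
    (hvl : v' ∈ B.lattice)
    {q : X} (hq : q ∈ monoSpan p K (m s) (n s) 0 v) (hqU : q ∈ B.U s) :
    q ∈ monoSpan p K (m s) (n s) 0 v' := by
  -- As q has no component at s, modulo multiples of v' it lies in monomial spans of arbitrarily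
  -- high order, so it is p-adically close to the span of v'.
  refine B.mem_of_forall_p_pow (monoSpan_le_lattice hvl _ _ _) fun N => ?_
  obtain ⟨d, hd⟩ := B.exists_monoSpan_le_p_pow hv s N
  obtain ⟨q', hq', h⟩ := exists_sub_mem_monoSpan hl hc hmn hx hy hr hv' hU hq d
    (B.U_le_G _ _ hqU)
  obtain ⟨y, hy, hxy⟩ := hd _ h
  exact ⟨q', hq', y, hy, by rw [← hxy]; abel⟩

end Relation

end Frame

/-! ### Independence over finite fields under elimination. -/

section Independence

variable (p : ℕ) [Fact p.Prime] {K : Type*} [Field K] [CharP K p] [PerfectRing K p]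
variable {ι : Type*} [Fintype ι] (m n : ι → ℕ)

/-- For every pair `(m s, n s)`, the `a t` with `t ∉ S` and the same pair are linearly independent
over the field with `p ^ (m s + n s)` elements. -/
def Indep (S : Finset ι) (a : ι → K) : Prop :=
  ∀ (s : ι) (c : ι → K), (∀ t, c t ^ p ^ (m s + n s) = c t) →
    (∀ t, c t ≠ 0 → t ∉ S ∧ m t = m s ∧ n t = n s) → ∑ t, c t * a t = 0 → ∀ t, c t = 0

variable {p m n}

theorem Indep.ne_zero {S : Finset ι} {a : ι → K} (h : Indep p m n S a) {s : ι} (hs : s ∉ S) :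
    a s ≠ 0 := by
  classical
  intro h0
  have := h s (Pi.single s 1) (fun t => ?_) (fun t ht => ?_) ?_ s
  · simp at this
  · have hp : p ^ (m s + n s) ≠ 0 := pow_ne_zero _ (Fact.out : p.Prime).ne_zero
    by_cases hts : t = s
    · subst hts; simp
    · rw [Pi.single_eq_of_ne hts, zero_pow hp]
  · by_cases hts : t = s
    · subst hts; exact ⟨hs, rfl, rfl⟩
    · simp [hts] at ht
  · simp [Pi.single_apply, h0]

theorem Indep.smul {S : Finset ι} {a : ι → K} (h : Indep p m n S a) {x : K} (hx : x ≠ 0) :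
    Indep p m n S (fun t => x * a t) := by
  intro s c hc hS hsum
  refine h s c hc hS ?_
  have : ∑ t, c t * (x * a t) = x * ∑ t, c t * a t := by
    rw [Finset.mul_sum]; exact Finset.sum_congr rfl fun t _ => by ring
  rw [this] at hsum
  exact (mul_eq_zero.1 hsum).resolve_left hx

variable (p) in
open Classical in
/-- The leading coefficients after the component at `s` has been eliminated. -/
def elimCoeff (m n : ι → ℕ) (a : ι → K) (s t : ι) : K :=
  (if m t = m s ∧ n t = n s then tw p K (-m s) (a s) * tw p K (n s) (a t) else 0) -
    tw p K (n s) (a s) * tw p K (-m s) (a t)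

theorem tw_pow_eq (z : ℤ) {x : K} {q : ℕ} (h : x ^ q = x) : tw p K z x ^ q = tw p K z x := by
  rw [← map_pow, h]

/-- Put q = p^h with h = m_s + n_s. For t with the pair of s, σ^{m_s} takes `elimCoeff` to a_s a_t^q
- a_s^q a_t. A relation among these with coefficients d_t fixed by x ↦ x^q says that w = ∑ d_t a_t
satisfies a_s w^q = a_s^q w. Then w / a_s is fixed too, and ∑ d_t a_t = (w / a_s) a_s is a relation
among the old coefficients. For other pairs, `elimCoeff` is a nonzero constant times a twist of a_t.
-/
theorem Indep.elim [DecidableEq ι] {S : Finset ι} {a : ι → K} (h : Indep p m n S a) {s : ι}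
    (hs : s ∉ S) : Indep p m n (insert s S) (elimCoeff p m n a s) := by
  intro s' c hc hS hsum
  have has : a s ≠ 0 := h.ne_zero hs
  have hd : ∀ t, tw p K (m s) (c t) ^ p ^ (m s' + n s') = tw p K (m s) (c t) := fun t =>
    tw_pow_eq _ (hc t)
  have hd0 : ∀ t, tw p K (m s) (c t) = 0 ↔ c t = 0 := fun t => by simp
  have hmm : ∀ y : K, tw p K (m s) (tw p K (-m s) y) = y := fun y => by
    rw [← tw_add, add_neg_cancel, tw_zero]
  have hsum' := congrArg (tw p K (m s)) hsum
  rw [map_zero, map_sum] at hsum'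
  by_cases hss : m s' = m s ∧ n s' = n s
  · have key : ∑ t, tw p K (m s) (c t) * (a s * a t ^ p ^ (m s + n s) -
        a s ^ p ^ (m s + n s) * a t) = 0 := by
      rw [← hsum']
      refine Finset.sum_congr rfl fun t _ => ?_
      by_cases hct : c t = 0
      · simp [hct]
      obtain ⟨-, h1, h2⟩ := hS t hct
      rw [elimCoeff, if_pos ⟨h1.trans hss.1, h2.trans hss.2⟩, map_mul, map_sub, map_mul, map_mul,
        hmm, hmm, ← tw_add, ← tw_add, ← Nat.cast_add, tw_natCast (m s + n s), tw_natCast (m s + n s)]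
    have hd' : ∀ t, tw p K (m s) (c t) ^ p ^ (m s + n s) = tw p K (m s) (c t) := by
      intro t; have := hd t; rwa [hss.1, hss.2] at this
    set d : ι → K := fun t => tw p K (m s) (c t) with hdd
    set w := ∑ t, d t * a t with hw
    have hwq : w ^ p ^ (m s + n s) = ∑ t, d t * a t ^ p ^ (m s + n s) := by
      rw [hw, sum_pow_char_pow]
      exact Finset.sum_congr rfl fun t _ => by rw [mul_pow, hd']
    have hw1 : a s * w ^ p ^ (m s + n s) = a s ^ p ^ (m s + n s) * w := by
      rw [hwq, hw, Finset.mul_sum, Finset.mul_sum, ← sub_eq_zero, ← Finset.sum_sub_distrib, ← key]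
      exact Finset.sum_congr rfl fun t _ => by ring
    -- The relation does not involve s, which leaves room there for the coefficient -(w / a s).
    have hds : d s = 0 := by
      by_contra hne
      have := (hS s fun h0 => hne ((hd0 s).2 h0)).1
      simp at this
    -- The sign is handled by additivity of Frobenius, which covers p = 2 as well.
    have hodd : (-(w / a s)) ^ p ^ (m s + n s) = -(w / a s) := by
      have h1 : (w / a s) ^ p ^ (m s + n s) = w / a s := by
        rw [div_pow, div_eq_div_iff (pow_ne_zero _ has) has]
        linear_combination hw1
      have h2 := sub_pow_char_pow (0 : K) (w / a s) (p := p) (n := m s + n s)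
      rw [zero_pow (pow_ne_zero _ (Fact.out : p.Prime).ne_zero), zero_sub, zero_sub, h1] at h2
      exact h2
    have hfin := h s (Function.update d s (-(w / a s))) (fun t => ?_) (fun t ht => ?_) ?_
    · intro t
      by_cases hts : t = s
      · subst hts; exact (hd0 t).1 hds
      · have := hfin t
        rw [Function.update_of_ne hts] at this
        exact (hd0 t).1 this
    · by_cases hts : t = s
      · subst hts; simpa using hodd
      · rw [Function.update_of_ne hts]; exact hd' t
    · by_cases hts : t = s
      · subst hts; exact ⟨hs, rfl, rfl⟩
      · rw [Function.update_of_ne hts] at ht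
        obtain ⟨h1, h2, h3⟩ := hS t fun h0 => ht ((hd0 t).2 h0)
        exact ⟨fun h => h1 (Finset.mem_insert_of_mem h), h2.trans hss.1, h3.trans hss.2⟩
    · have h1 : ∑ t, Function.update d s (-(w / a s)) t * a t =
          ∑ t, (d t * a t + if t = s then -w else 0) := by
        refine Finset.sum_congr rfl fun t _ => ?_
        by_cases hts : t = s
        · subst hts; simp [hds, has]
        · simp [hts]
      rw [h1, Finset.sum_add_distrib, Finset.sum_ite_eq' Finset.univ s, if_pos (Finset.mem_univ s),
        ← hw, add_neg_cancel]
  · have hne : ∀ t, c t ≠ 0 → ¬(m t = m s ∧ n t = n s) := fun t ht h' => by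
      obtain ⟨-, h1, h2⟩ := hS t ht
      exact hss ⟨h1.symm.trans h'.1, h2.symm.trans h'.2⟩
    have key : ∑ t, tw p K (m s) (c t) * a t = 0 := by
      have hy : tw p K (m s) (tw p K (n s) (a s)) ≠ 0 := by simpa using has
      have : -tw p K (m s) (tw p K (n s) (a s)) * ∑ t, tw p K (m s) (c t) * a t = 0 := by
        rw [← hsum', Finset.mul_sum]
        refine Finset.sum_congr rfl fun t _ => ?_
        by_cases hct : c t = 0
        · simp [hct]
        rw [elimCoeff, if_neg (hne t hct), map_mul, zero_sub, map_neg, map_mul, hmm]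
        ring
      exact (mul_eq_zero.1 this).resolve_left (neg_ne_zero.2 hy)
    intro t
    refine (hd0 t).1 (h s' (fun t => tw p K (m s) (c t)) hd (fun t ht => ?_) key t)
    obtain ⟨h1, h2⟩ := hS t fun h0 => ht ((hd0 t).2 h0)
    exact ⟨fun h => h1 (Finset.mem_insert_of_mem h), h2⟩

end Independence

/-! ### Elimination of components along increasing slopes. -/

namespace Frame

variable {p : ℕ} [Fact p.Prime] {K : Type*} [Field K] [CharP K p] [PerfectRing K p]
variable {X : Type*} [AddCommGroup X] [WittVector.Isocrystal p K X]
variable [Module (WittVector p K) X] [IsScalarTower (WittVector p K) K(p, K) X]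
variable {ι : Type*} {m n : ι → ℕ} {B : Frame p K X m n} [Fintype ι]

theorem dieudonneSpan_le_lattice {v : X} (hv : v ∈ B.lattice) : dieudonneSpan (K := K) p v ≤ B.lattice := by
  rw [dieudonneSpan_eq 0 0]; exact monoSpan_le_lattice hv _ _ _

theorem dieudonneSpan_le_U {t : ι} {v : X} (hv : v ∈ B.U t) : dieudonneSpan (K := K) p v ≤ B.U t := by
  rw [dieudonneSpan_eq 0 0]; exact monoSpan_le_U hv _ _ _

theorem dieudonneSpan_le_of_mem {u v : X} (h : u ∈ dieudonneSpan (K := K) p v) :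
    dieudonneSpan (K := K) p u ≤ dieudonneSpan (K := K) p v := by
  rw [dieudonneSpan_eq 0 0] at h ⊢
  rw [dieudonneSpan_eq 0 0]
  exact monoSpan_le_of_mem h

/-- Elimination of the component at `s`. -/
theorem exists_elim [DecidableEq ι] (hmn : ∀ t, (m t).Coprime (n t)) {S : Finset ι} {s : ι}
    (hs : s ∉ S)
    (hmin : ∀ t, t ∉ S → m s * n t ≤ m t * n s) {v : X} {C : ℕ} {a : ι → K} (hv : v ∈ B.lattice)
    (hl : ∀ t, t ∉ S → B.Lead t (C * n t) (a t) v) (ha : Indep p m n S a) :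
    ∃ v' ∈ dieudonneSpan (K := K) p v, v' ∈ B.U s ∧
      (∀ t, t ∉ insert s S → B.Lead t ((C + m s) * n t) (elimCoeff p m n a s t) v') ∧
      (∀ q ∈ dieudonneSpan (K := K) p v, q ∈ B.U s → q ∈ dieudonneSpan (K := K) p v') ∧
      (∀ q ∈ dieudonneSpan (K := K) p v, ∀ k, ∀ c ≠ 0, B.Lead s k c q →
        ∃ i j, k = i * m s + j * n s + C * n s) := by
  have hn := B.n_pos s
  have hm := B.m_pos s
  have has := ha.ne_zero hs
  have hx : tw p K (-m s) (a s) ≠ 0 := by simpa using has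
  have hy : tw p K (n s) (a s) ≠ 0 := by simpa using has
  -- Both monomials have order C n_s + m_s n_s at s, with leading coefficients σ^{n_s}(a_s) and
  -- σ^{-m_s}(a_s); cross-multiplication cancels them.
  set u := WittVector.teichmuller p (tw p K (-m s) (a s)) • mono p K X (n s) 0 v -
      WittVector.teichmuller p (tw p K (n s) (a s)) • mono p K X 0 (m s) v with hu
  have hF : ∀ t, t ∉ S → B.Lead t (C * n t + n s * m t) (tw p K (n s) (a t))
      (mono p K X (n s) 0 v) := fun t ht => by simpa using (hl t ht).mono (n s) 0
  have hV : ∀ t, t ∉ S → B.Lead t (C * n t + m s * n t) (tw p K (-m s) (a t))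
      (mono p K X 0 (m s) v) := fun t ht => by simpa using (hl t ht).mono 0 (m s)
  have hul : u ∈ B.lattice := sub_mem (Submodule.smul_mem _ _ (B.mono_mem_lattice _ _ hv))
    (Submodule.smul_mem _ _ (B.mono_mem_lattice _ _ hv))
  have hlead : ∀ t, t ∉ S → B.Lead t (C * n t + m s * n t) (elimCoeff p m n a s t) u := by
    intro t ht
    have h2 := (hV t ht).smul (tw p K (n s) (a s))
    rw [elimCoeff]
    split_ifs with h
    · have h1 := (hF t ht).smul (tw p K (-m s) (a s))
      rw [h.1, mul_comm (n s), ← h.2] at h1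
      have := h1.sub h2
      simpa only [h.1, h.2] using this
    · refine (lead_zero_iff.2 ?_).sub h2
      refine Submodule.smul_mem _ _ (B.G_anti t ?_ (hF t ht).mem_G)
      -- Equal slopes in lowest terms mean equal pairs. So the slope of t is strictly larger, and at
      -- t the F-term has higher order than the V-term.
      have h3 : m s * n t ≠ m t * n s := by
        intro heq
        apply h
        have e1 : m s ∣ m t := (hmn s).dvd_of_dvd_mul_right (heq ▸ Dvd.intro _ rfl)
        have e2 : m t ∣ m s := (hmn t).dvd_of_dvd_mul_right (heq ▸ Dvd.intro _ rfl)
        have e := Nat.dvd_antisymm e2 e1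
        refine ⟨e, ?_⟩
        rw [e] at heq
        exact Nat.eq_of_mul_eq_mul_left hm heq
      have := lt_of_le_of_ne (hmin t ht) h3
      rw [mul_comm (n s)]
      omega
  have huG : u ∈ B.G s (C * n s + (m s * n s + 1)) := by
    have := hlead s hs
    rwa [elimCoeff, if_pos ⟨rfl, rfl⟩, mul_comm (tw p K (-m s) _), sub_self, lead_zero_iff, add_assoc] at this
  -- Every integer from (m_s - 1)(n_s - 1) on is of the form a m_s + b n_s, in particular every
  -- integer above m_s n_s.
  obtain ⟨r, hr, hur⟩ := exists_sub_mem_U hv (hl s hs) has (fun k hk =>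
    Nat.exists_add_mul_eq_of_gcd_dvd_of_mul_pred_le (m s) (n s) k
      (by simp [(hmn s).gcd_eq_one])
      ((Nat.mul_le_mul (Nat.pred_le _) (Nat.pred_le _)).trans (by omega))) hul huG
  have hrl : r ∈ B.lattice := monoSpan_le_lattice hv _ _ _ hr
  refine ⟨u - r, ?_, hur, fun t ht => ?_, fun q hq hqU => ?_, fun q hq k c hc hk => ?_⟩
  · rw [dieudonneSpan_eq (m s) (n s)]
    exact sub_mem (sub_mem (Submodule.smul_mem _ _ (mono_mem_monoSpan (Nat.zero_le _) v))
      (Submodule.smul_mem _ _ (mono_mem_monoSpan (Nat.zero_le _) v)))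
      (monoSpan_anti _ _ (Nat.zero_le _) v hr)
  · have htS : t ∉ S := fun h => ht (Finset.mem_insert_of_mem h)
    rw [add_mul]
    refine (hlead t htS).sub_mem ?_
    rw [add_assoc]
    refine monoSpan_le_G (hl t htS).mem_G (fun i j hij => ?_) hr
    have h1 := hmin t htS
    -- Because s has minimal slope, order above m_s n_s at s forces order above m_s n_t at t, so
    -- subtracting r leaves the leading terms of u intact.
    have h2 : (m s * n t) * n s < (i * m t + j * n t) * n s :=
      calc (m s * n t) * n s = m s * n s * n t := by ring
        _ < (i * m s + j * n s) * n t := Nat.mul_lt_mul_of_pos_right hij (B.n_pos t)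
        _ = i * (m s * n t) + j * n t * n s := by ring
        _ ≤ i * (m t * n s) + j * n t * n s := by gcongr
        _ = _ := by ring
    exact Nat.lt_of_mul_lt_mul_right h2
  · rw [dieudonneSpan_eq (m s) (n s)] at hq ⊢
    exact mem_monoSpan_of_mem_U hv (hl s hs) has (hmn s) hx hy hr rfl hur (sub_mem hul hrl) hq hqU
  · rw [dieudonneSpan_eq (m s) (n s)] at hq
    exact exists_eq_of_lead (hl s hs) has (hmn s) hx hy hr rfl hur hq hk hc

variable [LinearOrder ι]

/-- Removing s raises the order at t by m_s n_t, which explains the factor ∑ m_s. The last clause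
guarantees that nothing is lost: elements of the module without components in S are generated by the
new element u. -/
theorem exists_stage (hmn : ∀ t, (m t).Coprime (n t)) (hslope : ∀ s t, s ≤ t → m s * n t ≤ m t * n s)
    {v : X} {a : ι → K} (hv : v ∈ B.lattice) (hl : ∀ t, B.Lead t 0 (a t) v)
    (ha : Indep p m n ∅ a) (S : Finset ι) (hS : IsLowerSet (S : Set ι)) :
    ∃ u ∈ dieudonneSpan (K := K) p v, ∃ a' : ι → K, (∀ s ∈ S, u ∈ B.U s) ∧
      (∀ t, t ∉ S → B.Lead t ((∑ s ∈ S, m s) * n t) (a' t) u) ∧ Indep p m n S a' ∧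
      ∀ q ∈ dieudonneSpan (K := K) p v, (∀ s ∈ S, q ∈ B.U s) → q ∈ dieudonneSpan (K := K) p u := by
  induction S using Finset.induction_on_max with
  | empty =>
    refine ⟨v, ?_, a, by simp, by simpa using hl, ha, by simp⟩
    rw [dieudonneSpan_eq 0 0]; exact self_mem_monoSpan _ _ v
  | insert s S hmax ih =>
    have hs : s ∉ S := fun h => lt_irrefl _ (hmax s h)
    have hS' : IsLowerSet (S : Set ι) := by
      intro x y hyx hx
      have := hS hyx (Finset.mem_coe.2 (Finset.mem_insert_of_mem hx))
      rw [Finset.mem_coe, Finset.mem_insert] at this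
      rcases this with rfl | h
      · exact absurd (hmax x hx) (not_lt.2 hyx)
      · exact h
    obtain ⟨u, hu, a', hU, hL, hI, hD⟩ := ih hS'
    have hmin : ∀ t, t ∉ S → m s * n t ≤ m t * n s := by
      intro t ht
      refine hslope s t (le_of_not_gt fun hts => ht ?_)
      have := hS hts.le (Finset.mem_coe.2 (Finset.mem_insert_self s S))
      rw [Finset.mem_coe, Finset.mem_insert] at this
      exact this.resolve_left hts.ne
    obtain ⟨u', h1, h2, h3, h4, -⟩ := exists_elim hmn hs hmin
      (dieudonneSpan_le_lattice hv hu) hL hI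
    refine ⟨u', dieudonneSpan_le_of_mem hu h1, _, ?_, ?_, hI.elim hs, ?_⟩
    · intro t ht
      rcases Finset.mem_insert.1 ht with rfl | ht
      · exact h2
      · exact dieudonneSpan_le_U (hU t ht) h1
    · intro t ht
      rw [Finset.sum_insert hs, add_comm]
      exact h3 t ht
    · intro q hq hqU
      exact h4 q (hD q hq fun t ht => hqU t (Finset.mem_insert_of_mem ht))
        (hqU s (Finset.mem_insert_self s S))

/-- The indices of the leading terms of the elements of `dieudonneSpan (K := K) p v`. -/
theorem leads_dieudonneSpan_iff (hmn : ∀ t, (m t).Coprime (n t))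
    (hslope : ∀ s t, s ≤ t → m s * n t ≤ m t * n s)
    {v : X} {a : ι → K} (hv : v ∈ B.lattice) (hl : ∀ t, B.Lead t 0 (a t) v)
    (ha : Indep p m n ∅ a) (s : ι) (k : ℕ) :
    B.Leads (dieudonneSpan (K := K) p v) (s, k) ↔
      ∃ i j, k = i * m s + j * n s + (∑ t with t < s, m t) * n s := by
  obtain ⟨u, hu, a', hU, hL, hI, hD⟩ := exists_stage hmn hslope hv hl ha
    (Finset.univ.filter (· < s)) (fun x y hyx hx => by
      simp only [Finset.coe_filter, Finset.mem_univ, true_and, Set.mem_ofPred_eq] at hx ⊢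
      exact hyx.trans_lt hx)
  have hs : s ∉ Finset.univ.filter (· < s) := by simp
  have hmem : ∀ {t}, t ∈ Finset.univ.filter (· < s) ↔ t < s := by simp
  constructor
  · rintro ⟨q, hq, hqZ, c, hc, hk⟩
    obtain ⟨u', -, -, -, -, h5⟩ := exists_elim hmn hs
      (fun t ht => hslope s t (not_lt.1 fun h => ht (hmem.2 h)))
      (dieudonneSpan_le_lattice hv hu) hL hI
    exact h5 q (hD q hq fun t ht => mem_Z.1 hqZ t (hmem.1 ht)) k c hc hk
  · rintro ⟨i, j, rfl⟩
    -- The element u starts in component s, so its monomials realise all the required indices.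
    refine ⟨mono p K X i j u, ?_, mem_Z.2 fun t ht => B.mono_mem_U i j (hU t (hmem.2 ht)),
      tw p K (i - j) (a' s), ?_, ?_⟩
    · apply dieudonneSpan_le_of_mem hu
      rw [dieudonneSpan_eq 0 0]
      exact mono_mem_monoSpan (Nat.zero_le _) u
    · simpa using hI.ne_zero hs
    · rw [add_comm]; exact (hL s hs).mono i j

end Frame

/-! ### Colength from the missing leading indices. -/

section Length

variable {R A : Type*} [CommRing R] [AddCommGroup A] [Module R A]

theorem length_quotient_eq_add {S T U : Submodule R A} (hST : S ≤ T) (hTU : T ≤ U) :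
    Module.length R (U ⧸ S.submoduleOf U) =
      Module.length R (T ⧸ S.submoduleOf T) + Module.length R (U ⧸ T.submoduleOf U) := by
  let f : (T ⧸ S.submoduleOf T) →ₗ[R] (U ⧸ S.submoduleOf U) :=
    Submodule.mapQ _ _ (Submodule.inclusion hTU) fun _ hx => hx
  let g : (U ⧸ S.submoduleOf U) →ₗ[R] (U ⧸ T.submoduleOf U) :=
    Submodule.mapQ _ _ LinearMap.id fun _ hx => hST hx
  refine Module.length_eq_add_of_exact f g ?_ ?_ ?_
  · rw [← LinearMap.ker_eq_bot, LinearMap.ker_eq_bot']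
    intro x hx
    obtain ⟨x, rfl⟩ := Submodule.Quotient.mk_surjective _ x
    exact (Submodule.Quotient.mk_eq_zero _).2 ((Submodule.Quotient.mk_eq_zero (S.submoduleOf U)).1 hx)
  · intro x
    obtain ⟨x, rfl⟩ := Submodule.Quotient.mk_surjective _ x
    exact ⟨Submodule.Quotient.mk x, rfl⟩
  · intro x
    obtain ⟨x, rfl⟩ := Submodule.Quotient.mk_surjective _ x
    constructor
    · intro hx
      exact ⟨Submodule.Quotient.mk ⟨x, (Submodule.Quotient.mk_eq_zero (T.submoduleOf U)).1 hx⟩, rfl⟩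
    · rintro ⟨y, hy⟩
      obtain ⟨y, rfl⟩ := Submodule.Quotient.mk_surjective _ y
      rw [← hy]
      exact (Submodule.Quotient.mk_eq_zero _).2 y.2

end Length

namespace Frame

variable {p : ℕ} [Fact p.Prime] {K : Type*} [Field K] [CharP K p] [PerfectRing K p]
variable {X : Type*} [AddCommGroup X] [WittVector.Isocrystal p K X]
variable [Module (WittVector p K) X] [IsScalarTower (WittVector p K) K(p, K) X]
variable {ι : Type*} {m n : ι → ℕ} {B : Frame p K X m n} [Fintype ι] [LinearOrder ι]
variable {M : Submodule (WittVector p K) X}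

omit [Fintype ι] in
theorem Z_anti {s t : ι} (h : s ≤ t) : B.Z t ≤ B.Z s := fun _ hx =>
  mem_Z.2 fun t' ht' => mem_Z.1 hx t' (ht'.trans_le h)

omit [Fintype ι] in
theorem e_mem_Z {s t : ι} (h : s ≤ t) (l : ℕ) : B.e t l ∈ B.Z s :=
  mem_Z.2 fun _ ht' => B.e_mem_U (ht'.trans_le h).ne' l

/-- If all indices from `(s, l)` on are leading indices of elements of `M`, then `M` contains
all elements of the lattice with leading index at least `(s, l)`. -/
theorem mem_of_forall_leads (hM : M ≤ B.lattice) (s : ι) :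
    ∀ l, (∀ t k, s < t ∨ s = t ∧ l ≤ k → B.Leads M (t, k)) →
      ∀ x ∈ B.lattice, x ∈ B.Z s → x ∈ B.G s l → x ∈ M := by
  induction s using (Finite.to_wellFoundedGT (α := ι)).wf.induction with
  | _ s ih =>
  intro l hlead x hx hxZ hxG
  have step : ∀ k, ∃ z ∈ M, z ∈ B.Z s ∧ x - z ∈ B.G s (l + k) := by
    intro k
    induction k with
    | zero => exact ⟨0, zero_mem _, zero_mem _, by simpa using hxG⟩
    | succ k ihk =>
      obtain ⟨z, hz, hzZ, hxz⟩ := ihk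
      obtain ⟨c, hc⟩ := exists_lead hxz
      obtain ⟨y, hy, hyZ, a, ha, hya⟩ := hlead s (l + k) (Or.inr ⟨rfl, Nat.le_add_right _ _⟩)
      have h2 := hc.sub (hya.smul (c / a))
      rw [div_mul_cancel₀ _ ha, sub_self, lead_zero_iff, sub_sub] at h2
      exact ⟨_, add_mem hz (Submodule.smul_mem _ _ hy),
        add_mem hzZ (Submodule.smul_mem _ _ hyZ), h2⟩
  refine B.mem_of_forall_p_pow hM fun N => ?_
  obtain ⟨z, hz, hzZ, hxz⟩ := step (N * (m s + n s))
  obtain ⟨y, hy, hyU, hyU'⟩ := B.exists_split N (B.G_anti s (Nat.le_add_left _ _) hxz)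
  -- u has no component up to s: before s because x, z and y have none, at s by the splitting. The
  -- induction hypothesis for later slots therefore applies to it.
  set u := x - z - (p : WittVector p K) ^ N • y with hu
  have huM : u ∈ M := by
    by_cases h0 : u = 0
    · rw [h0]; exact zero_mem _
    have hul : u ∈ B.lattice := sub_mem (sub_mem hx (hM hz)) (Submodule.smul_mem _ _ hy)
    obtain ⟨t, k, hut, a, ha, hlt⟩ := exists_leading hul h0
    have hst : s < t := by
      by_contra hts
      apply ha
      refine hlt.unique (lead_zero_iff.2 (B.U_le_G _ _ ?_))
      rcases (not_lt.1 hts).eq_or_lt with rfl | h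
      · exact hyU
      · exact sub_mem (sub_mem (mem_Z.1 hxZ t h) (mem_Z.1 hzZ t h))
          (Submodule.smul_mem _ _ (hyU' t h.ne))
    refine ih t hst 0 (fun t' k' h => hlead t' k' (Or.inl ?_)) u hul hut (B.lattice_le_G t hul)
    rcases h with h | ⟨rfl, -⟩
    · exact hst.trans h
    · exact hst
  exact ⟨z + u, add_mem hz huM, y, hy, by rw [hu]; abel⟩

section Extend

variable {s : ι} {l : ℕ}

/-- Multiplication by p moves `e s l` to index l + h_s, beyond (s, l), where M contains everything.
-/
theorem p_smul_e_mem (hM : M ≤ B.lattice)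
    (hlead : ∀ t k, s < t ∨ s = t ∧ l + 1 ≤ k → B.Leads M (t, k)) :
    (p : WittVector p K) • B.e s l ∈ M := by
  rw [B.p_smul_e]
  refine mem_of_forall_leads hM s (l + 1) hlead _ (B.e_mem_lattice _ _) (e_mem_Z le_rfl _)
    (B.e_mem_G ?_)
  have := B.h_pos s
  omega

theorem covBy_sup_span (hp : (p : WittVector p K) • B.e s l ∈ M) (he : B.e s l ∉ M) :
    M ⋖ M ⊔ Submodule.span (WittVector p K) {B.e s l} := by
  refine ⟨lt_of_le_of_ne le_sup_left fun h => he ?_, fun C hC hC' => hC'.not_ge ?_⟩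
  · rw [h]; exact Submodule.mem_sup_right (Submodule.mem_span_singleton_self _)
  obtain ⟨x, hxC, hxM⟩ := SetLike.exists_of_lt hC
  obtain ⟨y, hy, _, hz, rfl⟩ := Submodule.mem_sup.1 (hC'.le hxC)
  obtain ⟨c, rfl⟩ := Submodule.mem_span_singleton.1 hz
  have hc : IsUnit c := by
    refine WittVector.isUnit_of_coeff_zero_ne_zero c fun h0 => hxM ?_
    obtain ⟨c', rfl⟩ := (p_dvd_iff_coeff_zero c).2 h0
    rw [mul_comm, mul_smul]
    exact add_mem hy (Submodule.smul_mem _ _ hp)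
  refine sup_le hC.le (Submodule.span_le.2 (Set.singleton_subset_iff.2 ?_))
  have h1 : c • B.e s l ∈ C := by
    have := sub_mem hxC (hC.le hy)
    rwa [add_sub_cancel_left] at this
  obtain ⟨d, hd⟩ := hc.exists_left_inv
  have h2 := C.smul_mem d h1
  rwa [smul_smul, hd, one_smul] at h2

/-- Let x = y + c e with c a unit. If x leads before (s, l), then y has the same leading term. If x
led after (s, l), then y would lead at (s, l), against `hn`. -/
theorem leads_sup_span_iff (hp : (p : WittVector p K) • B.e s l ∈ M) (hn : ¬ B.Leads M (s, l))
    (u : ι × ℕ) : B.Leads (M ⊔ Submodule.span (WittVector p K) {B.e s l}) u ↔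
      B.Leads M u ∨ u = (s, l) := by
  obtain ⟨t, k⟩ := u
  constructor
  · rintro ⟨_, hx, hxZ, a, ha, hla⟩
    obtain ⟨y, hy, _, hz, rfl⟩ := Submodule.mem_sup.1 hx
    obtain ⟨c, rfl⟩ := Submodule.mem_span_singleton.1 hz
    by_cases h0 : c.coeff 0 = 0
    · obtain ⟨c', rfl⟩ := (p_dvd_iff_coeff_zero c).2 h0
      rw [mul_comm, mul_smul] at hxZ hla
      exact Or.inl ⟨_, add_mem hy (Submodule.smul_mem _ _ hp), hxZ, a, ha, hla⟩
    by_cases hu : (t, k) = (s, l)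
    · exact Or.inr hu
    left
    by_cases hlt : t < s ∨ t = s ∧ k < l
    · refine ⟨y, hy, ?_, a, ha, ?_⟩
      · have hts : t ≤ s := by rcases hlt with h | h; exacts [h.le, h.1.le]
        have := sub_mem hxZ (Submodule.smul_mem _ c (e_mem_Z (B := B) hts l))
        rwa [add_sub_cancel_right] at this
      · have he : B.e s l ∈ B.G t (k + 1) := by
          rcases hlt with h | ⟨rfl, h⟩
          · exact B.e_mem_G_of_ne h.ne' _ _
          · exact B.e_mem_G h
        have := hla.sub_mem (Submodule.smul_mem _ c he)
        rwa [add_sub_cancel_right] at this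
    · exfalso
      have hts : s < t ∨ s = t ∧ l < k := by
        rw [not_or, not_and, not_lt, not_lt] at hlt
        rcases hlt.1.eq_or_lt with rfl | h
        · refine Or.inr ⟨rfl, lt_of_le_of_ne (hlt.2 rfl) fun h => hu (by rw [h])⟩
        · exact Or.inl h
      refine hn ⟨y, hy, ?_, -c.coeff 0, neg_ne_zero.2 h0, ?_⟩
      · have hst : s ≤ t := by rcases hts with h | h; exacts [h.le, h.1.le]
        have := sub_mem (Z_anti hst hxZ) (Submodule.smul_mem _ c (e_mem_Z (B := B) le_rfl l))
        rwa [add_sub_cancel_right] at this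
      · have hxG : y + c • B.e s l ∈ B.G s (l + 1) := by
          rcases hts with h | ⟨rfl, h⟩
          · exact B.U_le_G _ _ (mem_Z.1 hxZ s h)
          · exact B.G_anti s h hla.mem_G
        have h1 := (lead_zero_iff.2 hxG).sub ((lead_e (B := B) s l).witt_smul c)
        rwa [add_sub_cancel_right, mul_one, zero_sub] at h1
  · rintro (⟨x, hx, h⟩ | h)
    · exact ⟨x, Submodule.mem_sup_left hx, h⟩
    · rw [Prod.mk.injEq] at h
      obtain ⟨rfl, rfl⟩ := h
      exact ⟨_, Submodule.mem_sup_right (Submodule.mem_span_singleton_self _), e_mem_Z le_rfl _,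
        1, one_ne_zero, lead_e _ _⟩

/-- The summand c e is [c₀] e plus a multiple of p e. The latter is absorbed by M, and c₀ is stored
at the index (s, l), which the old sum avoids. -/
theorem exists_rep_of_sup_span {J : Finset (ι × ℕ)} (hp : (p : WittVector p K) • B.e s l ∈ M)
    (hu : (s, l) ∈ J) {x : X} (hx : x ∈ M) (c : WittVector p K) {b : ι → ℕ → K}
    (hb : ∀ u ∉ J.erase (s, l), b u.1 u.2 = 0) :
    ∃ z ∈ M, ∃ b' : ι → ℕ → K, (∀ u ∉ J, b' u.1 u.2 = 0) ∧
      x + c • B.e s l + ∑ u ∈ J.erase (s, l), WittVector.teichmuller p (b u.1 u.2) • B.e u.1 u.2 =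
        z + ∑ u ∈ J, WittVector.teichmuller p (b' u.1 u.2) • B.e u.1 u.2 := by
  obtain ⟨d, hd⟩ := exists_eq_teichmuller_add c
  have hbu : ∀ u : ι × ℕ, u ≠ (s, l) →
      Function.update b s (Function.update (b s) l (c.coeff 0)) u.1 u.2 = b u.1 u.2 := by
    rintro ⟨t, k⟩ hne
    by_cases hts : t = s
    · subst hts
      have hkl : k ≠ l := fun h => hne (by rw [h])
      simp [hkl]
    · simp [hts]
  refine ⟨x + d • (p : WittVector p K) • B.e s l, add_mem hx (Submodule.smul_mem _ _ hp),
    Function.update b s (Function.update (b s) l (c.coeff 0)), fun u huJ => ?_, ?_⟩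
  · rw [hbu u fun h => huJ (h ▸ hu)]
    exact hb u fun h => huJ (Finset.mem_of_mem_erase h)
  · have h1 : ∑ u ∈ J.erase (s, l), WittVector.teichmuller p
        (Function.update b s (Function.update (b s) l (c.coeff 0)) u.1 u.2) • B.e u.1 u.2 =
        ∑ u ∈ J.erase (s, l), WittVector.teichmuller p (b u.1 u.2) • B.e u.1 u.2 :=
      Finset.sum_congr rfl fun u hu => by rw [hbu u (Finset.ne_of_mem_erase hu)]
    have h2 : c • B.e s l = WittVector.teichmuller p (c.coeff 0) • B.e s l +
        d • (p : WittVector p K) • B.e s l := by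
      rw [smul_smul, ← add_smul, mul_comm d, ← hd]
    have h3 : Function.update b s (Function.update (b s) l (c.coeff 0)) s l = c.coeff 0 := by simp
    rw [← Finset.add_sum_erase J _ hu, h1, h2, h3]
    have h4 : ∀ a b c d : X, a + (b + c) + d = a + c + (b + d) := fun _ _ _ _ => by abel
    exact h4 _ _ _ _

end Extend

/-- A submodule of the lattice for which almost all indices are leading indices has finite
colength, and the remaining indices give representatives for the quotient. -/
theorem finite_colength (J : Finset (ι × ℕ)) : ∀ M : Submodule (WittVector p K) X, M ≤ B.lattice →
    (∀ u, B.Leads M u ↔ u ∉ J) →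
    (∃ N : ℕ, ∀ y ∈ B.lattice, (p : WittVector p K) ^ N • y ∈ M) ∧
    (∀ y ∈ B.lattice, ∃ z ∈ M, ∃ b : ι → ℕ → K, (∀ u ∉ J, b u.1 u.2 = 0) ∧
      y = z + ∑ u ∈ J, WittVector.teichmuller p (b u.1 u.2) • B.e u.1 u.2) ∧
    Module.length (WittVector p K) (B.lattice ⧸ M.submoduleOf B.lattice) = J.card := by
  induction hc : J.card generalizing J with
  | zero =>
    intro M hM hJ
    rw [Finset.card_eq_zero] at hc
    subst hc
    have hle : B.lattice ≤ M := by
      intro x hx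
      by_cases h0 : x = 0
      · rw [h0]; exact zero_mem _
      obtain ⟨s, l, hZ, a, ha, hl⟩ := exists_leading hx h0
      exact mem_of_forall_leads hM s l (fun t k _ => (hJ _).2 (Finset.notMem_empty _)) x hx hZ hl.mem_G
    obtain rfl : M = B.lattice := le_antisymm hM hle
    refine ⟨⟨0, fun y hy => by simpa using hy⟩,
      fun y hy => ⟨y, hy, 0, fun _ _ => rfl, by simp⟩, ?_⟩
    have : Subsingleton (B.lattice ⧸ B.lattice.submoduleOf B.lattice) := by
      rw [Submodule.Quotient.subsingleton_iff, Submodule.submoduleOf_self]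
    simp
  | succ c ih =>
    intro M hM hJ
    -- Everything beyond the lexicographically largest missing index is a leading index, as
    -- `p_smul_e_mem` requires. Adjoining the vector at this index fills one gap at the cost of
    -- length 1.
    obtain ⟨⟨s, l⟩, hu, hmax⟩ := Finset.exists_max_image J (fun u => toLex u)
      (Finset.card_pos.1 (by omega))
    have hn : ¬ B.Leads M (s, l) := fun h => (hJ _).1 h hu
    have hp : (p : WittVector p K) • B.e s l ∈ M := by
      refine p_smul_e_mem hM fun t k htk => (hJ _).2 fun h => ?_
      have := hmax _ h
      rw [Prod.Lex.toLex_le_toLex] at this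
      rcases htk with h1 | ⟨rfl, h1⟩ <;> rcases this with h2 | ⟨h2, h3⟩
      · exact lt_asymm h1 h2
      · exact h1.ne' h2
      · exact lt_irrefl _ h2
      · simp only at h3; omega
    have he : B.e s l ∉ M := fun h =>
      hn ⟨_, h, e_mem_Z le_rfl _, 1, one_ne_zero, lead_e _ _⟩
    set M' := M ⊔ Submodule.span (WittVector p K) {B.e s l} with hM'
    have hM'l : M' ≤ B.lattice :=
      sup_le hM (Submodule.span_le.2 (Set.singleton_subset_iff.2 (B.e_mem_lattice _ _)))
    have hMM' : M ≤ M' := le_sup_left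
    obtain ⟨⟨N, hN⟩, hrep, hlen⟩ := ih (J.erase (s, l)) (by rw [Finset.card_erase_of_mem hu, hc]; rfl)
      M' hM'l (fun u => by
        rw [leads_sup_span_iff hp hn, hJ, Finset.mem_erase]
        tauto)
    refine ⟨⟨N + 1, fun y hy => ?_⟩, fun y hy => ?_, ?_⟩
    · obtain ⟨x, hx, _, hz, hxz⟩ := Submodule.mem_sup.1 (hN y hy)
      obtain ⟨c, rfl⟩ := Submodule.mem_span_singleton.1 hz
      rw [pow_succ', mul_smul, ← hxz, smul_add, smul_comm]
      exact add_mem (Submodule.smul_mem _ _ hx) (Submodule.smul_mem _ _ hp)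
    · obtain ⟨z, hz, b, hb, hyz⟩ := hrep y hy
      obtain ⟨x, hx, _, hz', hxz⟩ := Submodule.mem_sup.1 hz
      obtain ⟨c, hc'⟩ := Submodule.mem_span_singleton.1 hz'
      rw [hyz, ← hxz, ← hc']
      exact exists_rep_of_sup_span hp hu hx c hb
    · rw [length_quotient_eq_add hMM' hM'l, hlen]
      have hs : IsSimpleModule (WittVector p K) (M' ⧸ M.submoduleOf M') :=
        (covBy_iff_quot_is_simple hMM').1 (covBy_sup_span hp he)
      rw [Module.length_eq_one, Nat.cast_succ, add_comm]

omit [Fintype ι] in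
theorem expands_sum {J : Finset (ι × ℕ)} {b : ι → ℕ → K} (hb : ∀ u ∉ J, b u.1 u.2 = 0) :
    B.Expands b (∑ u ∈ J, WittVector.teichmuller p (b u.1 u.2) • B.e u.1 u.2) := by
  intro t L
  have h1 : ∑ u ∈ J, WittVector.teichmuller p (b u.1 u.2) • B.e u.1 u.2 =
      ∑ u ∈ J ∪ ({t} ×ˢ Finset.range L), WittVector.teichmuller p (b u.1 u.2) • B.e u.1 u.2 := by
    refine Finset.sum_subset Finset.subset_union_left fun u _ hu => ?_
    rw [hb u hu, WittVector.teichmuller_zero, zero_smul]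
  have h2 : ∑ l ∈ Finset.range L, WittVector.teichmuller p (b t l) • B.e t l =
      ∑ u ∈ {t} ×ˢ Finset.range L, WittVector.teichmuller p (b u.1 u.2) • B.e u.1 u.2 := by
    rw [Finset.sum_product, Finset.sum_singleton]
  rw [h1, h2, ← Finset.sum_sdiff (Finset.subset_union_right (s₁ := J)), add_sub_cancel_right]
  refine Submodule.sum_mem _ fun u hu => Submodule.smul_mem _ _ ?_
  rw [Finset.mem_sdiff, Finset.mem_product, Finset.mem_singleton, Finset.mem_range] at hu
  by_cases h : u.1 = t
  · rw [h]; exact B.e_mem_G (not_lt.1 fun h' => hu.2 ⟨h, h'⟩)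
  · exact B.e_mem_G_of_ne h _ _

/-- The coefficient at a leading index. -/
theorem Expands.eq_of_lead {b : ι → ℕ → K} {x : X} (h : B.Expands b x) {t : ι} {l : ℕ} {a : K}
    (hl : B.Lead t l a x) : b t l = a :=
  (h.lead (h.eq_zero_of_mem_G hl.mem_G)).unique hl

/-- A submodule is determined by a smaller submodule and its leading indices. -/
theorem le_of_leads {J : Finset (ι × ℕ)} {M M' : Submodule (WittVector p K) X} (hMM' : M ≤ M')
    (hM' : M' ≤ B.lattice) (hJ : ∀ u, B.Leads M u ↔ u ∉ J) (hJ' : ∀ u, B.Leads M' u → u ∉ J) :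
    M' ≤ M := by
  intro x hx
  obtain ⟨z, hz, b, hb, rfl⟩ := (finite_colength J M (hMM'.trans hM') hJ).2.1 x (hM' hx)
  have hs := sub_mem hx (hMM' hz)
  rw [add_sub_cancel_left] at hs
  -- The representative of x is supported on J but lies in M', whose leading indices avoid J; so it
  -- is zero.
  have hE := expands_sum (B := B) hb
  by_cases h0 : ∑ u ∈ J, WittVector.teichmuller p (b u.1 u.2) • B.e u.1 u.2 = 0
  · rw [h0, add_zero]; exact hz
  obtain ⟨s, l, hZ, a, ha, hl⟩ := exists_leading (hM' hs) h0
  have h1 := hb (s, l) (hJ' _ ⟨_, hs, hZ, a, ha, hl⟩)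
  exact absurd ((hE.eq_of_lead hl).symm.trans h1) ha

end Frame

/-! ### Normalised generators. -/

namespace Frame

variable {p : ℕ} [Fact p.Prime] {K : Type*} [Field K] [CharP K p] [PerfectRing K p]
variable {X : Type*} [AddCommGroup X] [WittVector.Isocrystal p K X]
variable [Module (WittVector p K) X] [IsScalarTower (WittVector p K) K(p, K) X]
variable {ι : Type*} {m n : ι → ℕ} {B : Frame p K X m n}

theorem Expands.lead_zero {b : ι → ℕ → K} {x : X} (h : B.Expands b x) (t : ι) :
    B.Lead t 0 (b t 0) x := h.lead fun _ hl => absurd hl (Nat.not_lt_zero _)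

theorem Expands.eq_of_sub_mem_G {b b' : ι → ℕ → K} {x x' : X} (h : B.Expands b x)
    (h' : B.Expands b' x') {t : ι} {L : ℕ} (hx : x - x' ∈ B.G t L) : ∀ l < L, b t l = b' t l := by
  intro l
  induction l using Nat.strong_induction_on with
  | _ l ih =>
    intro hl
    have h1 := h.lead_sub h' (t := t) fun l' hl' => ih l' hl' (hl'.trans hl)
    exact sub_eq_zero.1 (h1.unique (lead_zero_iff.2 (B.G_anti t hl hx)))

/-- Up to a common factor, the coefficients of order `0` are the same for all elements of the
`𝒟(K)`-module generated by `v`. -/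
theorem exists_coeff_zero_eq {v w : X} {a b : ι → ℕ → K} (hv : B.Expands a v)
    (hw : B.Expands b w) (h : w ∈ dieudonneSpan (K := K) p v) : ∃ c : K, ∀ t, b t 0 = c * a t 0 := by
  rw [dieudonneSpan_eq 1 1] at h
  -- Every monomial other than v itself raises the order in every component, so modulo order 1 an
  -- element of the module is a multiple of v.
  have h1 : monoSpan p K 1 1 0 v ≤
      Submodule.span (WittVector p K) {v} ⊔ monoSpan p K 1 1 1 v := by
    refine Submodule.span_le.2 ?_
    rintro _ ⟨i, j, -, rfl⟩
    by_cases hij : i = 0 ∧ j = 0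
    · obtain ⟨rfl, rfl⟩ := hij
      exact Submodule.mem_sup_left (Submodule.mem_span_singleton_self _)
    · exact Submodule.mem_sup_right (mono_mem_monoSpan (by omega) v)
  obtain ⟨_, hz, y, hy, hzy⟩ := Submodule.mem_sup.1 (h1 h)
  obtain ⟨c, rfl⟩ := Submodule.mem_span_singleton.1 hz
  refine ⟨c.coeff 0, fun t => ?_⟩
  have h2 := ((hv.lead_zero t).witt_smul c).add_mem (y := y) (by
    refine monoSpan_le_G (hv.lead_zero t).mem_G (k := 1) (fun i j hij => ?_) hy
    have := B.m_pos t
    have := B.n_pos t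
    nlinarith)
  rw [hzy] at h2
  exact (hw.lead_zero t).unique h2

variable [Fintype ι] [LinearOrder ι]

/-- The leading indices depend only on the pairs (m, n), so they agree for v and w, and an inclusion
with equal leading indices is an equality. -/
theorem dieudonneSpan_eq_of_indep (hmn : ∀ t, (m t).Coprime (n t))
    (hslope : ∀ s t, s ≤ t → m s * n t ≤ m t * n s) {v w : X} {a b : ι → ℕ → K}
    (hv : B.Expands a v) (ha : Indep p m n ∅ fun t => a t 0) (hw : B.Expands b w)
    (hb : Indep p m n ∅ fun t => b t 0) (h : w ∈ dieudonneSpan (K := K) p v) {J : Finset (ι × ℕ)}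
    (hJ : ∀ u, B.Leads (dieudonneSpan p v) u ↔ u ∉ J) :
    dieudonneSpan (K := K) p w = dieudonneSpan p v := by
  have hiff : ∀ u, B.Leads (dieudonneSpan p w) u ↔ B.Leads (dieudonneSpan p v) u := fun ⟨s, k⟩ => by
    rw [leads_dieudonneSpan_iff hmn hslope hw.mem_lattice hw.lead_zero hb,
      leads_dieudonneSpan_iff hmn hslope hv.mem_lattice hv.lead_zero ha]
  exact le_antisymm (dieudonneSpan_le_of_mem h)
    (le_of_leads (dieudonneSpan_le_of_mem h) (dieudonneSpan_le_lattice hv.mem_lattice)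
      (fun u => (hiff u).trans (hJ u)) fun u => (hJ u).1)

/-- Scale v to have coefficient 1 at (f, 0), split off `e f 0`, and reduce the rest modulo the
module to a sum over J. Independence survives since the order-zero coefficients only change by a
common factor, nonzero because the entry at f is 1. -/
theorem exists_normalised {f : ι} {v : X} {a : ι → ℕ → K}
    (hv : B.Expands a v) (ha : Indep p m n ∅ fun t => a t 0) {J : Finset (ι × ℕ)}
    (hJ : ∀ u, B.Leads (dieudonneSpan p v) u ↔ u ∉ J) (hf : (f, 0) ∉ J) :
    ∃ w ∈ dieudonneSpan (K := K) p v, ∃ b, B.Expands b w ∧ (Indep p m n ∅ fun t => b t 0) ∧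
      b f 0 = 1 ∧ ∀ u, u ≠ (f, 0) → u ∉ J → b u.1 u.2 = 0 := by
  have hvM : v ∈ dieudonneSpan (K := K) p v := by
    rw [dieudonneSpan_eq 1 1]; exact self_mem_monoSpan _ _ _
  have haf : a f 0 ≠ 0 := ha.ne_zero (Finset.notMem_empty f)
  have hvl := hv.mem_lattice
  set v' := WittVector.teichmuller p (a f 0)⁻¹ • v with hv'
  have hl : B.Lead f 0 1 v' := by
    have := (hv.lead_zero f).smul (a f 0)⁻¹
    rwa [inv_mul_cancel₀ haf] at this
  obtain ⟨z, hz, b, hb, hyz⟩ := (finite_colength J _ (dieudonneSpan_le_lattice hvl) hJ).2.1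
    (v' - B.e f 0) (sub_mem (Submodule.smul_mem _ _ hvl) (B.e_mem_lattice _ _))
  have hw : v' - z = B.e f 0 + ∑ u ∈ J, WittVector.teichmuller p (b u.1 u.2) • B.e u.1 u.2 := by
    have h1 : v' = v' - B.e f 0 + B.e f 0 := by abel
    rw [h1, hyz]; abel
  have hwM : v' - z ∈ dieudonneSpan (K := K) p v := sub_mem (Submodule.smul_mem _ _ hvM) hz
  set b' : ι → ℕ → K := Function.update b f (Function.update (b f) 0 1) with hb'
  have hb'f : b' f 0 = 1 := by simp [hb']
  have hb'u : ∀ u : ι × ℕ, u ≠ (f, 0) → b' u.1 u.2 = b u.1 u.2 := by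
    rintro ⟨t, k⟩ hne
    by_cases hts : t = f
    · subst hts
      have hkl : k ≠ 0 := fun h => hne (by rw [h])
      simp [hb', hkl]
    · simp [hb', hts]
  have hE : B.Expands b' (v' - z) := by
    have h1 := expands_sum (B := B) (J := insert (f, 0) J) (b := b') fun u hu => by
      rw [Finset.mem_insert, not_or] at hu
      rw [hb'u u hu.1]
      exact hb u hu.2
    rw [Finset.sum_insert hf, hb'f, map_one, one_smul] at h1
    rw [hw]
    convert h1 using 2
    refine Finset.sum_congr rfl fun u hu => ?_
    rw [hb'u u fun h => hf (h ▸ hu)]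
  refine ⟨v' - z, hwM, b', hE, ?_, hb'f, fun u hu huJ => (hb'u u hu).trans (hb u huJ)⟩
  obtain ⟨c, hc⟩ := exists_coeff_zero_eq hv hE hwM
  have hc0 : c ≠ 0 := by
    rintro rfl
    have := hc f
    rw [hb'f, zero_mul] at this
    exact one_ne_zero this
  simp only [hc]
  exact ha.smul hc0

/-- The leading index of w - w' is outside J, where both expansions have the same prescribed
coefficients. -/
theorem eq_of_normalised {f : ι} {M : Submodule (WittVector p K) X}
    {J : Finset (ι × ℕ)} (hJ : ∀ u, B.Leads M u → u ∉ J) {w w' : X} {b b' : ι → ℕ → K}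
    (hw : w ∈ M) (hw' : w' ∈ M) (hb : B.Expands b w) (hb' : B.Expands b' w')
    (hf : b f 0 = 1) (hf' : b' f 0 = 1) (h0 : ∀ u, u ≠ (f, 0) → u ∉ J → b u.1 u.2 = 0)
    (h0' : ∀ u, u ≠ (f, 0) → u ∉ J → b' u.1 u.2 = 0) : w = w' := by
  by_contra hne
  obtain ⟨s, l, hZ, a, ha, hl⟩ := exists_leading
    (sub_mem hb.mem_lattice hb'.mem_lattice) (sub_ne_zero.2 hne)
  have hs := hJ (s, l) ⟨_, sub_mem hw hw', hZ, a, ha, hl⟩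
  have h1 := (hb.lead_sub hb' (hb.eq_of_sub_mem_G hb' hl.mem_G)).unique hl
  apply ha
  rw [← h1, sub_eq_zero]
  by_cases hsf : (s, l) = (f, 0)
  · rw [Prod.mk.injEq] at hsf
    rw [hsf.1, hsf.2, hf, hf']
  · rw [h0 _ hsf hs, h0' _ hsf hs]

end Frame

/-! ### Gaps of numerical semigroups and the size of I. -/

section Gaps

/-- Exactly one of `x` and `m * n - m - n - x` is of the form `a * m + b * n`. -/
theorem exists_iff_not_exists_sub {m n : ℕ} (hmn : m.Coprime n) (hn : 0 < n) (x : ℤ) :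
    (∃ a b : ℕ, x = a * m + b * n) ↔ ¬ ∃ a b : ℕ, (m * n - m - n : ℤ) - x = a * m + b * n := by
  constructor
  · rintro ⟨a, b, rfl⟩ ⟨a', b', h⟩
    -- Two such representations would add up to (a + a' + 1) m + (b + b' + 1) n = m n, impossible
    -- for coprime m, n.
    apply hmn.mul_add_mul_ne_mul (Nat.succ_ne_zero (a + a')) (Nat.succ_ne_zero (b + b'))
    zify
    linear_combination -h
  · intro h
    by_contra h'
    apply h
    obtain ⟨u, v, hx⟩ : ∃ u v : ℤ, x = u * m + v * n := by
      have := Nat.gcd_eq_gcd_ab m n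
      rw [hmn.gcd_eq_one, Nat.cast_one] at this
      exact ⟨x * m.gcdA n, x * m.gcdB n, by linear_combination x * this⟩
    have hn' : (0 : ℤ) < n := by exact_mod_cast hn
    -- Normalise the coefficient of m to 0 ≤ u' < n. As x is not represented, v' ≤ -1, and n - 1 -
    -- u', -1 - v' represent the reflected number.
    have h1 := Int.emod_add_mul_ediv u n
    have h2 := Int.emod_nonneg u hn'.ne'
    have h3 := Int.emod_lt_of_pos u hn'
    set u' := u % n with hu'
    set v' := v + m * (u / n) with hv'
    have hx' : x = u' * m + v' * n := by rw [hx, hv']; linear_combination (-(m : ℤ)) * h1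
    have hv0 : v' < 0 := by
      by_contra hv0
      exact h' ⟨u'.toNat, v'.toNat, by rw [Int.toNat_of_nonneg h2, Int.toNat_of_nonneg (by omega), hx']⟩
    refine ⟨(n - 1 - u').toNat, (-1 - v').toNat, ?_⟩
    rw [Int.toNat_of_nonneg (by omega), Int.toNat_of_nonneg (by omega), hx']
    ring

/-- Sylvester's count of the non-members of the semigroup generated by `m` and `n`. -/
theorem card_gaps {m n : ℕ} (hmn : m.Coprime n) (hm : 0 < m) (hn : 0 < n) (C : ℕ) :
    ∃ J : Finset ℕ, (∀ l, l ∉ J ↔ ∃ a b, l = a * m + b * n + C) ∧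
      2 * J.card = 2 * C + (m - 1) * (n - 1) := by
  classical
  set k := (m - 1) * (n - 1) with hk
  let G := (Finset.range k).filter fun l => ¬ ∃ a b, l = a * m + b * n
  let G' := (Finset.range k).filter fun l => ∃ a b, l = a * m + b * n
  have hbig : ∀ l, k ≤ l → ∃ a b, l = a * m + b * n := fun l hl => by
    obtain ⟨a, b, h⟩ := Nat.exists_add_mul_eq_of_gcd_dvd_of_mul_pred_le m n l
      (by simp [hmn.gcd_eq_one]) hl
    exact ⟨a, b, h.symm⟩
  have hkz : (k : ℤ) - 1 = m * n - m - n := by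
    rw [hk, Nat.cast_mul, Nat.cast_sub hm, Nat.cast_sub hn]; push_cast; ring
  have hsym : ∀ l < k, (∃ a b, l = a * m + b * n) ↔ ¬ ∃ a b, k - 1 - l = a * m + b * n := by
    intro l hl
    have h := exists_iff_not_exists_sub hmn hn (l : ℤ)
    have h1 : (m * n - m - n : ℤ) - l = ((k - 1 - l : ℕ) : ℤ) := by rw [← hkz]; omega
    rw [h1] at h
    exact_mod_cast h
  -- The reflection l ↦ k - 1 - l of [0, k) exchanges gaps and non-gaps, so the gaps are half of k.
  have hcard : G'.card = G.card := by
    refine Finset.card_bij' (fun l _ => k - 1 - l) (fun l _ => k - 1 - l) ?_ ?_ ?_ ?_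
    · intro l hl
      rw [Finset.mem_filter, Finset.mem_range] at hl ⊢
      exact ⟨by omega, (hsym l hl.1).1 hl.2⟩
    · intro l hl
      rw [Finset.mem_filter, Finset.mem_range] at hl ⊢
      refine ⟨by omega, ?_⟩
      by_contra h
      exact hl.2 ((hsym l hl.1).2 h)
    · intro l hl
      rw [Finset.mem_filter, Finset.mem_range] at hl
      omega
    · intro l hl
      rw [Finset.mem_filter, Finset.mem_range] at hl
      omega
  have htot : G'.card + G.card = k := by
    have := Finset.card_filter_add_card_filter_not (s := Finset.range k)
      (fun l => ∃ a b, l = a * m + b * n)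
    rwa [Finset.card_range] at this
  refine ⟨Finset.range C ∪ G.map (addRightEmbedding C), fun l => ?_, ?_⟩
  · rw [Finset.mem_union, not_or, Finset.mem_range, not_lt, Finset.mem_map]
    constructor
    · rintro ⟨h1, h2⟩
      obtain ⟨l, rfl⟩ := Nat.exists_eq_add_of_le' h1
      by_contra h
      refine h2 ⟨l, ?_, rfl⟩
      have hl : ¬ ∃ a b, l = a * m + b * n := by
        rintro ⟨a, b, rfl⟩; exact h ⟨a, b, rfl⟩
      rw [Finset.mem_filter, Finset.mem_range]
      exact ⟨by by_contra hc; exact hl (hbig l (not_lt.1 hc)), hl⟩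
    · rintro ⟨a, b, rfl⟩
      refine ⟨by omega, ?_⟩
      rintro ⟨l, hl, hlc⟩
      rw [Finset.mem_filter] at hl
      exact hl.2 ⟨a, b, by simpa using hlc⟩
  · rw [Finset.card_union_of_disjoint, Finset.card_map, Finset.card_range]
    · omega
    · rw [Finset.disjoint_left]
      intro l hl hl'
      rw [Finset.mem_map] at hl'
      obtain ⟨l', -, rfl⟩ := hl'
      rw [Finset.mem_range] at hl
      simp at hl

end Gaps

namespace SlopeData

variable (D : SlopeData)

open Classical in
theorem mem_I_iff (s : D.Slot) (l : ℕ) : (s, l) ∉ D.I ↔ ∃ a b : ℕ, l = a * D.m s.1 + b * D.n s.1 +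
    ∑ t : D.Slot with D.SlotLt t s, D.m t.1 * D.n s.1 := by
  rw [I, Set.mem_compl_iff, not_not]
  exact Iff.rfl

-- Slot s contributes the (m-1)(n-1)/2 gaps of its semigroup and one further gap for each unit of
-- its shift ∑ m_t n_s.
open Classical in
theorem exists_finset_I : ∃ J : Finset D.Index, (∀ u, u ∈ J ↔ u ∈ D.I) ∧ (J.card : ℚ) = D.c := by
  have h := fun s : D.Slot => card_gaps (D.coprime s.1) (D.m_pos s.1) (D.n_pos s.1)
    (∑ t : D.Slot with D.SlotLt t s, D.m t.1 * D.n s.1)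
  choose J hJ hcard using h
  refine ⟨(Finset.univ.sigma J).map (Equiv.sigmaEquivProd D.Slot ℕ).toEmbedding, ?_, ?_⟩
  · rintro ⟨s, l⟩
    rw [← not_iff_not, mem_I_iff, ← hJ s l, Finset.mem_map_equiv]
    simp
  · rw [Finset.card_map, Finset.card_sigma]
    have h1 : ∀ s : D.Slot, ((J s).card : ℚ) = ((D.m s.1 : ℚ) - 1) * ((D.n s.1 : ℚ) - 1) / 2 +
        ∑ t : D.Slot, if D.SlotLt t s then (D.m t.1 : ℚ) * D.n s.1 else 0 := by
      intro s
      have := congrArg (fun x : ℕ => (x : ℚ)) (hcard s)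
      rw [Finset.sum_filter] at this
      push_cast [Nat.cast_sub (D.m_pos s.1), Nat.cast_sub (D.n_pos s.1)] at this
      linarith
    push_cast
    rw [Finset.sum_congr rfl fun s _ => h1 s, Finset.sum_add_distrib, c]
    congr 1
    · rw [Fintype.sum_sigma]
      simp
    · rw [Finset.sum_filter, Fintype.sum_prod_type_right]

theorem finite_I : D.I.Finite := by
  obtain ⟨J, hJ, -⟩ := D.exists_finset_I
  exact J.finite_toSet.subset fun u hu => (hJ u).2 hu

theorem ncard_I : (D.I.ncard : ℚ) = D.c := by
  obtain ⟨J, hJ, hc⟩ := D.exists_finset_I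
  rw [← hc, show D.I = J from Set.ext fun u => (hJ u).symm, Set.ncard_coe_finset]

theorem not_slotLt_first (s : D.Slot) : ¬ D.SlotLt s D.first := by
  rintro (h | ⟨-, h⟩)
  · exact absurd h (by simp [first, Fin.lt_def])
  · simp [first] at h

theorem first_slotLt {s : D.Slot} (h : s ≠ D.first) : D.SlotLt D.first s := by
  obtain ⟨j, i⟩ := s
  by_cases hj : j = ⟨0, D.r_pos⟩
  · subst hj
    refine Or.inr ⟨rfl, Nat.pos_of_ne_zero fun h0 => h ?_⟩
    have : i = ⟨0, D.l_pos _⟩ := Fin.ext h0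
    rw [this, first]
  · refine Or.inl (Fin.lt_def.2 (Nat.pos_of_ne_zero fun h0 => hj (Fin.ext h0)))

theorem first_notMem_I : (D.first, 0) ∉ D.I := by
  classical
  rw [mem_I_iff]
  refine ⟨0, 0, ?_⟩
  rw [Finset.sum_eq_zero]
  · simp
  · intro t ht
    exact absurd (Finset.mem_filter.1 ht).2 (D.not_slotLt_first t)

theorem mem_I_of_ne_first {s : D.Slot} (h : s ≠ D.first) : (s, 0) ∈ D.I := by
  classical
  by_contra hs
  obtain ⟨a, b, hab⟩ := (D.mem_I_iff s 0).1 hs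
  have h1 : 0 < ∑ t : D.Slot with D.SlotLt t s, D.m t.1 * D.n s.1 :=
    Finset.sum_pos (fun t _ => Nat.mul_pos (D.m_pos _) (D.n_pos _))
      ⟨D.first, Finset.mem_filter.2 ⟨Finset.mem_univ _, D.first_slotLt h⟩⟩
  omega

end SlopeData

/-! ### Valuations, determinants and volumes. -/

section Valuation

variable {p : ℕ} [Fact p.Prime] {K : Type*} [Field K] [CharP K p] [PerfectRing K p]

theorem vp_mul {x y : K(p, K)} (hx : x ≠ 0) (hy : y ≠ 0) : vp p K (x * y) = vp p K x + vp p K y := by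
  have h := fun {x : K(p, K)} (hx : x ≠ 0) => (Valuation.ne_zero_iff
    ((IsDiscreteValuationRing.maximalIdeal (WittVector p K)).valuation K(p, K))).2 hx
  rw [vp, map_mul, WithZero.log_mul (h hx) (h hy), vp, vp]
  ring

theorem vp_one : vp p K 1 = 0 := by rw [vp, map_one, WithZero.log_one, neg_zero]

theorem vp_inv {x : K(p, K)} (hx : x ≠ 0) : vp p K x⁻¹ = -vp p K x := by
  have := vp_mul hx (inv_ne_zero hx)
  rw [mul_inv_cancel₀ hx, vp_one] at this
  omega

theorem vp_pow {x : K(p, K)} (hx : x ≠ 0) (N : ℕ) : vp p K (x ^ N) = N * vp p K x := by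
  induction N with
  | zero => simp [vp_one]
  | succ N ih => rw [pow_succ, vp_mul (pow_ne_zero _ hx) hx, ih]; push_cast; ring

theorem vp_prod {ι : Type*} (s : Finset ι) (f : ι → K(p, K)) (hf : ∀ i ∈ s, f i ≠ 0) :
    vp p K (∏ i ∈ s, f i) = ∑ i ∈ s, vp p K (f i) := by
  classical
  induction s using Finset.induction_on with
  | empty => simp [vp_one]
  | insert i s hi ih =>
    rw [Finset.prod_insert hi, Finset.sum_insert hi,
      vp_mul (hf i (Finset.mem_insert_self _ _))
        (Finset.prod_ne_zero_iff.2 fun j hj => hf j (Finset.mem_insert_of_mem hj)),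
      ih fun j hj => hf j (Finset.mem_insert_of_mem hj)]

theorem vp_p : vp p K (p : K(p, K)) = 1 := by
  have h : (IsDiscreteValuationRing.maximalIdeal (WittVector p K)).asIdeal =
      Ideal.span {(p : WittVector p K)} :=
    (WittVector.irreducible p).maximalIdeal_eq
  rw [vp, ← map_natCast (algebraMap (WittVector p K) K(p, K)),
    IsDedekindDomain.HeightOneSpectrum.valuation_of_algebraMap,
    IsDedekindDomain.HeightOneSpectrum.intValuation_singleton _ (WittVector.p_nonzero p K) h,
    WithZero.log_exp, neg_neg]

theorem vp_unit (u : (WittVector p K)ˣ) :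
    vp p K (algebraMap (WittVector p K) K(p, K) u) = 0 := by
  have : (IsDiscreteValuationRing.maximalIdeal (WittVector p K)).intValuation
      (u : WittVector p K) = 1 := by
    rw [IsDedekindDomain.HeightOneSpectrum.intValuation_eq_one_iff]
    exact fun h => (Ideal.IsPrime.ne_top
      (IsDiscreteValuationRing.maximalIdeal (WittVector p K)).isPrime)
      (Ideal.eq_top_of_isUnit_mem _ h u.isUnit)
  rw [vp, IsDedekindDomain.HeightOneSpectrum.valuation_of_algebraMap, this, WithZero.log_one,
    neg_zero]

theorem vp_p_pow_mul_unit (N : ℕ) (u : (WittVector p K)ˣ) :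
    vp p K (algebraMap (WittVector p K) K(p, K) ((p : WittVector p K) ^ N * u)) = N := by
  have hp := WittVector.FractionRing.p_nonzero p K
  have hu : algebraMap (WittVector p K) K(p, K) (u : WittVector p K) ≠ 0 :=
    (u.isUnit.map _).ne_zero
  rw [map_mul, map_pow, map_natCast, vp_mul (pow_ne_zero _ hp) hu, vp_pow hp, vp_p, vp_unit]
  ring

theorem vp_of_associated {x y : WittVector p K} (h : Associated x y) :
    vp p K (algebraMap (WittVector p K) K(p, K) x) =
      vp p K (algebraMap (WittVector p K) K(p, K) y) := by
  obtain ⟨u, rfl⟩ := h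
  by_cases hx : x = 0
  · simp [hx]
  have hx' : algebraMap (WittVector p K) K(p, K) x ≠ 0 := by
    rwa [Ne, FaithfulSMul.algebraMap_eq_zero_iff]
  rw [map_mul, vp_mul hx' (u.isUnit.map _).ne_zero, vp_unit, add_zero]

theorem length_quotient_span {x : WittVector p K} (hx : x ≠ 0) :
    ∃ N : ℕ, Module.length (WittVector p K) (WittVector p K ⧸ Ideal.span {x}) = N ∧
      vp p K (algebraMap (WittVector p K) K(p, K) x) = N := by
  obtain ⟨N, u, rfl⟩ := WittVector.exists_eq_pow_p_mul' x hx
  refine ⟨N, ?_, vp_p_pow_mul_unit N u⟩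
  rw [Ideal.span_singleton_mul_right_unit u.isUnit, ← Ideal.span_singleton_pow,
    ← (WittVector.irreducible p).maximalIdeal_eq,
    IsDiscreteValuationRing.length_quotient_pow_maximalIdeal]

open Submodule in
/-- The colength of a submodule of full rank is the valuation of the determinant. -/
theorem length_quotient_eq_vp_det {ι : Type*} [Fintype ι] {L : Type*} [AddCommGroup L]
    [Module (WittVector p K) L] (b : Module.Basis ι (WittVector p K) L)
    (T : Submodule (WittVector p K) L) (e : L ≃ₗ[WittVector p K] T) :
    ∃ N : ℕ, Module.length (WittVector p K) (L ⧸ T) = N ∧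
      vp p K (algebraMap (WittVector p K) K(p, K)
        (LinearMap.det (T.subtype ∘ₗ (e : L →ₗ[WittVector p K] T)))) = N := by
  classical
  have h : Module.finrank (WittVector p K) T = Module.finrank (WittVector p K) L := e.symm.finrank_eq
  let a := smithNormalFormCoeffs b h
  let b' := smithNormalFormTopBasis b h
  let ab := smithNormalFormBotBasis b h
  -- In Smith bases the inclusion of T is diagonal, and both sides become ∑ v_p(a_i). Replacing e by
  -- e' changes the determinant by a unit only.
  let e' : L ≃ₗ[WittVector p K] T := b'.equiv ab (Equiv.refl _)
  have hdet : LinearMap.det (T.subtype ∘ₗ (e' : L →ₗ[WittVector p K] T)) = ∏ i, a i := by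
    rw [← LinearMap.det_toMatrix b', ← Matrix.det_diagonal]
    congr 1
    ext i j
    have ha : (T.subtype ∘ₗ (e' : L →ₗ[WittVector p K] T)) (b' j) = a j • b' j := by
      have : (T.subtype ∘ₗ (e' : L →ₗ[WittVector p K] T)) (b' j) = ab j := by
        simp [e', Module.Basis.equiv_apply]
      rw [this]
      exact smithNormalFormBotBasis_def b h j
    rw [LinearMap.toMatrix_apply, ha, map_smul, Module.Basis.repr_self, Finsupp.smul_single,
      smul_eq_mul, mul_one]
    by_cases hij : i = j
    · rw [hij, Matrix.diagonal_apply_eq, Finsupp.single_eq_same]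
    · rw [Matrix.diagonal_apply_ne _ hij, Finsupp.single_eq_of_ne hij]
  have ha0 : ∀ i, a i ≠ 0 := smithNormalFormCoeffs_ne_zero b h
  choose N hN hN' using fun i => length_quotient_span (ha0 i)
  refine ⟨∑ i, N i, ?_, ?_⟩
  · rw [(quotientEquivPiSpan T b h).length_eq, Module.length_pi_of_fintype, Nat.cast_sum]
    exact Finset.sum_congr rfl fun i _ => hN i
  · rw [vp_of_associated (LinearMap.associated_det_comp_equiv T.subtype e e'), hdet, map_prod,
      vp_prod _ _ fun i _ => by rw [Ne, FaithfulSMul.algebraMap_eq_zero_iff]; exact ha0 i,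
      Nat.cast_sum]
    exact Finset.sum_congr rfl fun i _ => hN' i

end Valuation

section Volume

variable {p : ℕ} [Fact p.Prime] {K : Type*} [Field K] [CharP K p] [PerfectRing K p]
variable {X : Type*} [AddCommGroup X] [Module K(p, K) X]
variable [Module (WittVector p K) X] [IsScalarTower (WittVector p K) K(p, K) X]
variable {ι : Type*} [Fintype ι]

theorem length_quotient_map (b : Module.Basis ι K(p, K) X) (f : X ≃ₗ[K(p, K)] X)
    {L T : Submodule (WittVector p K) X} (hL : L = Submodule.span _ (Set.range b))
    (hT : T = L.map ((f : X →ₗ[K(p, K)] X).restrictScalars (WittVector p K))) (hTL : T ≤ L) :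
    ∃ N : ℕ, Module.length (WittVector p K) (L ⧸ T.submoduleOf L) = N ∧
      vp p K (LinearMap.det (f : X →ₗ[K(p, K)] X)) = N := by
  classical
  subst hL
  let bL := b.restrictScalars (WittVector p K)
  let L := Submodule.span (WittVector p K) (Set.range b)
  let e₁ : L ≃ₗ[WittVector p K] T :=
    ((f.restrictScalars (WittVector p K)).submoduleMap L).trans (LinearEquiv.ofEq _ _ hT.symm)
  let e : L ≃ₗ[WittVector p K] T.submoduleOf L :=
    e₁.trans (Submodule.submoduleOfEquivOfLe hTL).symm
  obtain ⟨N, h1, h2⟩ := length_quotient_eq_vp_det bL _ e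
  refine ⟨N, h1, ?_⟩
  rw [← h2]
  congr 1
  rw [← LinearMap.det_toMatrix b, ← LinearMap.det_toMatrix bL, RingHom.map_det]
  congr 1
  ext i j
  rw [RingHom.mapMatrix_apply, Matrix.map_apply, LinearMap.toMatrix_apply, LinearMap.toMatrix_apply,
    Module.Basis.restrictScalars_repr_apply]
  have : (((T.submoduleOf L).subtype ∘ₗ (e : L →ₗ[WittVector p K] T.submoduleOf L)) (bL j) : X) =
      f (b j) := by
    have : (bL j : X) = b j := Module.Basis.restrictScalars_apply _ b j
    rw [← this]
    rfl
  rw [this]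
  rfl

/-- Comparison of the volumes of `M` relative to two lattices. -/
theorem relVol_eq (b b' : Module.Basis ι K(p, K) X) (f : X ≃ₗ[K(p, K)] X) (hf : ∀ i, f (b i) = b' i)
    {L L' M : Submodule (WittVector p K) X} (hL : L = Submodule.span _ (Set.range b))
    (hL' : L' = Submodule.span _ (Set.range b')) (hM : M ≤ L') {c : ℕ}
    (hc : Module.length (WittVector p K) (L' ⧸ M.submoduleOf L') = c)
    (hN : ∃ N : ℕ, ∀ y ∈ L, (p : WittVector p K) ^ N • y ∈ M) :
    (Module.length (WittVector p K) (L ⧸ (L ⊓ M).submoduleOf L)).toNat -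
      ((Module.length (WittVector p K) (M ⧸ (L ⊓ M).submoduleOf M)).toNat : ℤ) =
      vp p K (LinearMap.det (f : X →ₗ[K(p, K)] X)) + c := by
  obtain ⟨N, hN⟩ := hN
  have hp : (p : K(p, K)) ^ N ≠ 0 := pow_ne_zero _ (WittVector.FractionRing.p_nonzero p K)
  let f₀ : X ≃ₗ[K(p, K)] X := LinearEquiv.smulOfNeZero K(p, K) X _ hp
  have hf₀ : ∀ x, f₀ x = (p : WittVector p K) ^ N • x := fun x => by
    rw [← algebraMap_smul K(p, K) ((p : WittVector p K) ^ N) x, map_pow, map_natCast]; rfl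
  have hgL : L' = L.map ((f : X →ₗ[K(p, K)] X).restrictScalars (WittVector p K)) := by
    rw [hL, hL', Submodule.map_span, ← Set.range_comp]
    congr 2
    exact funext fun i => (hf i).symm
  -- T = p^N L lies in L, in L' and in M. Its colength is v_p(det p^N) in L and, as T = p^N f⁻¹ L',
  -- v_p(det p^N) - v_p(det f) in L'. Additivity of length through L ⊓ M gives the claim.
  set T := L.map ((f₀ : X →ₗ[K(p, K)] X).restrictScalars (WittVector p K)) with hT
  have hTM : T ≤ M := by
    rintro _ ⟨y, hy, rfl⟩
    change f₀ y ∈ M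
    rw [hf₀]; exact hN y hy
  have hTL : T ≤ L := by
    rintro _ ⟨y, hy, rfl⟩
    change f₀ y ∈ L
    rw [hf₀]; exact Submodule.smul_mem _ _ hy
  obtain ⟨N₁, h1, h1'⟩ := length_quotient_map b f₀ hL hT hTL
  obtain ⟨N₂, h2, h2'⟩ := length_quotient_map (T := T) b' (f.symm.trans f₀) hL' (by
    rw [hgL, ← Submodule.map_comp, hT]
    congr 1
    ext x
    change f₀ x = f₀ (f.symm (f x))
    rw [f.symm_apply_apply]) (hTM.trans hM)
  have hdf : LinearMap.det (f : X →ₗ[K(p, K)] X) ≠ 0 := f.isUnit_det'.ne_zero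
  have hdf₀ : LinearMap.det (f₀ : X →ₗ[K(p, K)] X) ≠ 0 := f₀.isUnit_det'.ne_zero
  have hcomp : LinearMap.det (f.symm.trans f₀ : X →ₗ[K(p, K)] X) =
      LinearMap.det (f₀ : X →ₗ[K(p, K)] X) * (LinearMap.det (f : X →ₗ[K(p, K)] X))⁻¹ := by
    rw [eq_mul_inv_iff_mul_eq₀ hdf, ← LinearMap.det_comp]
    congr 1
    ext x
    change f₀ (f.symm (f x)) = f₀ x
    rw [f.symm_apply_apply]
  rw [hcomp, vp_mul hdf₀ (inv_ne_zero hdf), vp_inv hdf, h1'] at h2'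
  have e1 := length_quotient_eq_add (le_inf hTL hTM) (inf_le_left : L ⊓ M ≤ L)
  have e2 := length_quotient_eq_add (le_inf hTL hTM) (inf_le_right : L ⊓ M ≤ M)
  have e3 := length_quotient_eq_add hTM hM
  rw [h1] at e1
  rw [h2, hc, e2] at e3
  generalize Module.length (WittVector p K) (L ⧸ (L ⊓ M).submoduleOf L) = A at *
  generalize Module.length (WittVector p K) (M ⧸ (L ⊓ M).submoduleOf M) = A' at *
  generalize Module.length (WittVector p K) ((L ⊓ M : Submodule _ X) ⧸ T.submoduleOf (L ⊓ M)) = A'' at *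
  -- All lengths are finite, so `toNat` loses nothing.
  have hA'' : A'' ≠ ⊤ := fun h => by rw [h, top_add] at e1; exact ENat.natCast_ne_top _ e1
  have hA : A ≠ ⊤ := fun h => by rw [h, add_top] at e1; exact ENat.natCast_ne_top _ e1
  have hA' : A' ≠ ⊤ := fun h => by rw [h, add_top, top_add] at e3; exact ENat.natCast_ne_top _ e3
  lift A to ℕ using hA
  lift A' to ℕ using hA'
  lift A'' to ℕ using hA''
  norm_cast at e1 e3
  rw [ENat.toNat_natCast, ENat.toNat_natCast]
  omega

end Volume

/-! ### Linear independence in a standard isocrystal. -/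

section Standard

variable {p : ℕ} [Fact p.Prime] {K : Type*} [Field K] [CharP K p] [PerfectRing K p]
variable {X : Type*} [AddCommGroup X] [WittVector.Isocrystal p K X]
variable {m n : ℕ} {e : ℕ → X}

variable [Module (WittVector p K) X] [IsScalarTower (WittVector p K) K(p, K) X]

theorem exists_mono_witt_smul (a b : ℕ) (w : WittVector p K) :
    ∃ w' : WittVector p K, ∀ x : X, mono p K X a b (w • x) = w' • mono p K X a b x := by
  induction a with
  | zero =>
    induction b with
    | zero => exact ⟨w, fun x => rfl⟩
    | succ b ih =>
      obtain ⟨w', hw'⟩ := ih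
      obtain ⟨w'', rfl⟩ := exists_frobenius_eq w'
      exact ⟨w'', fun x => by rw [← verHom_mono, hw', verHom_witt_smul, verHom_mono]⟩
  | succ a ih =>
    obtain ⟨w', hw'⟩ := ih
    exact ⟨WittVector.frobenius w', fun x => by
      rw [← frobHom_mono, hw', frobHom_witt_smul, frobHom_mono]⟩

/-- The span of a tail of a sequence. -/
def tailSpan (p : ℕ) [Fact p.Prime] (K : Type*) [Field K] [CharP K p] {X : Type*} [AddCommGroup X]
    [Module (WittVector p K) X] (e : ℕ → X) (l : ℕ) : Submodule (WittVector p K) X :=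
  Submodule.span _ {x | ∃ l', l ≤ l' ∧ x = e l'}

theorem mem_tailSpan {l l' : ℕ} (h : l ≤ l') : e l' ∈ tailSpan p K e l :=
  Submodule.subset_span ⟨l', h, rfl⟩

theorem mono_mem_tailSpan (hF : ∀ l, frobHom p K X (e l) = e (l + m))
    (hp : ∀ l, (p : K(p, K)) • e l = e (l + (m + n))) (a b l : ℕ) {x : X}
    (hx : x ∈ tailSpan p K e l) :
    mono p K X a b x ∈ tailSpan p K e (l + (a * m + b * n)) := by
  induction hx using Submodule.span_induction with
  | mem x hx =>
    obtain ⟨l', hl, rfl⟩ := hx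
    rw [mono_shift hF hp]
    exact mem_tailSpan (by omega)
  | zero => rw [map_zero]; exact zero_mem _
  | add x y _ _ hx hy => rw [map_add]; exact add_mem hx hy
  | smul w x _ hx =>
    obtain ⟨w', hw'⟩ := exists_mono_witt_smul (p := p) (K := K) (X := X) a b w
    rw [hw']
    exact Submodule.smul_mem _ _ hx

/-- If e_l were a combination of later terms, applying F^a V^b would give the same at l + am + bn,
hence at all large indices. A tail would then equal p times itself and vanish by Nakayama, yet it
contains p^L e_0. -/
theorem notMem_tailSpan (hm : 0 < m) (hmn : m.Coprime n)
    (hF : ∀ l, frobHom p K X (e l) = e (l + m))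
    (hp : ∀ l, (p : K(p, K)) • e l = e (l + (m + n))) (he : e 0 ≠ 0) (l : ℕ) :
    e l ∉ tailSpan p K e (l + 1) := by
  classical
  intro h
  set L := l + (m - 1) * (n - 1) with hL
  have h1 : ∀ l', L ≤ l' → e l' ∈ tailSpan p K e (l' + 1) := by
    intro l' hl'
    obtain ⟨d, rfl⟩ := Nat.exists_eq_add_of_le ((Nat.le_add_right _ _).trans hl')
    obtain ⟨a, b, hab⟩ := Nat.exists_add_mul_eq_of_gcd_dvd_of_mul_pred_le m n d
      (by simp [hmn.gcd_eq_one]) (by simp only [Nat.pred_eq_sub_one]; omega)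
    have := mono_mem_tailSpan hF hp a b _ h
    rw [mono_shift hF hp, hab] at this
    rwa [show l + d + 1 = l + 1 + d by ring]
  have h2 : ∀ q, tailSpan p K e L ≤ tailSpan p K e (L + q) := by
    intro q
    induction q with
    | zero => exact le_rfl
    | succ q ih =>
      refine ih.trans (Submodule.span_le.2 ?_)
      rintro _ ⟨l', hl', rfl⟩
      rcases hl'.eq_or_lt with rfl | hlt
      · exact h1 _ (Nat.le_add_right _ _)
      · exact mem_tailSpan (by omega)
  have hh : 0 < m + n := by omega
  have hpow : ∀ q l, e (l + q * (m + n)) = (p : WittVector p K) ^ q • e l := fun q l => by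
    rw [← p_pow_smul_shift hp, witt_smul_eq, map_pow, map_natCast]
  have hfg : (tailSpan p K e L).FG := by
    refine ⟨(Finset.range (m + n)).image fun i => e (L + i), le_antisymm ?_ ?_⟩ <;>
      rw [Finset.coe_image] <;> refine Submodule.span_le.2 ?_
    · rintro _ ⟨i, -, rfl⟩
      exact mem_tailSpan (Nat.le_add_right _ _)
    · rintro _ ⟨l', hl', rfl⟩
      obtain ⟨d, rfl⟩ := Nat.exists_eq_add_of_le hl'
      have : L + d = L + d % (m + n) + d / (m + n) * (m + n) := by
        rw [add_assoc L, Nat.mod_add_div']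
      rw [this, hpow]
      exact Submodule.smul_mem _ _ (Submodule.subset_span
        ⟨_, Finset.mem_coe.2 (Finset.mem_range.2 (Nat.mod_lt _ hh)), rfl⟩)
  have hle : tailSpan p K e L ≤ Ideal.span {(p : WittVector p K)} • tailSpan p K e L := by
    refine (h2 (m + n)).trans (Submodule.span_le.2 ?_)
    rintro _ ⟨l', hl', rfl⟩
    obtain ⟨d, rfl⟩ := Nat.exists_eq_add_of_le hl'
    rw [show L + (m + n) + d = L + d + 1 * (m + n) by ring, hpow, pow_one]
    exact Submodule.smul_mem_smul (Ideal.mem_span_singleton_self _)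
      (mem_tailSpan (Nat.le_add_right _ _))
  have hbot := Submodule.eq_bot_of_le_smul_of_le_jacobson_bot _ _ hfg hle (by
    rw [IsLocalRing.jacobson_eq_maximalIdeal ⊥ bot_ne_top, Ideal.span_le,
      Set.singleton_subset_iff]
    exact (IsLocalRing.mem_maximalIdeal _).2 (WittVector.irreducible p).not_isUnit)
  have hz : e (0 + L * (m + n)) ∈ tailSpan p K e L :=
    mem_tailSpan (by rw [zero_add]; exact Nat.le_mul_of_pos_right _ hh)
  rw [hbot, Submodule.mem_bot, ← p_pow_smul_shift hp] at hz
  exact he ((smul_eq_zero.1 hz).resolve_left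
    (pow_ne_zero _ (WittVector.FractionRing.p_nonzero p K)))

/-- In a relation over W(K), take the first coefficient that is a unit. The earlier terms are
divisible by p and so jump behind it, which puts its vector into the tail behind it. Thus p divides
all coefficients; dividing by p and repeating makes them vanish. -/
theorem linearIndependent_shift (hm : 0 < m) (hmn : m.Coprime n)
    (hF : ∀ l, frobHom p K X (e l) = e (l + m))
    (hp : ∀ l, (p : K(p, K)) • e l = e (l + (m + n))) (he : e 0 ≠ 0) :
    LinearIndependent K(p, K) fun i : Fin (m + n) => e i := by
  rw [← LinearIndependent.iff_fractionRing (R := WittVector p K), Fintype.linearIndependent_iff]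
  classical
  have hdvd : ∀ w : Fin (m + n) → WittVector p K, ∑ i, w i • e i = 0 → ∀ i, (p : WittVector p K) ∣ w i := by
    intro w hw
    by_contra! hex
    have hne : (Finset.univ.filter fun i => ¬ (p : WittVector p K) ∣ w i).Nonempty :=
      hex.imp fun i hi => Finset.mem_filter.2 ⟨Finset.mem_univ _, hi⟩
    set i₀ := Finset.min' _ hne with hi₀
    have hi₀' : ¬ (p : WittVector p K) ∣ w i₀ := (Finset.mem_filter.1 (Finset.min'_mem _ hne)).2
    have hlt : ∀ i < i₀, (p : WittVector p K) ∣ w i := fun i hi => by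
      by_contra h
      exact absurd (Finset.min'_le _ i (Finset.mem_filter.2 ⟨Finset.mem_univ _, h⟩)) (not_le.2 hi)
    have hu : IsUnit (w i₀) := by
      rw [p_dvd_iff_coeff_zero] at hi₀'
      exact WittVector.isUnit_of_coeff_zero_ne_zero _ hi₀'
    have hmem : w i₀ • e i₀ ∈ tailSpan p K e (i₀ + 1) := by
      rw [← Finset.add_sum_erase _ _ (Finset.mem_univ i₀), add_eq_zero_iff_eq_neg] at hw
      rw [hw]
      refine neg_mem (sum_mem fun i hi => ?_)
      rcases lt_or_gt_of_ne (Finset.ne_of_mem_erase hi) with h | h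
      · obtain ⟨w', hw'⟩ := hlt i h
        rw [hw', mul_comm, mul_smul, p_smul_eq, hp]
        exact Submodule.smul_mem _ _ (mem_tailSpan (by have := i₀.2; omega))
      · exact Submodule.smul_mem _ _ (mem_tailSpan h)
    obtain ⟨u, hu⟩ := hu
    rw [← hu, Submodule.smul_mem_iff_of_isUnit _ u.isUnit] at hmem
    exact notMem_tailSpan hm hmn hF hp he _ hmem
  have hpow : ∀ (N : ℕ) (w : Fin (m + n) → WittVector p K), ∑ i, w i • e i = 0 →
      ∀ i, (p : WittVector p K) ^ N ∣ w i := by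
    intro N
    induction N with
    | zero => intro w _ i; simp
    | succ N ih =>
      intro w hw i
      choose w' hw' using hdvd w hw
      have h : (p : WittVector p K) • ∑ i, w' i • e i = 0 := by
        rw [Finset.smul_sum, ← hw]
        exact Finset.sum_congr rfl fun i _ => by rw [hw', mul_smul]
      rw [p_smul_eq, smul_eq_zero] at h
      rw [hw', pow_succ']
      exact mul_dvd_mul_left _ (ih w'
        (h.resolve_left (WittVector.FractionRing.p_nonzero p K)) i)
  intro w hw i
  refine WittVector.ext fun j => ?_
  rw [WittVector.zero_coeff]
  exact (WittVector.mem_span_p_pow_iff_le_coeff_eq_zero (w i) (j + 1)).1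
    (Ideal.mem_span_singleton.2 (hpow _ w hw i)) j j.lt_succ_self

end Standard

/-! ### The operators π_j and a basis of N. -/

section Relations

/-- The relation F^h = p^m is known only at e₀. It passes to powers since B⁻¹A fixes x and the
powers distribute by commutation. -/
theorem zpow_apply_eq_of_commute {α : Type*} {A B : Equiv.Perm α} (h : Commute A B) {x : α}
    (hx : A x = B x) (z : ℤ) : (A ^ z) x = (B ^ z) x := by
  have h1 : (B⁻¹ * A) x = x := by rw [Equiv.Perm.mul_apply, hx]; exact B.symm_apply_apply x
  have h2 := Equiv.Perm.zpow_apply_eq_self_of_apply_eq_self h1 z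
  rw [(h.symm.inv_left).mul_zpow, inv_zpow, Equiv.Perm.mul_apply] at h2
  exact Equiv.Perm.inv_eq_iff_eq.1 h2

variable {α : Type*} {P Φ : Equiv.Perm α} (hc : Commute P Φ) {x : α} {h m a b : ℤ}
  (hx : (Φ ^ h) x = (P ^ m) x) (hab : a * h + b * m = 1)

include hc hx hab

/-- At x, P^m may be replaced by Φ^h, so the m-th power of P^a Φ^b becomes Φ^(ah+bm) = Φ. The next
theorem replaces Φ^h by P^m instead. -/
theorem zpow_uniformizer_num : ((P ^ a * Φ ^ b) ^ m) x = Φ x := by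
  have hz := (zpow_apply_eq_of_commute ((hc.zpow_zpow m h).symm) hx a).symm
  rw [(hc.zpow_zpow a b).mul_zpow, ← zpow_mul, ← zpow_mul, (hc.zpow_zpow (a * m) (b * m)).eq,
    mul_comm a m, zpow_mul P, Equiv.Perm.mul_apply, hz, ← zpow_mul, ← Equiv.Perm.mul_apply, ← zpow_add,
    show b * m + h * a = 1 by linear_combination hab, zpow_one]

theorem zpow_uniformizer_den : ((P ^ a * Φ ^ b) ^ h) x = P x := by
  have hz := (zpow_apply_eq_of_commute ((hc.zpow_zpow m h).symm) hx b)
  rw [(hc.zpow_zpow a b).mul_zpow, ← zpow_mul, ← zpow_mul, mul_comm b h, zpow_mul Φ,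
    Equiv.Perm.mul_apply, hz, ← zpow_mul, ← Equiv.Perm.mul_apply, ← zpow_add,
    show a * h + m * b = 1 by linear_combination hab, zpow_one]

theorem uniformizer_num (l : ℤ) :
    Φ (((P ^ a * Φ ^ b) ^ l) x) = ((P ^ a * Φ ^ b) ^ (l + m)) x := by
  have hcomm : Commute Φ ((P ^ a * Φ ^ b) ^ l) :=
    (((hc.symm.zpow_right a)).mul_right ((Commute.refl Φ).zpow_right b)).zpow_right l
  rw [zpow_add, Equiv.Perm.mul_apply, zpow_uniformizer_num hc hx hab, ← Equiv.Perm.mul_apply,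
    hcomm.eq, Equiv.Perm.mul_apply]

theorem uniformizer_den (l : ℤ) :
    P (((P ^ a * Φ ^ b) ^ l) x) = ((P ^ a * Φ ^ b) ^ (l + h)) x := by
  have hcomm : Commute P ((P ^ a * Φ ^ b) ^ l) :=
    ((((Commute.refl P).zpow_right a)).mul_right (hc.zpow_right b)).zpow_right l
  rw [zpow_add, Equiv.Perm.mul_apply, zpow_uniformizer_den hc hx hab, ← Equiv.Perm.mul_apply,
    hcomm.eq, Equiv.Perm.mul_apply]

end Relations

section Decomposition

variable {p : ℕ} [Fact p.Prime] {k : Type*} [Field k] [CharP k p] [PerfectRing k p]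
variable {N : Type*} [AddCommGroup N] [WittVector.Isocrystal p k N]

variable (p k N) in
/-- Multiplication by `p` as a permutation. -/
def pPerm : Equiv.Perm N :=
  MulAction.toPermHom K(p, k)ˣ N (Units.mk0 (p : K(p, k)) (WittVector.FractionRing.p_nonzero p k))

theorem pPerm_zpow_apply (z : ℤ) (x : N) : (pPerm p k N ^ z) x = (p : K(p, k)) ^ z • x := by
  rw [pPerm, ← map_zpow]
  change ((Units.mk0 (p : K(p, k)) _ ^ z : K(p, k)ˣ) : K(p, k)) • x = _
  rw [Units.val_zpow_eq_zpow_val, Units.val_mk0]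

theorem pPerm_commute_F : Commute (pPerm p k N) (F p k N) :=
  Equiv.ext fun x => by
    have h := frobHom_smul (p := p) (K := k) (p : K(p, k)) x
    rw [map_natCast] at h
    exact h.symm

theorem piPerm_eq (α β : ℤ) : piPerm p k N α β = pPerm p k N ^ α * F p k N ^ β := by
  refine Equiv.ext fun x => ?_
  rw [Equiv.Perm.mul_apply, pPerm_zpow_apply]
  rfl

variable {D : SlopeData} (E : Decomposition p k N D) {α β : Fin D.r → ℤ}
  (hαβ : ∀ j, α j * (D.h j : ℤ) + β j * (D.m j : ℤ) = 1)

namespace Decomposition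

theorem frob_e₀_zpow (s : D.Slot) :
    (F p k N ^ (D.h s.1 : ℤ)) (E.e₀ s) = (pPerm p k N ^ (D.m s.1 : ℤ)) (E.e₀ s) := by
  rw [pPerm_zpow_apply, zpow_natCast, zpow_natCast, E.frob_e₀]

include hαβ

theorem frobHom_e (s : D.Slot) (l : ℤ) :
    frobHom p k N (E.e α β s l) = E.e α β s (l + D.m s.1) := by
  rw [e, e, piPerm_eq]
  exact uniformizer_num pPerm_commute_F (E.frob_e₀_zpow s) (hαβ s.1) l

theorem p_smul_e (s : D.Slot) (l : ℤ) :
    (p : K(p, k)) • E.e α β s l = E.e α β s (l + D.h s.1) := by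
  rw [e, e, piPerm_eq]
  exact uniformizer_den pPerm_commute_F (E.frob_e₀_zpow s) (hαβ s.1) l

omit hαβ in
theorem e_zero (s : D.Slot) : E.e α β s 0 = E.e₀ s := by
  rw [e, zpow_zero, Equiv.Perm.one_apply]

theorem span_e (s : D.Slot) :
    Submodule.span K(p, k) (Set.range fun i : Fin (D.m s.1 + D.n s.1) => E.e α β s (i : ℕ)) =
      E.comp s := by
  have hF : ∀ l : ℕ, frobHom p k N (E.e α β s l) = E.e α β s (l + D.m s.1 : ℕ) := fun l => by
    rw [E.frobHom_e hαβ, Nat.cast_add]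
  have hp : ∀ l : ℕ, (p : K(p, k)) • E.e α β s l = E.e α β s (l + (D.m s.1 + D.n s.1) : ℕ) :=
    fun l => by rw [E.p_smul_e hαβ, Nat.cast_add]; rfl
  have hmn := D.m_pos s.1
  set S := Submodule.span K(p, k)
    (Set.range fun i : Fin (D.m s.1 + D.n s.1) => E.e α β s (i : ℕ)) with hS
  have hmem : ∀ l : ℕ, E.e α β s l ∈ S := by
    intro l
    have h := p_pow_smul_shift (e := fun l : ℕ => E.e α β s l) hp
      (l / (D.m s.1 + D.n s.1)) (l % (D.m s.1 + D.n s.1))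
    rw [Nat.mod_add_div'] at h
    rw [← h]
    exact Submodule.smul_mem _ _ (Submodule.subset_span
      ⟨⟨_, Nat.mod_lt _ (by omega)⟩, rfl⟩)
  have hcomp : ∀ l : ℕ, E.e α β s l ∈ E.comp s := by
    intro l
    -- Stability of `E.comp s` under F puts only F^c e₀ with c ≥ 0 into it, so p^q e_l is written in
    -- this form. The equation c m = l + q h is solved by c = lβ, q = -lα; adding t (h, m) makes
    -- both nonnegative.
    obtain ⟨c, q, hcq⟩ : ∃ c q : ℕ, c * D.m s.1 = l + q * (D.m s.1 + D.n s.1) := by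
      have h1 := hαβ s.1
      have h2 : (D.h s.1 : ℤ) = D.m s.1 + D.n s.1 := by rw [SlopeData.h]; push_cast; ring
      have h3 := D.m_pos s.1
      have h4 := D.n_pos s.1
      set t : ℤ := |l * β s.1| + |l * α s.1| with ht
      refine ⟨(l * β s.1 + t * D.h s.1).toNat, (-(l * α s.1) + t * D.m s.1).toNat, ?_⟩
      have ha := neg_abs_le (l * β s.1)
      have hb := le_abs_self (l * α s.1)
      have ha' := abs_nonneg (l * β s.1)
      have hb' := abs_nonneg (l * α s.1)
      zify
      rw [Int.toNat_of_nonneg (by rw [h2]; nlinarith), Int.toNat_of_nonneg (by nlinarith), ← h2]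
      linear_combination (l : ℤ) * h1
    have h1 : (frobHom p k N ^ c) (E.e₀ s) ∈ E.comp s := by
      clear hcq
      induction c with
      | zero => exact E.e₀_mem s
      | succ c ih => rw [pow_succ']; exact (E.isSimple s).2.1 _ ih
    have h2 := mono_shift (e := fun l : ℕ => E.e α β s l) hF hp c 0 0
    have h3 := p_pow_smul_shift (e := fun l : ℕ => E.e α β s l) hp q l
    simp only [zero_mul, add_zero, zero_add, Nat.cast_zero, E.e_zero, mono, pow_zero, mul_one] at h2
    rw [h2, hcq] at h1
    simp only [← h3] at h1
    exact (Submodule.smul_mem_iff _ (pow_ne_zero _ (WittVector.FractionRing.p_nonzero p k))).1 h1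
  have hle : S ≤ E.comp s := Submodule.span_le.2 (by rintro _ ⟨i, rfl⟩; exact hcomp i)
  -- S is F-stable and contains e₀ ≠ 0, so simplicity of the component forces equality.
  refine ((E.isSimple s).2.2 S hle fun x hx => ?_).resolve_left fun hbot => ?_
  · rw [← frobHom_apply]
    induction hx using Submodule.span_induction with
    | mem x hx => obtain ⟨i, rfl⟩ := hx; simp only [hF]; exact hmem _
    | zero => rw [map_zero]; exact zero_mem _
    | add x y _ _ hx hy => rw [map_add]; exact add_mem hx hy
    | smul w x _ hx => rw [frobHom_smul]; exact Submodule.smul_mem _ _ hx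
  · have := hmem 0
    rw [hbot, Submodule.mem_bot, Nat.cast_zero, E.e_zero] at this
    exact E.e₀_ne_zero s this

theorem linearIndependent_e (s : D.Slot) :
    LinearIndependent K(p, k) fun i : Fin (D.m s.1 + D.n s.1) => E.e α β s (i : ℕ) := by
  let : Module (WittVector p k) N := Module.compHom N (algebraMap (WittVector p k) K(p, k))
  have : IsScalarTower (WittVector p k) K(p, k) N :=
    ⟨fun a b x => by rw [Algebra.smul_def, mul_smul]; rfl⟩
  exact linearIndependent_shift (e := fun l : ℕ => E.e α β s l) (D.m_pos s.1) (D.coprime s.1)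
    (fun l => by rw [E.frobHom_e hαβ, Nat.cast_add])
    (fun l => by rw [E.p_smul_e hαβ, Nat.cast_add]; rfl)
    (by rw [Nat.cast_zero, E.e_zero]; exact E.e₀_ne_zero s)

theorem exists_basis : ∃ b : Module.Basis (Σ s : D.Slot, Fin (D.m s.1 + D.n s.1)) K(p, k) N,
    ∀ s i, b ⟨s, i⟩ = E.e α β s (i : ℕ) := by
  let v := fun s => (Module.Basis.span (E.linearIndependent_e hαβ s)).map
    (LinearEquiv.ofEq _ _ (E.span_e hαβ s))
  refine ⟨E.isInternal.collectedBasis v, fun s i => ?_⟩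
  rw [DirectSum.IsInternal.collectedBasis_coe]
  simp only [v, Module.Basis.map_apply, LinearEquiv.coe_ofEq_apply, Module.Basis.span_apply]

end Decomposition

end Decomposition

/-! ### Independence of p-adic convergence from the lattice. -/

namespace Frame

variable {p : ℕ} [Fact p.Prime] {K : Type*} [Field K] [CharP K p] [PerfectRing K p]
variable {X : Type*} [AddCommGroup X] [WittVector.Isocrystal p K X]
variable [Module (WittVector p K) X] [IsScalarTower (WittVector p K) K(p, K) X]
variable {ι : Type*} [Fintype ι] {m n : ι → ℕ} (B B' : Frame p K X m n)

omit [Fintype ι] in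
theorem p_pow_smul_mem_G {t : ι} {l : ℕ} (N : ℕ) {x : X} (hx : x ∈ B.G t l) :
    (p : WittVector p K) ^ N • x ∈ B.G t (l + N) := by
  induction N with
  | zero => simpa using hx
  | succ N ih => rw [pow_succ', mul_smul]; exact B.p_smul_mem_G_succ ih

theorem exists_p_pow_smul_mem_lattice (x : X) :
    ∃ c : ℕ, (p : WittVector p K) ^ c • x ∈ B.lattice := by
  rw [← B.basis.sum_repr x]
  classical
  refine Finset.induction_on (motive := fun s : Finset (Σ t, Fin (m t + n t)) =>
    ∃ c : ℕ, (p : WittVector p K) ^ c • ∑ i ∈ s, B.basis.repr x i • B.basis i ∈ B.lattice)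
    Finset.univ ⟨0, by simp⟩ ?_
  rintro i s hi ⟨c, hc⟩
  obtain ⟨N, w, hw⟩ := exists_p_pow_smul_eq (B.basis.repr x i)
  refine ⟨c + N, ?_⟩
  rw [Finset.sum_insert hi, smul_add]
  refine add_mem ?_ ?_
  · rw [pow_add, mul_smul]
    have : (p : WittVector p K) ^ N • B.basis.repr x i • B.basis i = w • B.basis i := by
      rw [witt_smul_eq, map_pow, map_natCast, smul_smul, hw, ← witt_smul_eq]
    rw [this, B.basis_apply]
    exact Submodule.smul_mem _ _ (Submodule.smul_mem _ _ (B.e_mem_lattice _ _))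
  · rw [add_comm, pow_add, mul_smul]
    exact Submodule.smul_mem _ _ hc

theorem exists_p_pow_smul_lattice_le :
    ∃ c : ℕ, ∀ y ∈ B'.lattice, (p : WittVector p K) ^ c • y ∈ B.lattice := by
  choose c hc using fun i => B.exists_p_pow_smul_mem_lattice (B'.basis i)
  classical
  refine ⟨∑ i, c i, fun y hy => ?_⟩
  rw [lattice_eq_span_basis] at hy
  induction hy using Submodule.span_induction with
  | mem x hx =>
    obtain ⟨i, rfl⟩ := hx
    rw [← Finset.sum_erase_add _ _ (Finset.mem_univ i), pow_add, mul_smul]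
    exact Submodule.smul_mem _ _ (hc i)
  | zero => rw [smul_zero]; exact zero_mem _
  | add x y _ _ hx hy => rw [smul_add]; exact add_mem hx hy
  | smul w x _ hx => rw [smul_comm]; exact Submodule.smul_mem _ _ hx

theorem sum_sub_sum_mem_G (b : ι → ℕ → K) (t : ι) {L L' : ℕ} (hL : L ≤ L') :
    ∑ s, ∑ l ∈ Finset.range L', WittVector.teichmuller p (b s l) • B.e s l -
      ∑ l ∈ Finset.range L, WittVector.teichmuller p (b t l) • B.e t l ∈ B.G t L := by
  classical
  rw [← Finset.add_sum_erase _ _ (Finset.mem_univ t), ← Finset.sum_range_add_sum_Ico _ hL,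
    add_assoc, add_sub_cancel_left]
  refine add_mem (sum_mem fun l hl => ?_) (sum_mem fun s hs => sum_mem fun l _ => ?_)
  · exact Submodule.smul_mem _ _ (B.e_mem_G (Finset.mem_Ico.1 hl).1)
  · exact Submodule.smul_mem _ _ (B.e_mem_G_of_ne (Finset.ne_of_mem_erase hs) _ _)

/-- `p`-adic convergence of an expansion may be tested with any lattice. -/
theorem expands_iff {b : ι → ℕ → K} {x : X} :
    B.Expands b x ↔ ∀ N : ℕ, ∃ L₀ : ℕ, ∀ L ≥ L₀, ∃ y ∈ B'.lattice,
      x - ∑ s, ∑ l ∈ Finset.range L, WittVector.teichmuller p (b s l) • B.e s l =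
        (p : WittVector p K) ^ N • y := by
  constructor
  · intro h N
    obtain ⟨c, hc⟩ := B'.exists_p_pow_smul_lattice_le B
    -- From this L on the remainder lies in p^(N+c) times `B.lattice`, and p^c carries that lattice
    -- into `B'.lattice`.
    refine ⟨(N + c) * ∑ t, (m t + n t), fun L hL => ?_⟩
    obtain ⟨y, hy, hxy⟩ := B.exists_p_pow_smul_of_mem_G (N + c) (x := x -
      ∑ s, ∑ l ∈ Finset.range L, WittVector.teichmuller p (b s l) • B.e s l) fun t => by
        have hLt : (N + c) * (m t + n t) ≤ L := le_trans (Nat.mul_le_mul_left _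
          (Finset.single_le_sum (f := fun t => m t + n t) (fun _ _ => Nat.zero_le _)
            (Finset.mem_univ t))) hL
        refine B.G_anti t hLt ?_
        have := sub_mem (h t L) (B.sum_sub_sum_mem_G b t (le_refl L))
        rwa [sub_sub_sub_cancel_right] at this
    exact ⟨_, hc y hy, by rw [hxy, pow_add, mul_smul]⟩
  · intro h t L
    obtain ⟨c, hc⟩ := B.exists_p_pow_smul_lattice_le B'
    obtain ⟨L₀, hL₀⟩ := h (L + c)
    obtain ⟨y, hy, hxy⟩ := hL₀ (max L L₀) (le_max_right _ _)
    have h1 := B.p_pow_smul_mem_G L (B.lattice_le_G t (hc y hy))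
    rw [smul_smul, ← pow_add, ← hxy, zero_add] at h1
    have := add_mem h1 (B.sum_sub_sum_mem_G b t (le_max_left L L₀))
    rwa [sub_add_sub_cancel] at this

end Frame

/-! ### The order on the slots and condition (*). -/

namespace SlopeData

variable (D : SlopeData)

/-- The lexicographic order on the slots as a linear order. -/
@[reducible] def slotOrder : LinearOrder D.Slot :=
  LinearOrder.lift' (fun s => (toLex s : Σₗ j, Fin (D.l j))) toLex.injective

theorem slotOrder_lt (s t : D.Slot) : D.slotOrder.lt s t ↔ D.SlotLt s t := by
  change Sigma.Lex (· < ·) (fun _ => (· < ·)) s t ↔ _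
  obtain ⟨j, i⟩ := s
  obtain ⟨j', i'⟩ := t
  rw [Sigma.lex_iff, SlotLt]
  refine or_congr Iff.rfl ⟨?_, ?_⟩
  · rintro ⟨h, h'⟩
    obtain rfl : j = j' := h
    exact ⟨rfl, h'⟩
  · rintro ⟨h, h'⟩
    obtain rfl : j = j' := h
    exact ⟨rfl, h'⟩

variable {D}

theorem mul_lt_mul_of_lt {j j' : Fin D.r} (h : j < j') : D.m j * D.n j' < D.m j' * D.n j := by
  have h1 := D.slope_lt j j' h
  have hm : (0 : ℚ) < D.m j := by exact_mod_cast D.m_pos j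
  have hm' : (0 : ℚ) < D.m j' := by exact_mod_cast D.m_pos j'
  rw [div_lt_div_iff₀ (by positivity) (by positivity)] at h1
  have h2 : (D.m j : ℚ) * D.n j' < D.m j' * D.n j := by linarith
  exact_mod_cast h2

theorem mul_le_mul_of_slotOrder_le {s t : D.Slot} (h : D.slotOrder.le s t) :
    D.m s.1 * D.n t.1 ≤ D.m t.1 * D.n s.1 := by
  rcases (@le_iff_eq_or_lt _ D.slotOrder.toPartialOrder s t).1 h with rfl | h
  · exact le_rfl
  · rcases (D.slotOrder_lt s t).1 h with h | ⟨h, -⟩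
    · exact (mul_lt_mul_of_lt h).le
    · rw [h]

theorem eq_of_slope_eq {j j' : Fin D.r} (hm : D.m j = D.m j') (hn : D.n j = D.n j') : j = j' := by
  rcases lt_trichotomy j j' with h | h | h
  · exact absurd (mul_lt_mul_of_lt h) (by rw [hm, hn]; exact lt_irrefl _)
  · exact h
  · exact absurd (mul_lt_mul_of_lt h) (by rw [hm, hn]; exact lt_irrefl _)

/-- Strictly increasing slopes make j recoverable from (m_j, n_j), so a relation supported on one
pair is a relation within one j. -/
theorem leadingIndependent_iff (p : ℕ) [Fact p.Prime] {K : Type*} [Field K] [CharP K p]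
    {a : D.Slot → ℕ → K} : LeadingIndependent p a ↔
      Indep p (fun s : D.Slot => D.m s.1) (fun s => D.n s.1) ∅ fun s => a s 0 := by
  have hmem : ∀ (j : Fin D.r) (x : K),
      x ∈ (iterateFrobenius K p (D.h j)).eqLocusField (RingHom.id K) ↔
        x ^ p ^ (D.m j + D.n j) = x := fun j x => by
    rw [RingHom.mem_eqLocusField, iterateFrobenius_def]
    rfl
  constructor
  · intro h s c hc hs hsum t
    by_contra ht
    have hne : ∀ t, c t ≠ 0 → t.1 = s.1 := fun t ht =>
      eq_of_slope_eq (hs t ht).2.1 (hs t ht).2.2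
    have h1 := Fintype.linearIndependent_iff.1 (h s.1)
      (fun i => ⟨c ⟨s.1, i⟩, (hmem _ _).2 (hc ⟨s.1, i⟩)⟩) (by
        rw [Fintype.sum_sigma, Finset.sum_eq_single s.1] at hsum
        · exact hsum
        · intro j _ hj
          refine Finset.sum_eq_zero fun i _ => ?_
          by_contra h0
          exact hj (hne _ (left_ne_zero_of_mul h0))
        · exact fun h => absurd (Finset.mem_univ _) h)
    obtain ⟨j, i⟩ := t
    obtain rfl : j = s.1 := hne _ ht
    exact ht (congrArg Subtype.val (h1 i))
  · intro h j
    rw [Fintype.linearIndependent_iff]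
    intro f hf i
    let c : D.Slot → K := fun t => if ht : t.1 = j then (f (ht ▸ t.2) : K) else 0
    have hcj : ∀ i, c ⟨j, i⟩ = f i := fun i => dif_pos rfl
    have hc0 : ∀ t : D.Slot, t.1 ≠ j → c t = 0 := fun t ht => dif_neg ht
    have h1 := h ⟨j, i⟩ c (fun t => ?_) (fun t ht => ?_) ?_ ⟨j, i⟩
    · rw [hcj] at h1
      exact Subtype.ext h1
    · obtain ⟨j', i'⟩ := t
      by_cases hj : j' = j
      · subst hj
        rw [hcj]
        exact (hmem _ _).1 (f i').2
      · rw [hc0 _ hj, zero_pow (pow_ne_zero _ (Fact.out : p.Prime).ne_zero)]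
    · have : t.1 = j := by
        by_contra hj; exact ht (hc0 t hj)
      exact ⟨Finset.notMem_empty _, congrArg D.m this, congrArg D.n this⟩
    · rw [Fintype.sum_sigma, Finset.sum_eq_single j]
      · rw [← hf]
        exact Finset.sum_congr rfl fun i _ => by rw [hcj]; rfl
      · intro j' _ hj
        exact Finset.sum_eq_zero fun i _ => by rw [hc0 _ hj, zero_mul]
      · exact fun h => absurd (Finset.mem_univ _) h

end SlopeData

/-! ### The frame of N_K attached to g. -/

section BaseChange

variable {p : ℕ} [Fact p.Prime] {k : Type*} [Field k] [CharP k p] [PerfectRing k p]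
variable {K : Type*} [Field K] [CharP K p] [PerfectRing K p] [Algebra k K]
variable {N : Type*} [AddCommGroup N] [WittVector.Isocrystal p k N]

/-- After clearing denominators an element is p^m times a unit, and the map fixes p and preserves
units. -/
theorem vp_fracMap {c : K(p, k)} (hc : c ≠ 0) : vp p K (fracMap p k K c) = vp p k c := by
  obtain ⟨n, w, hw⟩ := exists_p_pow_smul_eq c
  have hp : (p : K(p, k)) ^ n ≠ 0 := pow_ne_zero _ (WittVector.FractionRing.p_nonzero p k)
  have hp' : (p : K(p, K)) ^ n ≠ 0 := pow_ne_zero _ (WittVector.FractionRing.p_nonzero p K)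
  have hw0 : w ≠ 0 := by
    rintro rfl
    rw [map_zero] at hw
    exact mul_ne_zero hp hc hw
  obtain ⟨m, u, rfl⟩ := WittVector.exists_eq_pow_p_mul' w hw0
  have h1 := congrArg (vp p k) hw
  have h2 := congrArg (fun x => vp p K (fracMap p k K x)) hw
  have h3 := vp_p_pow_mul_unit m
    (Units.map (WittVector.map (p := p) (algebraMap k K) : WittVector p k →* WittVector p K) u)
  have h4 : fracMap p k K (algebraMap _ _ ((p : WittVector p k) ^ m * u)) =
      algebraMap (WittVector p K) K(p, K) ((p : WittVector p K) ^ m *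
        (Units.map (WittVector.map (p := p) (algebraMap k K) : WittVector p k →* WittVector p K) u :
          (WittVector p K)ˣ)) := by
    rw [fracMap_algebraMap, map_mul, map_pow, map_natCast]
    rfl
  simp only [h4, h3, map_mul (fracMap p k K) _ c, map_pow, map_natCast] at h2
  rw [vp_mul hp' ((map_ne_zero _).2 hc), vp_pow (WittVector.FractionRing.p_nonzero p K), vp_p] at h2
  rw [vp_mul hp hc, vp_pow (WittVector.FractionRing.p_nonzero p k), vp_p, vp_p_pow_mul_unit] at h1
  omega

variable (p k K N) in
attribute [local instance] fracAlgebra in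
/-- The base change of an automorphism. -/
def autBaseChange (g : N ≃ₗ[K(p, k)] N) : BaseChange p k K N ≃ₗ[K(p, K)] BaseChange p k K N :=
  (g.baseChange K(p, k) K(p, K) N N :)

attribute [local instance] fracAlgebra in
theorem det_autBaseChange [Module.Finite K(p, k) N] (g : N ≃ₗ[K(p, k)] N) :
    LinearMap.det (autBaseChange p k K N g : BaseChange p k K N →ₗ[K(p, K)] BaseChange p k K N) =
      fracMap p k K (LinearMap.det (g : N →ₗ[K(p, k)] N)) :=
  LinearMap.det_baseChange (A := K(p, K)) (g : N →ₗ[K(p, k)] N)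

variable {D : SlopeData} (E : Decomposition p k N D) {α β : Fin D.r → ℤ}
  (hαβ : ∀ j, α j * (D.h j : ℤ) + β j * (D.m j : ℤ) = 1)

attribute [local instance] fracAlgebra in
variable (K) in
/-- The frame of `N_K` given by the vectors `g (e_{jil})`. -/
def Decomposition.frame (g : N ≃ₗ[K(p, k)] N) (hg : ∀ x : N, g (F p k N x) = F p k N (g x)) :
    Frame p K (BaseChange p k K N) (fun s : D.Slot => D.m s.1) fun s => D.n s.1 where
  m_pos s := D.m_pos s.1
  n_pos s := D.n_pos s.1
  e s l := toBaseChange p k K (g (E.e α β s (l : ℕ)))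
  frob_e s l := by
    rw [frobHom_apply, F_toBaseChange, ← hg, ← frobHom_apply, E.frobHom_e hαβ, Nat.cast_add]
  p_smul_e' s l := by
    have : ∀ x : N, (p : K(p, K)) • toBaseChange p k K x = toBaseChange p k K ((p : K(p, k)) • x) := by
      intro x
      rw [Nat.cast_smul_eq_nsmul, Nat.cast_smul_eq_nsmul]
      exact (map_nsmul (TensorProduct.mk K(p, k) K(p, K) N 1) p x).symm
    rw [this, ← map_smul, E.p_smul_e hαβ, Nat.cast_add]
    rfl
  basis := (Algebra.TensorProduct.basis K(p, K) ((E.exists_basis hαβ).choose.map g) :)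
  basis_apply s i := by
    refine (Algebra.TensorProduct.basis_apply _ _).trans ?_
    rw [Module.Basis.map_apply, (E.exists_basis hαβ).choose_spec]
    rfl

end BaseChange

namespace Frame

variable {p : ℕ} [Fact p.Prime] {K : Type*} [Field K] [CharP K p] [PerfectRing K p]
variable {X : Type*} [AddCommGroup X] [WittVector.Isocrystal p K X]
variable [Module (WittVector p K) X] [IsScalarTower (WittVector p K) K(p, K) X]
variable {ι : Type*} [Fintype ι] [LinearOrder ι] {m n : ι → ℕ} {B : Frame p K X m n}
variable {M : Submodule (WittVector p K) X}

theorem Leads.exists_expands (hM : M ≤ B.lattice) {u : ι × ℕ} (h : B.Leads M u) :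
    ∃ x ∈ M, ∃ b, B.Expands b x ∧ b u.1 u.2 ≠ 0 ∧
      ∀ t l, t < u.1 ∨ t = u.1 ∧ l < u.2 → b t l = 0 := by
  obtain ⟨x, hx, hZ, a, ha, hl⟩ := h
  obtain ⟨b, hb⟩ := B.exists_expands (hM hx)
  refine ⟨x, hx, b, hb, by rwa [hb.eq_of_lead hl], ?_⟩
  rintro t l (ht | ⟨rfl, ht⟩)
  · exact hb.mem_U_iff.1 (mem_Z.1 hZ t ht) l
  · exact hb.eq_zero_of_mem_G hl.mem_G l ht

theorem Expands.leads {x : X} (hx : x ∈ M) {b : ι → ℕ → K} (hb : B.Expands b x) {u : ι × ℕ}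
    (h : b u.1 u.2 ≠ 0) (h0 : ∀ t l, t < u.1 ∨ t = u.1 ∧ l < u.2 → b t l = 0) : B.Leads M u :=
  ⟨x, hx, mem_Z.2 fun t ht => hb.mem_U_iff.2 fun l => h0 t l (Or.inl ht), _, h,
    hb.lead fun l hl => h0 _ l (Or.inr ⟨rfl, hl⟩)⟩

theorem isLattice (hM : M ≤ B.lattice)
    (hN : ∃ N : ℕ, ∀ y ∈ B.lattice, (p : WittVector p K) ^ N • y ∈ M) : M.IsLattice K(p, K) := by
  obtain ⟨N, hN⟩ := hN
  refine ⟨B.fg_of_le_lattice hM, ?_⟩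
  rw [eq_top_iff, ← B.basis.span_eq, Submodule.span_le]
  rintro _ ⟨⟨t, i⟩, rfl⟩
  rw [B.basis_apply]
  have h := Submodule.subset_span (R := K(p, K)) (hN _ (B.e_mem_lattice t i))
  rw [witt_smul_eq, map_pow, map_natCast] at h
  exact (Submodule.smul_mem_iff _
    (pow_ne_zero _ (WittVector.FractionRing.p_nonzero p K))).1 h

end Frame

/-! ### Assembly of the theorem. -/

section Main

variable {p : ℕ} [Fact p.Prime] {k : Type*} [Field k] [CharP k p] [PerfectRing k p]
variable {K : Type*} [Field K] [CharP K p] [PerfectRing K p] [Algebra k K]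
variable {N : Type*} [AddCommGroup N] [WittVector.Isocrystal p k N]
variable {D : SlopeData} (E : Decomposition p k N D) {α β : Fin D.r → ℤ}
  (hαβ : ∀ j, α j * (D.h j : ℤ) + β j * (D.m j : ℤ) = 1)
  {g : N ≃ₗ[K(p, k)] N} (hg : ∀ x : N, g (F p k N x) = F p k N (g x))

/-- Convergence is tested with M₀, the lattice of the frame for g = 1, while the terms belong to the
frame of g; `Frame.expands_iff` permits two different lattices for this purpose. -/
theorem Decomposition.hasExpansion_iff {b : D.Slot → ℕ → K} {x : BaseChange p k K N} :
    E.HasExpansion α β g b x ↔ (E.frame K hαβ g hg).Expands b x := by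
  rw [(E.frame K hαβ g hg).expands_iff (E.frame K hαβ (LinearEquiv.refl _ _) fun _ => rfl)]
  rfl

attribute [local instance] SlopeData.slotOrder

section Generic

variable {X : Type*} [AddCommGroup X] [WittVector.Isocrystal p K X]
variable [Module (WittVector p K) X] [IsScalarTower (WittVector p K) K(p, K) X]
variable {B : Frame p K X (fun s : D.Slot => D.m s.1) fun s => D.n s.1}

theorem Frame.leads_iff_notMem_I {a : D.Slot → ℕ → K} (ha : SlopeData.LeadingIndependent p a)
    {v : X} (hv : B.Expands a v) (u : D.Index) :
    B.Leads (dieudonneSpan p v) u ↔ u ∉ D.I := by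
  classical
  obtain ⟨s, l⟩ := u
  have hmn : ∀ t : D.Slot, (D.m t.1).Coprime (D.n t.1) := fun t => D.coprime t.1
  have hslope : ∀ s t : D.Slot, D.slotOrder.le s t → D.m s.1 * D.n t.1 ≤ D.m t.1 * D.n s.1 :=
    fun s t h => SlopeData.mul_le_mul_of_slotOrder_le h
  have h : ∑ t : D.Slot with D.SlotLt t s, D.m t.1 * D.n s.1 =
      (∑ t ∈ Finset.univ.filter (fun t => D.slotOrder.lt t s), D.m t.1) * D.n s.1 := by
    rw [Finset.sum_mul]
    exact Finset.sum_congr (Finset.filter_congr fun t _ => (D.slotOrder_lt t s).symm) fun _ _ => rfl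
  have h1 := Frame.leads_dieudonneSpan_iff (B := B) hmn hslope hv.mem_lattice
    (fun t => hv.lead_zero t) ((SlopeData.leadingIndependent_iff p).1 ha) s l
  rw [D.mem_I_iff, h, h1]

end Generic

theorem Decomposition.relVol_eq {M : Submodule (WittVector p K) (BaseChange p k K N)}
    (hM : M ≤ (E.frame K hαβ g hg).lattice) {c : ℕ}
    (hc : Module.length (WittVector p K)
      ((E.frame K hαβ g hg).lattice ⧸ M.submoduleOf (E.frame K hαβ g hg).lattice) = c)
    (hN : ∃ L : ℕ, ∀ y ∈ (E.frame K hαβ g hg).lattice, (p : WittVector p K) ^ L • y ∈ M) :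
    relVol (E.M₀ α β K) M = vp p k (LinearMap.det (g : N →ₗ[K(p, k)] N)) + c := by
  have hfin : Module.Finite K(p, k) N := .of_basis (E.exists_basis hαβ).choose
  set B₀ := E.frame K hαβ (LinearEquiv.refl _ _) fun _ => rfl with hB₀
  set B := E.frame K hαβ g hg with hB
  obtain ⟨L, hL⟩ := hN
  obtain ⟨L', hL'⟩ := B.exists_p_pow_smul_lattice_le B₀
  have h := Dieudonne.relVol_eq B₀.basis B.basis (autBaseChange p k K N g) (fun ⟨s, i⟩ => by
      rw [B₀.basis_apply, B.basis_apply]; rfl) B₀.lattice_eq_span_basis B.lattice_eq_span_basis hM hc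
    ⟨L + L', fun y hy => by rw [pow_add, mul_smul]; exact hL _ (hL' y hy)⟩
  rw [det_autBaseChange, vp_fracMap g.isUnit_det'.ne_zero] at h
  exact h

end Main
end Dieudonne

end

attribute [local instance] Dieudonne.SlopeData.slotOrder in
theorem mainTheorem7 (p : ℕ) [Fact p.Prime]
    (k : Type*) [Field k] [IsAlgClosed k] [CharP k p]
    (K : Type*) [Field K] [CharP K p] [PerfectRing K p] [Algebra k K]
    (N : Type*) [AddCommGroup N] [WittVector.Isocrystal p k N]
    (D : Dieudonne.SlopeData) (E : Dieudonne.Decomposition p k N D)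
    (α β : Fin D.r → ℤ) (hαβ : ∀ j, α j * (D.h j : ℤ) + β j * (D.m j : ℤ) = 1)
    (g : N ≃ₗ[K(p, k)] N) (hg : ∀ x : N, g (Dieudonne.F p k N x) = Dieudonne.F p k N (g x))
    (a : D.Slot → ℕ → K) (ha : Dieudonne.SlopeData.LeadingIndependent p a)
    (v : Dieudonne.BaseChange p k K N) (hv : E.HasExpansion α β g a v)
    (M : Submodule (WittVector p K) (Dieudonne.BaseChange p k K N))
    (hM : M = Dieudonne.dieudonneSpan p v) :
    -- (i)
    M.IsLattice K(p, K) ∧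
    -- (ii)
    (Dieudonne.relVol (E.M₀ α β K) M : ℚ) =
      (Dieudonne.vp p k (LinearMap.det (g : N →ₗ[K(p, k)] N)) : ℚ) + D.c ∧
    -- (iii)
    (D.I.Finite ∧ (D.I.ncard : ℚ) = D.c ∧ (D.first, 0) ∉ D.I ∧
      (∀ s : D.Slot, s ≠ D.first → (s, 0) ∈ D.I) ∧
      (∃ w, E.IsNormalised α β g M w) ∧
      (∀ w, E.IsNormalised α β g M w → Dieudonne.dieudonneSpan p w = M) ∧
      (∀ w w', E.IsNormalised α β g M w → E.IsNormalised α β g M w' → w = w')) ∧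
    -- (iv)
    (∀ x ∈ M, ∃ b : D.Slot → ℕ → K, E.HasExpansion α β g b x) ∧
    (∀ x ∈ M, ∀ b : D.Slot → ℕ → K, E.HasExpansion α β g b x →
      ∀ t : D.Index, Dieudonne.SlopeData.IsLeading b t → t ∉ D.I) ∧
    -- (v)
    (∀ t : D.Index, t ∉ D.I → ∃ x ∈ M, ∃ b : D.Slot → ℕ → K,
      E.HasExpansion α β g b x ∧ Dieudonne.SlopeData.IsLeading b t) := by
  classical
  subst hM
  have hexp := fun (b : D.Slot → ℕ → K) x => E.hasExpansion_iff (K := K) hαβ hg (b := b) (x := x)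
  have hind := fun b : D.Slot → ℕ → K =>
    Dieudonne.SlopeData.leadingIndependent_iff (D := D) p (a := b)
  rw [hexp] at hv
  have hlead := Dieudonne.Frame.leads_iff_notMem_I ha hv
  obtain ⟨J, hJI, hJc⟩ := D.exists_finset_I
  have hJ : ∀ u, (E.frame K hαβ g hg).Leads (Dieudonne.dieudonneSpan p v) u ↔ u ∉ J := fun u => by
    rw [hlead, hJI]
  have hle : Dieudonne.dieudonneSpan p v ≤ (E.frame K hαβ g hg).lattice :=
    Dieudonne.Frame.dieudonneSpan_le_lattice hv.mem_lattice
  obtain ⟨hN, -, hlen⟩ := Dieudonne.Frame.finite_colength J _ hle hJ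
  have hlt : ∀ (b : D.Slot → ℕ → K) (u : D.Index), Dieudonne.SlopeData.IsLeading b u ↔
      b u.1 u.2 ≠ 0 ∧ ∀ t l, D.slotOrder.lt t u.1 ∨ t = u.1 ∧ l < u.2 → b t l = 0 := fun b u =>
    and_congr Iff.rfl ⟨fun h t l htl => h (t, l) (htl.imp_left (D.slotOrder_lt _ _).1),
      fun h t ht => h t.1 t.2 (ht.imp_left (D.slotOrder_lt _ _).2)⟩
  have hmn : ∀ t : D.Slot, (D.m t.1).Coprime (D.n t.1) := fun t => D.coprime t.1
  have hslope : ∀ s t : D.Slot, D.slotOrder.le s t → D.m s.1 * D.n t.1 ≤ D.m t.1 * D.n s.1 :=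
    fun s t h => Dieudonne.SlopeData.mul_le_mul_of_slotOrder_le h
  refine ⟨Dieudonne.Frame.isLattice hle hN, ?_, ⟨D.finite_I, D.ncard_I, D.first_notMem_I,
    fun s hs => D.mem_I_of_ne_first hs, ?_, ?_, ?_⟩, ?_, ?_, ?_⟩
  · rw [E.relVol_eq hαβ hg hle hlen hN, ← hJc]
    push_cast
    rfl
  · obtain ⟨w, hw, b, hb, hbi, hb1, hb0⟩ := Dieudonne.Frame.exists_normalised hv
      ((hind a).1 ha) hJ (fun h => D.first_notMem_I ((hJI _).1 h))
    exact ⟨w, hw, b, (hexp b w).2 hb, (hind b).2 hbi, hb1,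
      fun t ht htI => hb0 t ht fun h => htI ((hJI _).1 h)⟩
  · rintro w ⟨hw, b, hb, hbi, -, -⟩
    exact Dieudonne.Frame.dieudonneSpan_eq_of_indep hmn hslope hv ((hind a).1 ha)
      ((hexp b w).1 hb) ((hind b).1 hbi) hw hJ
  · rintro w w' ⟨hw, b, hb, -, hb1, hb0⟩ ⟨hw', b', hb', -, hb1', hb0'⟩
    exact Dieudonne.Frame.eq_of_normalised (fun u => (hJ u).1) hw hw' ((hexp b w).1 hb)
      ((hexp b' w').1 hb') hb1 hb1' (fun u hu huJ => hb0 u hu fun h => huJ ((hJI _).2 h))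
      fun u hu huJ => hb0' u hu fun h => huJ ((hJI _).2 h)
  · intro x hx
    obtain ⟨b, hb⟩ := (E.frame K hαβ g hg).exists_expands (hle hx)
    exact ⟨b, (hexp b x).2 hb⟩
  · intro x hx b hb t ht
    rw [hlt] at ht
    exact (hlead t).1 (((hexp b x).1 hb).leads hx ht.1 ht.2)
  · intro t ht
    obtain ⟨x, hx, b, hb, h1, h2⟩ := ((hlead t).2 ht).exists_expands hle
    exact ⟨x, hx, b, (hexp b x).2 hb, (hlt b t).2 ⟨h1, h2⟩⟩
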